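/- **Theorem 4.3.** Let $d\ge 2$, $\mathbb I=[0,1]$, and let $C,C_1,C_2,\ldots$ be $d$-dimensional Archimedean copulas with normalized generators $\psi,\psi_1,\psi_2,\ldots$. That is, each generator $\psi:[0,\infty)\to\mathbb I$ is continuous and non-increasing with $\psi(0)=1$, $\psi(1)=\tfrac12$, $\lim_{z\to\infty}\psi(z)=0$ (put $\psi(\infty)=0$), it is strictly decreasing on $[0,\inf\{z\in[0,\infty]:\psi(z)=0\}]$, and, with the pseudoinverse $\varphi(x)=\inf\{z\in[0,\infty]:\psi(z)\le x\}$, $C(\mathbf x)=\psi(\varphi(x_1)+\cdots+\varphi(x_d))$ for all $\mathbf x\in\mathbb I^d$; similarly for $C_n,\psi_n,\varphi_n$. For a copula $A$ let $\mu_A$ be its probability measure on $\mathbb I^d$, let $K_A(x,\cdot)$ denote (a version of) the conditional distribution under $\mu_A$ of the last $d-1$ coordinates given that the first one equals $x$ (the $1$-Markov kernel), and put $$D_1(A,B)=\int_{\mathbb I}\int_{\mathbb I^{d-1}}|K_A(x,[\mathbf 0,\mathbf y])-K_B(x,[\mathbf 0,\mathbf y])|\,d\mathbf y\,dx,$$ $$D_2(A,B)=\Big(\int_{\mathbb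 I}\int_{\mathbb I^{d-1}}(K_A(x,[\mathbf 0,\mathbf y])-K_B(x,[\mathbf 0,\mathbf y]))^2\,d\mathbf y\,dx\Big)^{1/2},$$ $$D_\infty(A,B)=\sup_{\mathbf y\in\mathbb I^{d-1}}\int_{\mathbb I}|K_A(x,[\mathbf 0,\mathbf y])-K_B(x,[\mathbf 0,\mathbf y])|\,dx.$$ Let $D^-$ denote the left derivative, and let $c^{1:m}$ be the density with respect to Lebesgue measure on $\mathbb I^m$ of the marginal of $C$ in the first $m$ coordinates ($c_n^{1:m}$ for $C_n$). Then the following assertions are equivalent: 1. $C_n\to C$ uniformly on $\mathbb I^d$; 2. for all $1\le i<j\le d$ the bivariate marginals satisfy $C_n^{ij}\to C^{ij}$ uniformly on $\mathbb I^2$; 3. $\varphi_n\to\varphi$ pointwise on $(0,1]$; 4. $\psi_n\to\psi$ uniformly on $[0,\infty)$; 5. $\psi_n^{(m)}\to\psi^{(m)}$ pointwise on $(0,\infty)$ for every $m\in\{1,\ldots,d-2\}$, and $D^-\psi_n^{(d-2)}(z)\to D^-\psi^{(d-2)}(z)$ at every continuity point $z\in(0,\infty)$ of $D^-\psi^{(d-2)}$;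 6. $D_1(C_n,C)\to0$; 7. $D_2(C_n,C)\to0$; 8. $D_\infty(C_n,C)\to0$; 9. $(C_n)$ converges $1$-weakly conditional to $C$: there is a Borel set $\Lambda\subseteq\mathbb I$ of full measure for the first one-dimensional marginal of $\mu_C$ such that for every $x\in\Lambda$ the probability measures $K_{C_n}(x,\cdot)$ converge weakly to $K_C(x,\cdot)$. If $d\ge3$, these are also equivalent to: 10. for every $m\in\{2,\ldots,d-1\}$, $c_n^{1:m}\to c^{1:m}$ almost everywhere on $\mathbb I^m$. -/

import Mathlib

open MeasureTheory ProbabilityTheory Filter Topology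
open scoped unitInterval ENNReal

/-- A `d`-dimensional copula, given by its `d`-stochastic measure `μ_C`: a probability measure on
`I^d`, `I = [0,1]`, all of whose one-dimensional marginals are the uniform distribution. -/
structure Copula (d : ℕ) where
  /-- The `d`-stochastic measure `μ_C`. -/
  measure : Measure (Fin d → I)
  isProbabilityMeasure : IsProbabilityMeasure measure
  map_eval : ∀ i : Fin d, measure.map (fun x => x i) = volume

namespace Copula

instance {d : ℕ} (C : Copula d) : IsProbabilityMeasure C.measure := C.isProbabilityMeasure

/-- The copula as a function on `I^d`: `C(x) = μ_C([0,x])` (in `I^d`, `[0,x]` is `Set.Iic x`). -/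
noncomputable def cdf {d : ℕ} (C : Copula d) (x : Fin d → I) : ℝ :=
  C.measure.real (Set.Iic x)

/-- The `i`-`j`-marginal `C^{ij}(s,t) = C(1,…,1,s,1,…,1,t,1,…,1)`, with `s` at place `i` and `t` at
place `j`. -/
noncomputable def pairMarginal {d : ℕ} (C : Copula d) (i j : Fin d) (q : I × I) : ℝ :=
  C.cdf (Function.update (Function.update (fun _ => 1) i q.1) j q.2)

/-- The measure `μ_{C^{1:m}}` of the marginal copula of the first `m` coordinates. -/
noncomputable def firstMarginal {d : ℕ} (C : Copula d) (m : ℕ) (hm : m ≤ d) :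
    Measure (Fin m → I) :=
  C.measure.map (fun x i => x (Fin.castLE hm i))

/-- The density `c^{1:m}` of the marginal copula of the first `m` coordinates with respect to
Lebesgue measure on `I^m` (as a Radon-Nikodym derivative). -/
noncomputable def firstMarginalDensity {d : ℕ} (C : Copula d) (m : ℕ) (hm : m ≤ d) :
    (Fin m → I) → ℝ≥0∞ :=
  (C.firstMarginal m hm).rnDeriv volume

/-- The measure `μ_C` under the identification `I^(m+1) = I × I^m` that splits off the first
coordinate. -/
noncomputable def splitMeasure {m : ℕ} (C : Copula (m + 1)) : Measure (I × (Fin m → I)) :=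
  C.measure.map (fun x => (x 0, fun i => x i.succ))

instance {m : ℕ} (C : Copula (m + 1)) : IsProbabilityMeasure C.splitMeasure :=
  Measure.isProbabilityMeasure_map (by fun_prop)

/-- (A version of) the 1-Markov kernel `K_C` of the copula `C`: the regular conditional
distribution of the last `m` coordinates given the first one. -/
noncomputable def kernel {m : ℕ} (C : Copula (m + 1)) : Kernel I (Fin m → I) :=
  C.splitMeasure.condKernel

instance {m : ℕ} (C : Copula (m + 1)) : IsMarkovKernel C.kernel := by
  unfold kernel; infer_instance

/-- The probability measure `K_C(x, ·)` on `I^m`. -/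
noncomputable def kernelAt {m : ℕ} (C : Copula (m + 1)) (x : I) : ProbabilityMeasure (Fin m → I) :=
  ⟨C.kernel x, inferInstance⟩

/-- `K_C(x, [0,y])`. -/
noncomputable def kernelCdf {m : ℕ} (C : Copula (m + 1)) (x : I) (y : Fin m → I) : ℝ :=
  (C.kernel x).real (Set.Iic y)

/-- The metric `D₁`. -/
noncomputable def D1 {m : ℕ} (A B : Copula (m + 1)) : ℝ :=
  ∫ z : I × (Fin m → I), |A.kernelCdf z.1 z.2 - B.kernelCdf z.1 z.2|

/-- The metric `D₂`. -/
noncomputable def D2 {m : ℕ} (A B : Copula (m + 1)) : ℝ :=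
  Real.sqrt (∫ z : I × (Fin m → I), (A.kernelCdf z.1 z.2 - B.kernelCdf z.1 z.2) ^ 2)

/-- The metric `D_∞`. -/
noncomputable def DInf {m : ℕ} (A B : Copula (m + 1)) : ℝ :=
  ⨆ y : Fin m → I, ∫ x : I, |A.kernelCdf x y - B.kernelCdf x y|

/-- 1-weak conditional convergence of `(C_n)` to `C`. -/
def TendstoWeaklyConditional {m : ℕ} (Cs : ℕ → Copula (m + 1)) (C : Copula (m + 1)) : Prop :=
  ∃ Λ : Set I, MeasurableSet Λ ∧ C.measure.map (fun x => x 0) Λ = 1 ∧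
    ∀ x ∈ Λ, Tendsto (fun n => (Cs n).kernelAt x) atTop (𝓝 (C.kernelAt x))

end Copula

/-- The extension of `ψ : [0,∞) → I` to `[0,∞]` by `ψ(∞) = 0`. Functions on `[0,∞)` are represented
by functions on `ℝ` whose values at negative arguments play no role. -/
noncomputable def genExt (ψ : ℝ → ℝ) (z : ℝ≥0∞) : ℝ :=
  if z = ∞ then 0 else ψ z.toReal

/-- `inf {z ∈ [0,∞] : ψ(z) = 0}`. -/
noncomputable def firstZero (ψ : ℝ → ℝ) : ℝ≥0∞ :=
  sInf {z : ℝ≥0∞ | genExt ψ z = 0}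

/-- Archimedean generators (not necessarily normalized). -/
structure IsArchimedeanGenerator (ψ : ℝ → ℝ) : Prop where
  continuousOn : ContinuousOn ψ (Set.Ici 0)
  antitoneOn : AntitoneOn ψ (Set.Ici 0)
  mapsTo : Set.MapsTo ψ (Set.Ici 0) (Set.Icc 0 1)
  map_zero : ψ 0 = 1
  tendsto_atTop : Tendsto ψ atTop (𝓝 0)
  strictAntiOn : StrictAntiOn (genExt ψ) (Set.Iic (firstZero ψ))

/-- The pseudoinverse `φ : [0,1] → [0,∞]` of a generator, `φ(x) = inf {z ∈ [0,∞] : ψ(z) ≤ x}`. For a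
generator `ψ` it is finite on `(0,1]`, and `φ(0) = inf {z ∈ [0,∞] : ψ(z) = 0}`. -/
noncomputable def pseudoInv (ψ : ℝ → ℝ) (x : I) : ℝ≥0∞ :=
  sInf {z : ℝ≥0∞ | genExt ψ z ≤ x}

/-- `C` is the Archimedean copula with normalized generator `ψ`:
`C(x) = ψ(φ(x₁) + ⋯ + φ(x_d))` for all `x ∈ I^d`, where `ψ(1) = 1/2`. -/
structure Copula.IsArchimedeanWith {d : ℕ} (C : Copula d) (ψ : ℝ → ℝ) : Prop where
  isGenerator : IsArchimedeanGenerator ψ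
  normalized : ψ 1 = 1 / 2
  cdf_eq : ∀ x : Fin d → I, C.cdf x = genExt ψ (∑ i, pseudoInv ψ (x i))

/-- The left derivative `D⁻f`. -/
noncomputable def leftDeriv (f : ℝ → ℝ) (z : ℝ) : ℝ :=
  derivWithin f (Set.Iio z) z

/-! Everything is routed through pointwise convergence `ψ_n → ψ`.

The mass that an Archimedean copula of dimension `p + 2` gives to a box is an iterated difference of
`ψ` (`measureReal_eq_iterDiff`), so the differences of `ψ` up to order `p + 2` are nonnegative.
Hence `(-1)^k ψ^(k)` exists and is convex and decreasing on `(0,∞)` for `k ≤ p`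
(`MultiplyMonotone`), and `ψ^(p)` has a left derivative. Pointwise convergence of convex functions
forces convergence of left derivatives at continuity points of the limit
(`tendsto_negLeftDeriv_of_tendsto`). Applied repeatedly, this gives convergence of all derivatives;
conversely, integrating the first derivative and using `ψ(1) = 1/2` recovers `ψ`.

A single bivariate marginal determines the limit of the generators: it encodes `(ψ a, ψ b) ↦ ψ(a +
b)`, so convergence at the anchor `1` spreads by halving and adding to the dyadic numbers and by
monotonicity to all arguments (`tendsto_generator_of_pairMarginal`).

The substitution `x = ψ(z)` yields explicit formulas: for almost every `x`, `K_C(x,[0,y])` is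
`D⁻ψ(φ(x) + ∑ φ(y_i)) / D⁻ψ(φ(x))` (`kernel_Iic_ae_eq`), and the density of the first `m ≤ p + 1`
coordinates is the `m`-th derivative, up to sign, at `∑ φ(u_i)` divided by `∏ |D⁻ψ(φ(u_i))|`
(`firstMarginal_eq_withDensity`). Discontinuities of the derivatives are countable and are met only
on null sets, so kernels and densities converge almost everywhere.

Back to the copulas: weak conditional convergence gives `D_∞ → 0` by dominated convergence and a
Lipschitz bound in `y` common to all copulas. The three metrics are comparable enough to vanish
together, and `D₁ → 0` controls the distribution functions, which are integrals of the kernels. For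
densities, Fatou's lemma on a set and on its complement gives convergence of the marginal measures.
-/

/-! ### Iterated differences -/

/-- The iterated backward difference `f ↦ f - f(· + h)` with steps `h 0, …, h (k - 1)`. -/
def iterDiff (h : ℕ → ℝ) : ℕ → (ℝ → ℝ) → ℝ → ℝ
  | 0, f, z => f z
  | k + 1, f, z => iterDiff h k f z - iterDiff h k f (z + h k)

/-- All `n`-fold iterated differences of `f` with positive steps are nonnegative on `(0,∞)`. -/
def DiffNonneg (n : ℕ) (f : ℝ → ℝ) : Prop :=
  ∀ h : ℕ → ℝ, (∀ i, 0 < h i) → ∀ z, 0 < z → 0 ≤ iterDiff h n f z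

lemma iterDiff_sub_shift (h : ℕ → ℝ) (k : ℕ) (f : ℝ → ℝ) (a z : ℝ) :
    iterDiff h k (fun z => f z - f (z + a)) z = iterDiff h k f z - iterDiff h k f (z + a) := by
  induction k generalizing z with
  | zero => rfl
  | succ k ih => simp only [iterDiff, ih, add_right_comm z (h k) a]; ring

lemma iterDiff_const_mul (h : ℕ → ℝ) (k : ℕ) (f : ℝ → ℝ) (a z : ℝ) :
    iterDiff h k (fun z => a * f z) z = a * iterDiff h k f z := by
  induction k generalizing z with
  | zero => rfl
  | succ k ih => simp only [iterDiff, ih]; ring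

lemma iterDiff_congr_steps {h h' : ℕ → ℝ} {k : ℕ} (hh : ∀ i < k, h i = h' i) (f : ℝ → ℝ) (z : ℝ) :
    iterDiff h k f z = iterDiff h' k f z := by
  induction k generalizing z with
  | zero => rfl
  | succ k ih =>
    have := fun z => ih (fun i hi => hh i (Nat.lt_succ_of_lt hi)) z
    simp only [iterDiff, this, hh k (Nat.lt_succ_self k)]

lemma tendsto_iterDiff {ι : Type*} {l : Filter ι} {F : ι → ℝ → ℝ} {f : ℝ → ℝ}
    (hF : ∀ z, 0 < z → Tendsto (fun i => F i z) l (𝓝 (f z))) {h : ℕ → ℝ} (hh : ∀ i, 0 < h i)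
    (k : ℕ) {z : ℝ} (hz : 0 < z) :
    Tendsto (fun i => iterDiff h k (F i) z) l (𝓝 (iterDiff h k f z)) := by
  induction k generalizing z with
  | zero => exact hF z hz
  | succ k ih => exact (ih hz).sub (ih (add_pos hz (hh k)))

lemma DiffNonneg.sub_shift {n : ℕ} {f : ℝ → ℝ} (hf : DiffNonneg (n + 1) f) {a : ℝ} (ha : 0 < a) :
    DiffNonneg n (fun z => f z - f (z + a)) := by
  intro h hh z hz
  have key := hf (Function.update h n a) (fun i => by
    by_cases hi : i = n
    · simpa [hi] using ha
    · simpa [hi] using hh i) z hz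
  have e : ∀ z, iterDiff (Function.update h n a) n f z = iterDiff h n f z := fun z =>
    iterDiff_congr_steps (fun i hi => by simp [hi.ne]) f z
  simpa [iterDiff, e, iterDiff_sub_shift] using key

lemma DiffNonneg.of_sub_shift {n : ℕ} {f : ℝ → ℝ}
    (hf : ∀ a, 0 < a → DiffNonneg n (fun z => f z - f (z + a))) : DiffNonneg (n + 1) f := by
  intro h hh z hz
  simpa [iterDiff, iterDiff_sub_shift] using hf (h n) (hh n) h hh z hz

lemma DiffNonneg.of_tendsto {ι : Type*} {l : Filter ι} [l.NeBot] {F : ι → ℝ → ℝ} {f : ℝ → ℝ}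
    {n : ℕ} (hF : ∀ z, 0 < z → Tendsto (fun i => F i z) l (𝓝 (f z)))
    (h : ∀ᶠ i in l, DiffNonneg n (F i)) : DiffNonneg n f := fun s hs z hz =>
  ge_of_tendsto (tendsto_iterDiff hF hs n hz) (h.mono fun _ hi => hi s hs z hz)

/-- Sending one step to infinity kills the shifted term, because `f` vanishes at infinity. -/
lemma DiffNonneg.pred {n : ℕ} {f : ℝ → ℝ} (hf : DiffNonneg (n + 1) f)
    (h0 : Tendsto f atTop (𝓝 0)) : DiffNonneg n f := by
  induction n generalizing f with
  | zero =>
    intro h _ z hz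
    have h1 : ∀ᶠ a in atTop, f (z + a) ≤ f z := by
      filter_upwards [eventually_gt_atTop 0] with a ha
      have := hf (fun _ => a) (fun _ => ha) z hz
      simpa [iterDiff] using this
    exact le_of_tendsto (h0.comp (tendsto_atTop_add_const_left _ z tendsto_id)) h1
  | succ n ih =>
    refine DiffNonneg.of_sub_shift fun a ha => ih (hf.sub_shift ha) ?_
    simpa using h0.sub (h0.comp (tendsto_atTop_add_const_right _ a tendsto_id))

lemma DiffNonneg.of_le {m n : ℕ} {f : ℝ → ℝ} (hf : DiffNonneg n f)
    (h0 : Tendsto f atTop (𝓝 0)) (hmn : m ≤ n) : DiffNonneg m f := by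
  induction n, hmn using Nat.le_induction with
  | base => exact hf
  | succ n _ ih => exact ih (hf.pred h0)

lemma DiffNonneg.antitoneOn {f : ℝ → ℝ} (hf : DiffNonneg 1 f) : AntitoneOn f (Set.Ioi 0) := by
  intro x hx y _ hxy
  rcases hxy.eq_or_lt with rfl | hxy
  · exact le_rfl
  · have := hf (fun _ => y - x) (fun _ => sub_pos.2 hxy) x hx
    simpa [iterDiff] using this

/-- Suppose the maximum is positive and let `c` be the leftmost point where it is attained. The
midpoint inequality at `c` forces the maximum at `c - h` as well, contradicting the choice of `c`.
-/
lemma exists_convex_violation {f : ℝ → ℝ} {x y : ℝ} (hxy : x < y)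
    (hf : ContinuousOn f (Set.Icc x y)) (hx : f x = 0) (hy : f y = 0)
    (hmid : ∀ c h, 0 < h → x ≤ c - h → c + h ≤ y → 2 * f c ≤ f (c - h) + f (c + h))
    {z : ℝ} (hz : z ∈ Set.Icc x y) : f z ≤ 0 := by
  by_contra! hpos
  obtain ⟨m, hm, hmax⟩ := isCompact_Icc.exists_isMaxOn ⟨z, hz⟩ hf
  have hM : 0 < f m := hpos.trans_le (hmax hz)
  have hK : IsCompact (Set.Icc x y ∩ f ⁻¹' {f m}) :=
    isCompact_Icc.of_isClosed_subset (hf.preimage_isClosed_of_isClosed isClosed_Icc isClosed_singleton)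
      Set.inter_subset_left
  obtain ⟨c, ⟨hc, hfc⟩, hcmin⟩ := hK.exists_isLeast ⟨m, hm, rfl⟩
  simp only [Set.mem_preimage, Set.mem_singleton_iff] at hfc
  have hxc : x < c := lt_of_le_of_ne hc.1 (by rintro rfl; linarith)
  have hcy : c < y := lt_of_le_of_ne hc.2 (by rintro rfl; linarith)
  set h := min (c - x) (y - c) with hh
  have h0 : 0 < h := lt_min (by linarith) (by linarith)
  have h1 : h ≤ c - x := min_le_left _ _
  have h2 : h ≤ y - c := min_le_right _ _
  have a1 : f (c + h) ≤ f m := hmax ⟨by linarith, by linarith⟩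
  have a2 : f (c - h) ≤ f m := hmax ⟨by linarith, by linarith⟩
  have a3 := hmid c h h0 (by linarith) (by linarith)
  have a4 : f (c - h) = f m := by linarith
  have := hcmin ⟨⟨by linarith, by linarith⟩, a4⟩
  linarith

/-- Subtracting the chord, which is affine, preserves the midpoint inequality and reduces to
`exists_convex_violation`. -/
lemma convexOn_of_midpoint_le {f : ℝ → ℝ} (hf : ContinuousOn f (Set.Ioi 0))
    (hmid : ∀ c h, 0 < h → 0 < c - h → 2 * f c ≤ f (c - h) + f (c + h)) :
    ConvexOn ℝ (Set.Ioi 0) f := by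
  refine LinearOrder.convexOn_of_lt (convex_Ioi 0) fun x hx y hy hxy a b ha hb hab => ?_
  simp only [Set.mem_Ioi] at hx hy
  have hyx : 0 < y - x := by linarith
  set s := (f y - f x) / (y - x) with hs
  have hs' : s * (y - x) = f y - f x := by rw [hs]; field_simp
  have := exists_convex_violation (f := fun t => f t - (f x + s * (t - x))) hxy
    ((hf.mono fun t ht => hx.trans_le ht.1).sub (by fun_prop)) (by simp) (by simp [hs'])
    (fun c h hh h1 h2 => by
      have := hmid c h hh (by linarith)
      linarith)
    (z := a • x + b • y) ⟨by simp only [smul_eq_mul]; nlinarith, by simp only [smul_eq_mul]; nlinarith⟩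
  simp only [smul_eq_mul] at this ⊢
  have e : s * (a * x + b * y - x) = b * (f y - f x) := by
    rw [← hs']
    have : a = 1 - b := by linarith
    rw [this]; ring
  rw [e] at this
  have ha' : a = 1 - b := by linarith
  rw [ha'] at this ⊢
  linarith

lemma DiffNonneg.convexOn {f : ℝ → ℝ} (hf : DiffNonneg 2 f) (hc : ContinuousOn f (Set.Ioi 0)) :
    ConvexOn ℝ (Set.Ioi 0) f := by
  refine convexOn_of_midpoint_le hc fun c h hh hch => ?_
  have := hf (fun _ => h) (fun _ => hh) (c - h) hch
  simp only [iterDiff, sub_add_cancel] at this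
  linarith

/-! ### Left derivatives of convex functions -/

/-- A convex antitone function on `(0,∞)` that vanishes at infinity. -/
structure ConvexDecay (f : ℝ → ℝ) : Prop where
  convexOn : ConvexOn ℝ (Set.Ioi 0) f
  antitoneOn : AntitoneOn f (Set.Ioi 0)
  tendsto : Tendsto f atTop (𝓝 0)

open Classical in
/-- The negative left derivative on `(0,∞)`, extended by `0`. -/
noncomputable def negLeftDeriv (f : ℝ → ℝ) (z : ℝ) : ℝ :=
  if 0 < z then -leftDeriv f z else 0

lemma negLeftDeriv_of_pos (f : ℝ → ℝ) {z : ℝ} (hz : 0 < z) :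
    negLeftDeriv f z = -leftDeriv f z := if_pos hz

lemma leftDeriv_congr {f g : ℝ → ℝ} (h : ∀ z, 0 < z → f z = g z) {z : ℝ} (hz : 0 < z) :
    leftDeriv f z = leftDeriv g z := by
  have : f =ᶠ[𝓝 z] g := by
    filter_upwards [Ioi_mem_nhds hz] with w hw using h w hw
  exact (this.filter_mono nhdsWithin_le_nhds).derivWithin_eq this.self_of_nhds

namespace ConvexDecay

variable {f : ℝ → ℝ}

lemma continuousOn (hf : ConvexDecay f) : ContinuousOn f (Set.Ioi 0) :=
  hf.convexOn.continuousOn isOpen_Ioi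

lemma slope_le_negLeftDeriv (hf : ConvexDecay f) {x y : ℝ} (hx : 0 < x) (hxy : x < y) :
    (f x - f y) / (y - x) ≤ negLeftDeriv f x := by
  have h1 := hf.convexOn.rightDeriv_le_slope_of_mem_interior (x := x) (y := y)
    (by simpa using hx) (hx.trans hxy) hxy
  have h2 := hf.convexOn.leftDeriv_le_rightDeriv_of_mem_interior (x := x) (by simpa using hx)
  rw [negLeftDeriv_of_pos f hx, leftDeriv]
  have : (f x - f y) / (y - x) = - slope f x y := by
    rw [slope_def_field, ← neg_div, neg_sub]
  linarith

lemma negLeftDeriv_le_slope (hf : ConvexDecay f) {x y : ℝ} (hx : 0 < x) (hxy : x < y) :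
    negLeftDeriv f y ≤ (f x - f y) / (y - x) := by
  have h1 := hf.convexOn.slope_le_leftDeriv_of_mem_interior (x := x) (y := y)
    hx (by simpa using hx.trans hxy) hxy
  rw [negLeftDeriv_of_pos f (hx.trans hxy), leftDeriv]
  have : (f x - f y) / (y - x) = - slope f x y := by
    rw [slope_def_field, ← neg_div, neg_sub]
  linarith

lemma antitoneOn_negLeftDeriv (hf : ConvexDecay f) : AntitoneOn (negLeftDeriv f) (Set.Ioi 0) := by
  intro x hx y hy hxy
  have := hf.convexOn.monotoneOn_leftDeriv (by simpa using hx) (by simpa using hy) hxy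
  rw [negLeftDeriv_of_pos f hx, negLeftDeriv_of_pos f hy]
  exact neg_le_neg this

lemma negLeftDeriv_nonneg (hf : ConvexDecay f) (z : ℝ) : 0 ≤ negLeftDeriv f z := by
  by_cases hz : 0 < z
  · refine le_trans (div_nonneg (sub_nonneg.2 ?_) ?_) (hf.slope_le_negLeftDeriv hz (lt_add_one z))
    · exact hf.antitoneOn hz (by simp only [Set.mem_Ioi]; linarith) (by linarith)
    · linarith
  · simp [negLeftDeriv, hz]

lemma tendsto_negLeftDeriv (hf : ConvexDecay f) : Tendsto (negLeftDeriv f) atTop (𝓝 0) := by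
  have h : Tendsto (fun z => f (z - 1) - f z) atTop (𝓝 0) := by
    simpa [sub_eq_add_neg] using (hf.tendsto.comp (tendsto_atTop_add_const_right _ (-1) tendsto_id)).sub hf.tendsto
  refine squeeze_zero' (Eventually.of_forall hf.negLeftDeriv_nonneg) ?_ h
  filter_upwards [eventually_gt_atTop 1] with z hz
  simpa using hf.negLeftDeriv_le_slope (x := z - 1) (y := z) (by linarith) (by linarith)

/-- The right derivative at `z` is at most the slope over `[z, w]`, which is at most the left
derivative at `w`. Letting `w ↓ z`, continuity of the left derivative closes the gap between the
one-sided derivatives. -/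
lemma hasDerivAt (hf : ConvexDecay f) {z : ℝ} (hz : 0 < z)
    (hc : ContinuousAt (negLeftDeriv f) z) : HasDerivAt f (-negLeftDeriv f z) z := by
  have hz' : z ∈ interior (Set.Ioi (0:ℝ)) := by simpa using hz
  have hl := hf.convexOn.hasDerivWithinAt_leftDeriv_of_mem_interior hz'
  have hr := hf.convexOn.hasDerivWithinAt_rightDeriv_of_mem_interior hz'
  have e : derivWithin f (Set.Ioi z) z = derivWithin f (Set.Iio z) z := by
    refine le_antisymm ?_ (hf.convexOn.leftDeriv_le_rightDeriv_of_mem_interior hz')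
    have hc' : Tendsto (fun w => -negLeftDeriv f w) (𝓝[>] z) (𝓝 (-negLeftDeriv f z)) :=
      hc.neg.tendsto.mono_left nhdsWithin_le_nhds
    have hle : derivWithin f (Set.Ioi z) z ≤ -negLeftDeriv f z := by
      refine ge_of_tendsto hc' ?_
      filter_upwards [self_mem_nhdsWithin] with w (hw : z < w)
      have h1 := hf.convexOn.rightDeriv_le_slope_of_mem_interior hz' (hz.trans hw) hw
      have h2 := hf.negLeftDeriv_le_slope hz hw
      have : (f z - f w) / (w - z) = - slope f z w := by
        rw [slope_def_field, ← neg_div, neg_sub]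
      linarith
    simpa [negLeftDeriv, hz, leftDeriv] using hle
  rw [e] at hr
  have h3 : -negLeftDeriv f z = derivWithin f (Set.Iio z) z := by
    simp [negLeftDeriv, hz, leftDeriv]
  rw [h3, hasDerivAt_iff_tendsto_slope, ← Set.Iio_union_Ioi, nhdsWithin_union, tendsto_sup]
  exact ⟨(hasDerivWithinAt_iff_tendsto_slope' (by simp)).1 hl,
    (hasDerivWithinAt_iff_tendsto_slope' (by simp)).1 hr⟩

lemma countable_not_continuousAt (hf : ConvexDecay f) :
    {z | 0 < z ∧ ¬ContinuousAt (negLeftDeriv f) z}.Countable := by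
  refine hf.antitoneOn_negLeftDeriv.countable_not_continuousWithinAt.mono ?_
  rintro z ⟨hz, h⟩
  refine ⟨hz, fun h' => h (h'.continuousAt (Ioi_mem_nhds hz))⟩

end ConvexDecay

/-- Left derivatives are squeezed between chord slopes, and chord slopes converge. The chords lie
over `[z + e, z + 2e]` and `[z - 2e, z - e]`, so that `w n` has room to move. Moving arguments are
needed because the lemma is applied with `w n` built from `φ_n(x)`. -/
lemma tendsto_negLeftDeriv_of_tendsto {F : ℕ → ℝ → ℝ} {f : ℝ → ℝ} (hF : ∀ n, ConvexDecay (F n))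
    (hf : ConvexDecay f) (h : ∀ z, 0 < z → Tendsto (fun n => F n z) atTop (𝓝 (f z)))
    {w : ℕ → ℝ} {z : ℝ} (hz : 0 < z) (hw : Tendsto w atTop (𝓝 z))
    (hc : ContinuousAt (negLeftDeriv f) z) :
    Tendsto (fun n => negLeftDeriv (F n) (w n)) atTop (𝓝 (negLeftDeriv f z)) := by
  have hT : Tendsto (fun e : ℝ => negLeftDeriv f (z + e)) (𝓝 0) (𝓝 (negLeftDeriv f z)) := by
    have : Tendsto (fun e : ℝ => z + e) (𝓝 0) (𝓝 z) := by
      exact (continuous_const.add continuous_id).tendsto' _ _ (by simp)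
    exact hc.tendsto.comp this
  rw [tendsto_order]
  constructor
  · intro a ha
    have h1 := hT.eventually (lt_mem_nhds ha)
    obtain ⟨e, he, he0⟩ : ∃ e, a < negLeftDeriv f (z + 2 * e) ∧ 0 < e := by
      have h2 : Tendsto (fun e : ℝ => 2 * e) (𝓝[>] 0) (𝓝 0) :=
        ((continuous_const.mul continuous_id).tendsto' _ _ (by simp)).mono_left nhdsWithin_le_nhds
      obtain ⟨e, h⟩ := ((h2.eventually h1).and self_mem_nhdsWithin).exists
      exact ⟨e, h.1, h.2⟩
    have hlim := ((h (z + e) (by linarith)).sub (h (z + 2 * e) (by linarith))).div_const e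
    have hlt : a < (f (z + e) - f (z + 2 * e)) / e := he.trans_le (by
      have := hf.negLeftDeriv_le_slope (x := z + e) (y := z + 2 * e) (by linarith) (by linarith)
      have e1 : z + 2 * e - (z + e) = e := by ring
      rwa [e1] at this)
    filter_upwards [hlim.eventually (lt_mem_nhds hlt), hw.eventually (eventually_lt_nhds (b := z + e) (by linarith)),
      hw.eventually (lt_mem_nhds hz)] with n h1 h2 h3
    refine h1.trans_le ?_
    have h4 := (hF n).slope_le_negLeftDeriv (x := z + e) (y := z + 2 * e) (by linarith) (by linarith)
    have e1 : z + 2 * e - (z + e) = e := by ring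
    rw [e1] at h4
    exact h4.trans ((hF n).antitoneOn_negLeftDeriv h3 (by simp only [Set.mem_Ioi]; linarith) h2.le)
  · intro a ha
    have h1 := hT.eventually (gt_mem_nhds ha)
    obtain ⟨e, he, he0, hez⟩ : ∃ e, negLeftDeriv f (z - 2 * e) < a ∧ 0 < e ∧ 2 * e < z := by
      have h2 : Tendsto (fun e : ℝ => -(2 * e)) (𝓝[>] 0) (𝓝 0) :=
        ((continuous_const.mul continuous_id).neg.tendsto' _ _ (by simp)).mono_left
          nhdsWithin_le_nhds
      have h3 : ∀ᶠ e in 𝓝[>] (0 : ℝ), 0 < e ∧ e < z / 2 :=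
        Ioo_mem_nhdsGT (half_pos hz)
      obtain ⟨e, h, he0, hez⟩ := ((h2.eventually h1).and h3).exists
      exact ⟨e, by simpa [sub_eq_add_neg] using h, he0, by linarith⟩
    have hlim := ((h (z - 2 * e) (by linarith)).sub (h (z - e) (by linarith))).div_const e
    have e1 : z - e - (z - 2 * e) = e := by ring
    have hlt : (f (z - 2 * e) - f (z - e)) / e < a := lt_of_le_of_lt (by
      have := hf.slope_le_negLeftDeriv (x := z - 2 * e) (y := z - e) (by linarith) (by linarith)
      rwa [e1] at this) he
    filter_upwards [hlim.eventually (gt_mem_nhds hlt), hw.eventually (eventually_gt_nhds (b := z - e) (by linarith))]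
      with n h1 h2
    refine lt_of_le_of_lt ?_ h1
    have h4 := (hF n).negLeftDeriv_le_slope (x := z - 2 * e) (y := z - e) (by linarith) (by linarith)
    rw [e1] at h4
    have h5 : 0 < z - e := by linarith
    exact ((hF n).antitoneOn_negLeftDeriv h5 (h5.trans h2) h2.le).trans h4

/-! ### Multiply monotone functions and their derivatives -/

/-- A continuous function on `(0,∞)` vanishing at infinity, all of whose iterated differences of
order at most `n + 2` are nonnegative. -/
structure MultiplyMonotone (n : ℕ) (f : ℝ → ℝ) : Prop where
  continuousOn : ContinuousOn f (Set.Ioi 0)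
  tendsto : Tendsto f atTop (𝓝 0)
  diffNonneg : DiffNonneg (n + 2) f

namespace MultiplyMonotone

variable {n : ℕ} {f : ℝ → ℝ}

lemma convexDecay (hf : MultiplyMonotone n f) : ConvexDecay f where
  convexOn := (hf.diffNonneg.of_le hf.tendsto (by omega)).convexOn hf.continuousOn
  antitoneOn := (hf.diffNonneg.of_le hf.tendsto (by omega)).antitoneOn
  tendsto := hf.tendsto

lemma sub_shift (hf : MultiplyMonotone (n + 1) f) {a : ℝ} (ha : 0 < a) :
    MultiplyMonotone n (fun z => f z - f (z + a)) where
  continuousOn := hf.continuousOn.sub <| hf.continuousOn.comp (by fun_prop) fun z hz => by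
    simp only [Set.mem_Ioi] at hz ⊢; linarith
  tendsto := by
    simpa using hf.tendsto.sub (hf.tendsto.comp (tendsto_atTop_add_const_right _ a tendsto_id))
  diffNonneg := hf.diffNonneg.sub_shift ha

/-- A convex `f` can only have a kink at `z` with slope jumping upwards. Shift it to a point `y < z`
where `f` is differentiable: then `f - f(· + a)` has a downward jump of slope at `y`, although it is
convex too. Hence there is no kink. -/
lemma hasDerivAt (hf : MultiplyMonotone (n + 1) f) {z : ℝ} (hz : 0 < z) :
    HasDerivAt f (-_root_.negLeftDeriv f z) z := by
  have hcd := hf.convexDecay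
  have hmem : ∀ {w : ℝ}, 0 < w → w ∈ interior (Set.Ioi (0:ℝ)) := fun h => by simpa using h
  have hl := fun {w : ℝ} (hw : 0 < w) =>
    hcd.convexOn.hasDerivWithinAt_leftDeriv_of_mem_interior (hmem hw)
  have hr := fun {w : ℝ} (hw : 0 < w) =>
    hcd.convexOn.hasDerivWithinAt_rightDeriv_of_mem_interior (hmem hw)
  obtain ⟨y, ⟨hy0, hyz⟩, hyc⟩ : ∃ y ∈ Set.Ioo 0 z, ContinuousAt (_root_.negLeftDeriv f) y := by
    by_contra! h
    have hsub : Set.Ioo 0 z ⊆ {y | 0 < y ∧ ¬ContinuousAt (_root_.negLeftDeriv f) y} :=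
      fun y hy => ⟨hy.1, h y hy⟩
    exact (Cardinal.Real.Ioo_countable_iff.1 (hcd.countable_not_continuousAt.mono hsub)).not_gt hz
  set a := z - y with ha
  have ha0 : 0 < a := by simp [ha, hyz]
  have hg := (hf.sub_shift ha0).convexDecay
  have hyd := hcd.hasDerivAt hy0 hyc
  have hya : y + a = z := by simp [ha]
  have h1 : HasDerivWithinAt (fun w => f w - f (w + a))
      (-_root_.negLeftDeriv f y - derivWithin f (Set.Iio z) z) (Set.Iio y) y := by
    refine hyd.hasDerivWithinAt.sub ?_
    have := HasDerivWithinAt.scomp (h := fun w => w + a) (s := Set.Iio y) (t' := Set.Iio z) (h' := 1) y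
      (by rw [hya]; exact hl hz) ((hasDerivAt_id y).add_const a).hasDerivWithinAt
      (fun w (hw : w < y) => by simp only [Set.mem_Iio]; linarith)
    simpa [hya, Function.comp_def] using this
  have h2 : HasDerivWithinAt (fun w => f w - f (w + a))
      (-_root_.negLeftDeriv f y - derivWithin f (Set.Ioi z) z) (Set.Ioi y) y := by
    refine hyd.hasDerivWithinAt.sub ?_
    have := HasDerivWithinAt.scomp (h := fun w => w + a) (s := Set.Ioi y) (t' := Set.Ioi z) (h' := 1) y
      (by rw [hya]; exact hr hz) ((hasDerivAt_id y).add_const a).hasDerivWithinAt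
      (fun w (hw : y < w) => by simp only [Set.mem_Ioi]; linarith)
    simpa [hya, Function.comp_def] using this
  have h3 := hg.convexOn.leftDeriv_le_rightDeriv_of_mem_interior (hmem hy0)
  rw [h1.derivWithin (uniqueDiffWithinAt_Iio y), h2.derivWithin (uniqueDiffWithinAt_Ioi y)] at h3
  have h4 := hcd.convexOn.leftDeriv_le_rightDeriv_of_mem_interior (hmem hz)
  have e : derivWithin f (Set.Ioi z) z = derivWithin f (Set.Iio z) z := by linarith
  have hr' := hr hz
  rw [e] at hr'
  rw [negLeftDeriv_of_pos f hz, neg_neg, leftDeriv, hasDerivAt_iff_tendsto_slope,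
    ← Set.Iio_union_Ioi, nhdsWithin_union, tendsto_sup]
  exact ⟨(hasDerivWithinAt_iff_tendsto_slope' (by simp)).1 (hl hz),
    (hasDerivWithinAt_iff_tendsto_slope' (by simp)).1 hr'⟩

/-- The negated derivative is the limit of the quotients `a⁻¹ (f - f(· + a))`, which have
nonnegative differences of one order less. That property and convexity survive pointwise limits, and
convexity supplies the continuity. -/
lemma negLeftDeriv (hf : MultiplyMonotone (n + 1) f) : MultiplyMonotone n (negLeftDeriv f) := by
  have hlim : ∀ z, 0 < z → Tendsto (fun a => a⁻¹ * (f z - f (z + a))) (𝓝[>] 0)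
      (𝓝 (_root_.negLeftDeriv f z)) := by
    intro z hz
    have h := ((hasDerivAt_iff_tendsto_slope_zero.1 (hf.hasDerivAt hz)).mono_left
      (nhdsWithin_mono 0 (fun x (hx : 0 < x) => hx.ne'))).neg
    rw [neg_neg] at h
    refine h.congr fun a => ?_
    simp only [smul_eq_mul]; ring
  have key : ∀ a, 0 < a → DiffNonneg (n + 2) (fun z => a⁻¹ * (f z - f (z + a))) :=
    fun a ha h hh z hz => by
      rw [iterDiff_const_mul]
      exact mul_nonneg (inv_nonneg.2 ha.le) ((hf.sub_shift ha).diffNonneg h hh z hz)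
  have hconv : ConvexOn ℝ (Set.Ioi 0) (_root_.negLeftDeriv f) := by
    refine ⟨convex_Ioi 0, fun x hx y hy a b ha hb hab => ?_⟩
    have hxy : 0 < a • x + b • y := (convex_Ioi (0:ℝ)) hx hy ha hb hab
    refine le_of_tendsto_of_tendsto (hlim _ hxy)
      (((hlim x hx).const_smul a).add ((hlim y hy).const_smul b)) ?_
    filter_upwards [self_mem_nhdsWithin] with c (hc : 0 < c)
    have := ((hf.sub_shift hc).convexDecay.convexOn.smul (inv_nonneg.2 hc.le)).2 hx hy ha hb hab
    simpa using this
  exact ⟨hconv.continuousOn isOpen_Ioi, hf.convexDecay.tendsto_negLeftDeriv,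
    DiffNonneg.of_tendsto hlim (by filter_upwards [self_mem_nhdsWithin] with a ha using key a ha)⟩

lemma iterate_negLeftDeriv {k : ℕ} (hf : MultiplyMonotone n f) (hk : k ≤ n) :
    MultiplyMonotone (n - k) (_root_.negLeftDeriv^[k] f) := by
  induction k with
  | zero => simpa using hf
  | succ k ih =>
    rw [Function.iterate_succ_apply']
    have := ih (by omega)
    rw [show n - k = n - (k + 1) + 1 by omega] at this
    exact this.negLeftDeriv

lemma iteratedDeriv_eq {k : ℕ} (hf : MultiplyMonotone n f) (hk : k ≤ n) {z : ℝ} (hz : 0 < z) :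
    iteratedDeriv k f z = (-1) ^ k * _root_.negLeftDeriv^[k] f z := by
  induction k generalizing z with
  | zero => simp
  | succ k ih =>
    have h := hf.iterate_negLeftDeriv (k := k) (by omega)
    rw [show n - k = n - (k + 1) + 1 by omega] at h
    have e : iteratedDeriv k f =ᶠ[𝓝 z] fun z => (-1) ^ k * _root_.negLeftDeriv^[k] f z := by
      filter_upwards [Ioi_mem_nhds hz] with w hw using ih (by omega) hw
    rw [iteratedDeriv_succ, e.deriv_eq, ((h.hasDerivAt hz).const_mul _).deriv,
      Function.iterate_succ_apply']
    ring

lemma leftDeriv_iteratedDeriv {k : ℕ} (hf : MultiplyMonotone n f) (hk : k ≤ n) {z : ℝ}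
    (hz : 0 < z) :
    leftDeriv (iteratedDeriv k f) z = (-1) ^ (k + 1) * _root_.negLeftDeriv^[k + 1] f z := by
  have h := (hf.iterate_negLeftDeriv hk).convexDecay
  rw [leftDeriv_congr (fun w hw => hf.iteratedDeriv_eq hk hw) hz,
    Function.iterate_succ_apply', negLeftDeriv_of_pos _ hz, leftDeriv]
  have := (h.convexOn.hasDerivWithinAt_leftDeriv_of_mem_interior
    (by simpa using hz)).const_mul ((-1 : ℝ) ^ k)
  rw [this.derivWithin (uniqueDiffWithinAt_Iio z), leftDeriv]
  ring

end MultiplyMonotone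

/-! ### Integrating the left derivative -/

lemma AntitoneOn.measurable_of_eq_zero {g : ℝ → ℝ} (hg : AntitoneOn g (Set.Ioi 0))
    (h0 : ∀ z, z ≤ 0 → g z = 0) : Measurable g := by
  refine measurable_of_Ioi fun a => ?_
  have h1 : MeasurableSet (g ⁻¹' Set.Ioi a ∩ Set.Ioi 0) := by
    refine Set.OrdConnected.measurableSet ⟨fun x hx y hy z hz => ⟨?_, hx.2.trans_le hz.1⟩⟩
    exact lt_of_lt_of_le hy.1 (hg (hx.2.trans_le hz.1) hy.2 hz.2)
  have h2 : MeasurableSet (g ⁻¹' Set.Ioi a ∩ Set.Iic 0) := by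
    by_cases ha : a < 0
    · convert measurableSet_Iic (a := (0:ℝ)) using 1
      ext z
      simp only [Set.mem_inter_iff, Set.mem_preimage, Set.mem_Ioi, Set.mem_Iic, and_iff_right_iff_imp]
      intro hz
      rwa [h0 z hz]
    · convert MeasurableSet.empty using 1
      ext z
      simp only [Set.mem_inter_iff, Set.mem_preimage, Set.mem_Ioi, Set.mem_Iic,
        Set.mem_empty_iff_false, iff_false, not_and]
      intro h hz
      rw [h0 z hz] at h
      exact ha h
  convert h1.union h2 using 1
  rw [← Set.inter_union_distrib_left, Set.union_comm, Set.Iic_union_Ioi, Set.inter_univ]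

namespace ConvexDecay

variable {f : ℝ → ℝ}

lemma measurable_negLeftDeriv (hf : ConvexDecay f) : Measurable (negLeftDeriv f) :=
  hf.antitoneOn_negLeftDeriv.measurable_of_eq_zero fun z hz => by simp [negLeftDeriv, hz.not_gt]

lemma intervalIntegrable_negLeftDeriv (hf : ConvexDecay f) {a b : ℝ} (ha : 0 < a) (hab : a ≤ b) :
    IntervalIntegrable (negLeftDeriv f) volume a b := by
  refine AntitoneOn.intervalIntegrable (hf.antitoneOn_negLeftDeriv.mono ?_)
  rw [Set.uIcc_of_le hab]
  exact fun x hx => ha.trans_le hx.1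

/-- The fundamental theorem of calculus tolerates the countable set of kinks. -/
lemma integral_negLeftDeriv (hf : ConvexDecay f) {a b : ℝ} (ha : 0 < a) (hab : a ≤ b) :
    ∫ z in a..b, negLeftDeriv f z = f a - f b := by
  have := integral_eq_of_hasDerivAt_off_countable_of_le (fun z => - f z) (negLeftDeriv f) hab
    hf.countable_not_continuousAt (hf.continuousOn.mono fun x hx => ha.trans_le hx.1).neg
    (fun x hx => by
      have hx0 : 0 < x := ha.trans hx.1.1
      have hc : ContinuousAt (negLeftDeriv f) x := by
        by_contra h
        exact hx.2 ⟨hx0, h⟩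
      simpa using (hf.hasDerivAt hx0 hc).fun_neg)
    (hf.intervalIntegrable_negLeftDeriv ha hab)
  rw [this]; ring

lemma setLIntegral_Ioc_negLeftDeriv (hf : ConvexDecay f) {a b : ℝ} (ha : 0 < a) (hab : a ≤ b) :
    ∫⁻ z in Set.Ioc a b, ENNReal.ofReal (negLeftDeriv f z) = ENNReal.ofReal (f a - f b) := by
  rw [← hf.integral_negLeftDeriv ha hab, intervalIntegral.integral_of_le hab,
    ofReal_integral_eq_lintegral_ofReal]
  · exact (intervalIntegrable_iff_integrableOn_Ioc_of_le hab).1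
      (hf.intervalIntegrable_negLeftDeriv ha hab)
  · exact Eventually.of_forall fun z => hf.negLeftDeriv_nonneg z

/-- Exhaust `(s,∞)` by compact pieces. Right continuity at `s` is a hypothesis because `s = 0` is
allowed, where convexity on `(0,∞)` says nothing. -/
lemma setLIntegral_Ioi_negLeftDeriv (hf : ConvexDecay f) {s : ℝ} (hs : 0 ≤ s)
    (hc : ContinuousWithinAt f (Set.Ioi s) s) :
    ∫⁻ z in Set.Ioi s, ENNReal.ofReal (negLeftDeriv f z) = ENNReal.ofReal (f s) := by
  have hn : Tendsto (fun n : ℕ => s + 1 / ((n : ℝ) + 1)) atTop (𝓝[>] s) := by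
    refine tendsto_nhdsWithin_iff.2 ⟨?_, Eventually.of_forall fun n => ?_⟩
    · simpa using tendsto_const_nhds.add (tendsto_one_div_add_atTop_nhds_zero_nat (𝕜 := ℝ))
    · simp only [Set.mem_Ioi, lt_add_iff_pos_right]; positivity
  have hb : Tendsto (fun n : ℕ => s + 1 + (n : ℝ)) atTop atTop :=
    tendsto_atTop_add_const_left _ _ tendsto_natCast_atTop_atTop
  have hcov : AECover (volume.restrict (Set.Ioi s)) atTop
      (fun n : ℕ => Set.Ioc (s + 1 / ((n : ℝ) + 1)) (s + 1 + n)) :=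
    (aecover_Ioi_of_Ioi (tendsto_nhdsWithin_iff.1 hn).1).inter (aecover_Iic hb).restrict
  have h1 := hcov.lintegral_tendsto_of_countably_generated
    (f := fun z => ENNReal.ofReal (negLeftDeriv f z))
    (hf.measurable_negLeftDeriv.ennreal_ofReal.aemeasurable)
  have h2 : Tendsto (fun n : ℕ => ENNReal.ofReal (f (s + 1 / ((n : ℝ) + 1)) - f (s + 1 + n))) atTop
      (𝓝 (ENNReal.ofReal (f s))) := by
    refine ENNReal.tendsto_ofReal ?_
    simpa using (hc.tendsto.comp hn).sub (hf.tendsto.comp hb)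
  refine tendsto_nhds_unique h1 (h2.congr fun n => ?_)
  have h3 : (0:ℝ) < 1 / ((n : ℝ) + 1) := by positivity
  have h4 : 1 / ((n : ℝ) + 1) ≤ 1 := by
    rw [div_le_one (by positivity)]; linarith [(Nat.cast_nonneg n : (0:ℝ) ≤ n)]
  rw [Measure.restrict_restrict measurableSet_Ioc, Set.inter_eq_left.2,
    hf.setLIntegral_Ioc_negLeftDeriv (by linarith) (by linarith [(Nat.cast_nonneg n : (0:ℝ) ≤ n)])]
  exact fun z hz => lt_trans (by linarith) hz.1

lemma continuousWithinAt_of_pos (hf : ConvexDecay f) {s : ℝ} (hs : 0 < s) :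
    ContinuousWithinAt f (Set.Ioi s) s :=
  (hf.continuousOn.continuousAt (Ioi_mem_nhds hs)).continuousWithinAt

end ConvexDecay

/-! ### Archimedean generators and their pseudoinverses -/

/-- The real-valued pseudoinverse; it is meaningful on `(0,1]`. -/
noncomputable def genInv (ψ : ℝ → ℝ) (x : I) : ℝ := (pseudoInv ψ x).toReal

/-- A generator as a map into the unit interval. -/
noncomputable def genUnit (ψ : ℝ → ℝ) (z : ℝ) : I := Set.projIcc 0 1 zero_le_one (ψ (max z 0))

lemma genExt_ofReal (ψ : ℝ → ℝ) {z : ℝ} (hz : 0 ≤ z) : genExt ψ (ENNReal.ofReal z) = ψ z := by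
  simp [genExt, hz]

lemma genInv_nonneg (ψ : ℝ → ℝ) (x : I) : 0 ≤ genInv ψ x := ENNReal.toReal_nonneg

lemma antitone_pseudoInv (ψ : ℝ → ℝ) : Antitone (pseudoInv ψ) := fun _ _ hxy =>
  sInf_le_sInf fun _ hz => le_trans hz (Subtype.coe_le_coe.2 hxy)

lemma measurable_genInv (ψ : ℝ → ℝ) : Measurable (genInv ψ) :=
  (antitone_pseudoInv ψ).measurable.ennreal_toReal

namespace IsArchimedeanGenerator

variable {ψ : ℝ → ℝ}

lemma apply_nonneg (h : IsArchimedeanGenerator ψ) {z : ℝ} (hz : 0 ≤ z) : 0 ≤ ψ z := (h.mapsTo hz).1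

lemma apply_le_one (h : IsArchimedeanGenerator ψ) {z : ℝ} (hz : 0 ≤ z) : ψ z ≤ 1 := (h.mapsTo hz).2

lemma coe_genUnit (h : IsArchimedeanGenerator ψ) {z : ℝ} (hz : 0 ≤ z) : (genUnit ψ z : ℝ) = ψ z := by
  rw [genUnit, max_eq_left hz, Set.projIcc_of_mem zero_le_one (h.mapsTo hz)]

lemma continuous_genUnit (h : IsArchimedeanGenerator ψ) : Continuous (genUnit ψ) :=
  continuous_projIcc.comp
    (h.continuousOn.comp_continuous (by fun_prop) fun z => le_max_right z 0)

lemma genExt_nonneg (h : IsArchimedeanGenerator ψ) (z : ℝ≥0∞) : 0 ≤ genExt ψ z := by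
  unfold genExt
  split_ifs
  · exact le_rfl
  · exact h.apply_nonneg ENNReal.toReal_nonneg

lemma antitone_genExt (h : IsArchimedeanGenerator ψ) : Antitone (genExt ψ) := by
  intro a b hab
  by_cases hb : b = ∞
  · rw [genExt, if_pos hb]
    exact h.genExt_nonneg a
  · have ha : a ≠ ∞ := fun ha => hb (top_le_iff.1 (ha ▸ hab))
    rw [genExt, genExt, if_neg hb, if_neg ha]
    exact h.antitoneOn ENNReal.toReal_nonneg ENNReal.toReal_nonneg (ENNReal.toReal_mono hb hab)

lemma continuous_genExt (h : IsArchimedeanGenerator ψ) : Continuous (genExt ψ) := by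
  rw [continuous_iff_continuousAt]
  intro z
  by_cases hz : z = ∞
  · subst hz
    rw [ContinuousAt, tendsto_order]
    have e : genExt ψ ∞ = 0 := by simp [genExt]
    rw [e]
    refine ⟨fun a ha => Eventually.of_forall fun z => ha.trans_le (h.genExt_nonneg z), fun a ha => ?_⟩
    obtain ⟨N, hN, hN0⟩ := ((h.tendsto_atTop.eventually (gt_mem_nhds ha)).and
      (eventually_ge_atTop 0)).exists
    filter_upwards [Ioi_mem_nhds (ENNReal.ofReal_lt_top (r := N))] with w hw
    refine lt_of_le_of_lt (h.antitone_genExt hw.le) ?_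
    rwa [genExt_ofReal ψ hN0]
  · have e : genExt ψ =ᶠ[𝓝 z] fun w => ψ w.toReal := by
      filter_upwards [isOpen_ne.mem_nhds hz] with w hw
      exact if_neg hw
    refine ContinuousAt.congr ?_ e.symm
    have h1 : Tendsto ENNReal.toReal (𝓝 z) (𝓝[Set.Ici 0] z.toReal) :=
      tendsto_nhdsWithin_iff.2 ⟨ENNReal.tendsto_toReal hz,
        Eventually.of_forall fun w => ENNReal.toReal_nonneg⟩
    exact (h.continuousOn z.toReal ENNReal.toReal_nonneg).tendsto.comp h1

/-- By continuity on `[0,∞]` the sublevel set is closed, so the infimum is attained. The resulting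
Galois connection is what the later arguments use in place of the definition of `φ`. -/
lemma pseudoInv_le_iff (h : IsArchimedeanGenerator ψ) {x : I} {z : ℝ≥0∞} :
    pseudoInv ψ x ≤ z ↔ genExt ψ z ≤ x := by
  refine ⟨fun hz => ?_, fun hz => sInf_le hz⟩
  refine (h.antitone_genExt hz).trans ?_
  have hcl : IsClosed {z : ℝ≥0∞ | genExt ψ z ≤ x} := isClosed_le h.continuous_genExt continuous_const
  exact hcl.sInf_mem ⟨∞, by simpa [genExt] using x.2.1⟩

lemma pseudoInv_ne_top (h : IsArchimedeanGenerator ψ) {x : I} (hx : 0 < x) : pseudoInv ψ x ≠ ∞ := by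
  have hx' : (0:ℝ) < x := hx
  obtain ⟨N, hN, hN0⟩ := ((h.tendsto_atTop.eventually (gt_mem_nhds hx')).and
    (eventually_ge_atTop 0)).exists
  refine ne_top_of_le_ne_top (ENNReal.ofReal_ne_top (r := N)) (h.pseudoInv_le_iff.2 ?_)
  rw [genExt_ofReal ψ hN0]
  exact le_of_lt hN

lemma ofReal_genInv (h : IsArchimedeanGenerator ψ) {x : I} (hx : 0 < x) :
    ENNReal.ofReal (genInv ψ x) = pseudoInv ψ x := ENNReal.ofReal_toReal (h.pseudoInv_ne_top hx)

lemma genInv_le_iff (h : IsArchimedeanGenerator ψ) {x : I} (hx : 0 < x) {z : ℝ} (hz : 0 ≤ z) :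
    genInv ψ x ≤ z ↔ ψ z ≤ x := by
  rw [← genExt_ofReal ψ hz, ← h.pseudoInv_le_iff, ← h.ofReal_genInv hx,
    ENNReal.ofReal_le_ofReal_iff hz]

lemma apply_genInv (h : IsArchimedeanGenerator ψ) {x : I} (hx : 0 < x) : ψ (genInv ψ x) = x := by
  have h0 := genInv_nonneg ψ x
  refine le_antisymm ((h.genInv_le_iff hx h0).1 le_rfl) ?_
  by_contra! hlt
  obtain ⟨z, hz, hzx⟩ := intermediate_value_Icc' h0
    (h.continuousOn.mono fun z hz => hz.1) (show (x:ℝ) ∈ Set.Icc (ψ (genInv ψ x)) (ψ 0) from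
      ⟨hlt.le, by rw [h.map_zero]; exact x.2.2⟩)
  have := (h.genInv_le_iff hx hz.1).2 hzx.le
  have e : z = genInv ψ x := le_antisymm hz.2 this
  rw [e] at hzx
  exact hlt.ne hzx

/-- Strict monotonicity up to the first zero, restated without `firstZero`: positivity of `ψ` at a
point places it before the first zero. -/
lemma apply_lt_apply (h : IsArchimedeanGenerator ψ) {z w : ℝ} (hz : 0 ≤ z) (hzw : z < w)
    (hpos : 0 < ψ z) : ψ w < ψ z := by
  rcases (h.apply_nonneg (hz.trans hzw.le)).eq_or_lt with h0 | h0
  · rwa [← h0]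
  have key : ∀ {y : ℝ}, 0 ≤ y → 0 < ψ y → ENNReal.ofReal y ≤ firstZero ψ := by
    intro y hy hpy
    refine le_sInf fun u hu => ?_
    by_contra! hlt
    have := h.antitone_genExt hlt.le
    rw [genExt_ofReal ψ hy, show genExt ψ u = 0 from hu] at this
    linarith
  have := h.strictAntiOn (key hz hpos) (key (hz.trans hzw.le) h0)
    ((ENNReal.ofReal_lt_ofReal_iff (hz.trans_lt hzw)).2 hzw)
  rwa [genExt_ofReal ψ hz, genExt_ofReal ψ (hz.trans hzw.le)] at this

lemma genInv_genUnit (h : IsArchimedeanGenerator ψ) {z : ℝ} (hz : 0 ≤ z) (hpos : 0 < ψ z) :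
    genInv ψ (genUnit ψ z) = z := by
  have hx : 0 < genUnit ψ z := by
    rw [← Subtype.coe_lt_coe, h.coe_genUnit hz]
    exact hpos
  have h1 : genInv ψ (genUnit ψ z) ≤ z := (h.genInv_le_iff hx hz).2 (h.coe_genUnit hz).ge
  have h2 : ψ (genInv ψ (genUnit ψ z)) = ψ z := by rw [h.apply_genInv hx, h.coe_genUnit hz]
  by_contra hne
  have := h.apply_lt_apply (genInv_nonneg _ _) (lt_of_le_of_ne h1 hne) (by rwa [h2])
  linarith

lemma genUnit_genInv (h : IsArchimedeanGenerator ψ) {x : I} (hx : 0 < x) :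
    genUnit ψ (genInv ψ x) = x := by
  ext
  rw [h.coe_genUnit (genInv_nonneg _ _), h.apply_genInv hx]

lemma genInv_injOn (h : IsArchimedeanGenerator ψ) : Set.InjOn (genInv ψ) (Set.Ioi 0) := by
  intro x hx y hy hxy
  rw [← h.genUnit_genInv hx, ← h.genUnit_genInv hy, hxy]

lemma genInv_one (h : IsArchimedeanGenerator ψ) : genInv ψ 1 = 0 :=
  le_antisymm ((h.genInv_le_iff zero_lt_one le_rfl).2 (by simp [h.map_zero])) (genInv_nonneg _ _)

lemma genInv_pos (h : IsArchimedeanGenerator ψ) {x : I} (hx : 0 < x) (hx1 : x < 1) :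
    0 < genInv ψ x := by
  refine lt_of_le_of_ne (genInv_nonneg _ _) fun h0 => ?_
  have := h.apply_genInv hx
  rw [← h0, h.map_zero] at this
  exact hx1.ne (Subtype.ext this.symm)

lemma genUnit_le_iff (h : IsArchimedeanGenerator ψ) {x : I} (hx : 0 < x) {z : ℝ} (hz : 0 ≤ z) :
    genUnit ψ z ≤ x ↔ genInv ψ x ≤ z := by
  rw [h.genInv_le_iff hx hz, ← h.coe_genUnit hz, Subtype.coe_le_coe]

end IsArchimedeanGenerator

/-! ### Convergence of generators and of their pseudoinverses -/

section Convergence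

variable {ψ : ℝ → ℝ} {ψs : ℕ → ℝ → ℝ}

lemma tendsto_pseudoInv_of_tendsto (h : IsArchimedeanGenerator ψ)
    (hs : ∀ n, IsArchimedeanGenerator (ψs n))
    (hlim : ∀ z, 0 ≤ z → Tendsto (fun n => ψs n z) atTop (𝓝 (ψ z))) {x : I} (hx : 0 < x) :
    Tendsto (fun n => pseudoInv (ψs n) x) atTop (𝓝 (pseudoInv ψ x)) := by
  have e : ∀ n, pseudoInv (ψs n) x = ENNReal.ofReal (genInv (ψs n) x) := fun n =>
    ((hs n).ofReal_genInv hx).symm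
  simp_rw [e, ← h.ofReal_genInv hx]
  refine ENNReal.tendsto_ofReal (tendsto_order.2 ⟨fun a ha => ?_, fun a ha => ?_⟩)
  · by_cases ha0 : 0 ≤ a
    · have h1 : (x:ℝ) < ψ a := by
        by_contra! hle
        exact ((h.genInv_le_iff hx ha0).2 hle).not_gt ha
      filter_upwards [(hlim a ha0).eventually (lt_mem_nhds h1)] with n hn
      by_contra! hle
      exact (((hs n).genInv_le_iff hx ha0).1 hle).not_gt hn
    · exact Eventually.of_forall fun n => (not_le.1 ha0).trans_le (genInv_nonneg _ _)
  · obtain ⟨b, hb, hba⟩ := exists_between ha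
    have hb0 : 0 ≤ b := (genInv_nonneg ψ x).trans hb.le
    have h1 : ψ b < x := by
      have := h.apply_lt_apply (genInv_nonneg ψ x) hb (by rw [h.apply_genInv hx]; exact hx)
      rwa [h.apply_genInv hx] at this
    filter_upwards [(hlim b hb0).eventually (gt_mem_nhds h1)] with n hn
    exact (((hs n).genInv_le_iff hx hb0).2 hn.le).trans_lt hba

lemma tendsto_genInv (h : IsArchimedeanGenerator ψ) {x : I} (hx : 0 < x)
    (hlim : Tendsto (fun n => pseudoInv (ψs n) x) atTop (𝓝 (pseudoInv ψ x))) :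
    Tendsto (fun n => genInv (ψs n) x) atTop (𝓝 (genInv ψ x)) :=
  (ENNReal.tendsto_toReal (h.pseudoInv_ne_top hx)).comp hlim

lemma tendsto_of_tendsto_genInv (h : IsArchimedeanGenerator ψ)
    (hs : ∀ n, IsArchimedeanGenerator (ψs n))
    (hlim : ∀ x : I, 0 < x → Tendsto (fun n => genInv (ψs n) x) atTop (𝓝 (genInv ψ x)))
    {z : ℝ} (hz : 0 ≤ z) : Tendsto (fun n => ψs n z) atTop (𝓝 (ψ z)) := by
  refine tendsto_order.2 ⟨fun a ha => ?_, fun a ha => ?_⟩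
  · by_cases ha0 : 0 < a
    · have ha1 : a ≤ 1 := ha.le.trans (h.apply_le_one hz)
      let x : I := ⟨a, ha0.le, ha1⟩
      have hx : 0 < x := ha0
      have h1 : z < genInv ψ x := by
        by_contra! hle
        exact ((h.genInv_le_iff hx hz).1 hle).not_gt ha
      filter_upwards [(hlim x hx).eventually (lt_mem_nhds h1)] with n hn
      by_contra! hle
      exact (((hs n).genInv_le_iff hx hz).2 hle).not_gt hn
    · obtain h0 | h0 := (h.apply_nonneg hz).eq_or_lt
      · exact Eventually.of_forall fun n =>
          (ha.trans_le h0.ge).trans_le ((hs n).apply_nonneg hz)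
      · obtain ⟨b, hb0, hb⟩ := exists_between h0
        let x : I := ⟨b, hb0.le, hb.le.trans (h.apply_le_one hz)⟩
        have hx : 0 < x := hb0
        have h1 : z < genInv ψ x := by
          by_contra! hle
          exact ((h.genInv_le_iff hx hz).1 hle).not_gt hb
        filter_upwards [(hlim x hx).eventually (lt_mem_nhds h1)] with n hn
        by_contra! hle
        exact (((hs n).genInv_le_iff hx hz).2 (hle.trans ((not_lt.1 ha0).trans hb0.le))).not_gt hn
  · by_cases ha1 : 1 < a
    · exact Eventually.of_forall fun n => ((hs n).apply_le_one hz).trans_lt ha1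
    · obtain ⟨b, hb, hba⟩ := exists_between ha
      have hb0 : 0 < b := (h.apply_nonneg hz).trans_lt hb
      let x : I := ⟨b, hb0.le, hba.le.trans (not_lt.1 ha1)⟩
      have hx : 0 < x := hb0
      have h1 : genInv ψ x < z := by
        refine lt_of_le_of_ne ((h.genInv_le_iff hx hz).2 hb.le) fun e => ?_
        have := h.apply_genInv hx
        rw [e] at this
        exact hb.ne this
      filter_upwards [(hlim x hx).eventually (gt_mem_nhds h1)] with n hn
      exact (((hs n).genInv_le_iff hx hz).1 hn.le).trans_lt hba

/-- Pólya's argument: control the error at the finitely many points where `ψ` takes the values `k /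
N`, and interpolate by monotonicity. -/
lemma tendstoUniformlyOn_of_tendsto (h : IsArchimedeanGenerator ψ)
    (hs : ∀ n, IsArchimedeanGenerator (ψs n))
    (hlim : ∀ z, 0 ≤ z → Tendsto (fun n => ψs n z) atTop (𝓝 (ψ z))) :
    TendstoUniformlyOn ψs ψ atTop (Set.Ici 0) := by
  rw [Metric.tendstoUniformlyOn_iff]
  intro ε hε
  obtain ⟨N, hN⟩ := exists_nat_gt (2 / ε)
  have hN0 : (0:ℝ) < N := lt_trans (by positivity) hN
  have hNε : 2 / (N:ℝ) < ε := by
    rw [div_lt_iff₀ hN0]; rwa [div_lt_iff₀ hε, mul_comm] at hN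
  have hmem : ∀ k ∈ Finset.Icc 1 N, (k:ℝ) / N ∈ Set.Icc (0:ℝ) 1 := fun k hk =>
    ⟨by positivity, (div_le_one hN0).2 (by exact_mod_cast (Finset.mem_Icc.1 hk).2)⟩
  -- Level `0` is left out since `ψ` may never reach it; below level `1 / N` nonnegativity of `ψ_n`
  -- replaces the missing grid point.
  have hex : ∀ k : ℕ, k ∈ Finset.Icc 1 N → ∃ w, 0 ≤ w ∧ ∀ z, 0 ≤ z → (w ≤ z ↔ ψ z ≤ (k:ℝ) / N) := by
    intro k hk
    have hk0 : 0 < (⟨(k:ℝ) / N, hmem k hk⟩ : I) := by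
      have : 0 < (k:ℝ) := by exact_mod_cast (Finset.mem_Icc.1 hk).1
      exact div_pos this hN0
    exact ⟨genInv ψ ⟨_, hmem k hk⟩, genInv_nonneg _ _, fun z hz => h.genInv_le_iff hk0 hz⟩
  choose! w hw0 hw using hex
  have hww : ∀ k ∈ Finset.Icc 1 N, ψ (w k) = (k:ℝ) / N := by
    intro k hk
    refine le_antisymm ((hw k hk _ (hw0 k hk)).1 le_rfl) ?_
    have hk0 : 0 < (⟨(k:ℝ) / N, hmem k hk⟩ : I) := by
      have : 0 < (k:ℝ) := by exact_mod_cast (Finset.mem_Icc.1 hk).1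
      exact div_pos this hN0
    have e := h.apply_genInv hk0
    have h1 := (hw k hk _ (genInv_nonneg ψ _)).2 e.le
    have h2 := h.antitoneOn (hw0 k hk) (genInv_nonneg ψ _) h1
    rwa [e] at h2
  have hev : ∀ᶠ n in atTop, ∀ k ∈ Finset.Icc 1 N, |ψs n (w k) - ψ (w k)| < 1 / N := by
    rw [Filter.eventually_all_finset]
    intro k hk
    have := (hlim (w k) (hw0 k hk)).eventually (Metric.ball_mem_nhds _ (show 0 < 1 / (N:ℝ) by positivity))
    simpa [Real.dist_eq] using this
  filter_upwards [hev] with n hn z hz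
  have hz' : (0:ℝ) ≤ z := hz
  obtain ⟨k, hkN, hk1, hk2⟩ : ∃ k : ℕ, k < N ∧ (k:ℝ) / N ≤ ψ z ∧ ψ z ≤ ((k + 1 : ℕ) : ℝ) / N := by
    have h0 := h.apply_nonneg hz'
    rcases (h.apply_le_one hz').eq_or_lt with e | hlt
    -- When `ψ z = 1` the floor would return `N` and push level `k + 1` off the grid.
    · refine ⟨N - 1, Nat.sub_lt (by exact_mod_cast hN0) one_pos, ?_, ?_⟩
      · rw [e]
        exact (div_le_one hN0).2 (by exact_mod_cast Nat.sub_le _ _)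
      · rw [Nat.sub_add_cancel (by exact_mod_cast hN0), div_self hN0.ne', e]
    · refine ⟨⌊ψ z * N⌋₊, ?_, ?_, ?_⟩
      · rw [Nat.floor_lt (by positivity)]
        nlinarith
      · rw [div_le_iff₀ hN0]
        exact Nat.floor_le (by positivity)
      · rw [le_div_iff₀ hN0]
        push_cast
        exact (Nat.lt_floor_add_one _).le
  have hk1mem : k + 1 ∈ Finset.Icc 1 N := Finset.mem_Icc.2 ⟨by omega, by omega⟩
  have hup : ψs n z ≤ ψ z + 2 / N := by
    have h1 := (hs n).antitoneOn (hw0 _ hk1mem) hz ((hw _ hk1mem z hz).2 hk2)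
    have h2 := abs_lt.1 (hn _ hk1mem)
    rw [hww _ hk1mem] at h2
    have e1 : ((k + 1 : ℕ) : ℝ) / N = k / N + 1 / N := by push_cast; ring
    have e2 : 2 / (N:ℝ) = 1 / N + 1 / N := by ring
    rw [e1] at h2
    linarith [h2.2]
  have hlow : ψ z - 2 / N ≤ ψs n z := by
    have e1 : ((k + 1 : ℕ) : ℝ) / N = k / N + 1 / N := by push_cast; ring
    have e2 : 2 / (N:ℝ) = 1 / N + 1 / N := by ring
    rw [e1] at hk2
    rcases Nat.eq_zero_or_pos k with rfl | hk0
    · have := (hs n).apply_nonneg hz'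
      have h3 : 0 < 1 / (N:ℝ) := by positivity
      simp only [Nat.cast_zero, zero_div, zero_add] at hk2
      linarith
    · have hkmem : k ∈ Finset.Icc 1 N := Finset.mem_Icc.2 ⟨hk0, hkN.le⟩
      have h2 := abs_lt.1 (hn _ hkmem)
      have hzw : z ≤ w k := by
        by_contra! hlt
        have h3 := (hw k hkmem z hz').1 hlt.le
        have h4 := h.apply_lt_apply (hw0 k hkmem) hlt (by
          rw [hww k hkmem]
          have : (0:ℝ) < k := by exact_mod_cast hk0
          positivity)
        rw [hww k hkmem] at h4
        linarith
      have h1 := (hs n).antitoneOn hz (hw0 _ hkmem) hzw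
      rw [hww _ hkmem] at h2
      linarith [h2.1]
  rw [Real.dist_eq, abs_sub_lt_iff]
  constructor <;> linarith

end Convergence

/-! ### Uniform continuity estimates for distribution functions on cubes -/

lemma measurableSet_Iic_pi {m : ℕ} (y : Fin m → I) : MeasurableSet (Set.Iic y) :=
  isClosed_Iic.measurableSet

instance : Measure.IsOpenPosMeasure (volume : Measure I) := by
  refine ⟨fun U hU ⟨x, hx⟩ h0 => ?_⟩
  obtain ⟨r, hr, hball⟩ := Metric.isOpen_iff.1 hU x hx
  let a : I := Set.projIcc 0 1 zero_le_one ((x:ℝ) - r / 2)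
  let b : I := Set.projIcc 0 1 zero_le_one ((x:ℝ) + r / 2)
  have ha : (a:ℝ) = max 0 (x - r / 2) := by
    simp only [a, Set.coe_projIcc]
    rw [min_eq_right (by linarith [x.2.2])]
  have hb : (b:ℝ) = min 1 (x + r / 2) := by
    simp only [b, Set.coe_projIcc]
    rw [max_eq_right (le_min zero_le_one (by linarith [x.2.1]))]
  have hab : (a:ℝ) < b := by
    rw [ha, hb]
    exact max_lt (lt_min one_pos (by linarith [x.2.1])) (lt_min (by linarith [x.2.2]) (by linarith))
  have hsub : Set.Icc a b ⊆ U := by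
    intro y hy
    refine hball ?_
    have h1 : (x:ℝ) - r / 2 ≤ y := (le_max_right 0 _).trans (ha ▸ hy.1)
    have h2 : (y:ℝ) ≤ x + r / 2 := le_trans (show (y:ℝ) ≤ b from hy.2) (hb ▸ min_le_right _ _)
    rw [Metric.mem_ball, Subtype.dist_eq, Real.dist_eq, abs_lt]
    constructor <;> linarith
  have := measure_mono_null hsub h0
  rw [unitInterval.volume_Icc, ENNReal.ofReal_eq_zero] at this
  linarith

/-- A point in one orthant but not in the other lies in one of the slabs between corresponding
coordinates. With uniform marginals a slab has mass equal to its width, which gives Lipschitz bounds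
common to all copulas. -/
lemma abs_measureReal_Iic_sub_le {m : ℕ} (ν : Measure (Fin m → I)) [IsFiniteMeasure ν]
    (y y' : Fin m → I) :
    |ν.real (Set.Iic y) - ν.real (Set.Iic y')| ≤ ∑ i, ν.real {u | u i ∈ Set.uIoc (y i) (y' i)} := by
  have key : ∀ y y' : Fin m → I, ν.real (Set.Iic y) ≤
      ν.real (Set.Iic y') + ∑ i, ν.real {u | u i ∈ Set.uIoc (y i) (y' i)} := by
    intro y y'
    have hsub : Set.Iic y ⊆ Set.Iic y' ∪ ⋃ i, {u | u i ∈ Set.uIoc (y i) (y' i)} := by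
      intro u hu
      by_cases h : u ≤ y'
      · exact Or.inl h
      · right
        obtain ⟨i, hi⟩ := not_forall.1 h
        exact Set.mem_iUnion.2 ⟨i, Set.mem_uIoc.2 (Or.inr ⟨not_le.1 hi, hu i⟩)⟩
    refine (measureReal_mono hsub).trans ((measureReal_union_le _ _).trans ?_)
    gcongr
    exact measureReal_iUnion_fintype_le _
  rw [abs_sub_le_iff]
  constructor
  · linarith [key y y']
  · have := key y' y
    simp_rw [Set.uIoc_comm (y' _) (y _)] at this
    linarith

/-- Equicontinuity with a shared modulus upgrades pointwise convergence on a compact space. It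
serves both distribution functions and `kernelDist`. -/
lemma tendstoUniformly_of_modulus {X : Type*} [TopologicalSpace X] [CompactSpace X]
    {F : ℕ → X → ℝ} {f : X → ℝ} {ω : X → X → ℝ} (hω : ∀ x, Tendsto (ω x) (𝓝 x) (𝓝 0))
    (hF : ∀ n x y, |F n x - F n y| ≤ ω x y) (hf : ∀ x y, |f x - f y| ≤ ω x y)
    (h : ∀ x, Tendsto (fun n => F n x) atTop (𝓝 (f x))) : TendstoUniformly F f atTop := by
  rw [← tendstoLocallyUniformly_iff_tendstoUniformly_of_compactSpace,
    Metric.tendstoLocallyUniformly_iff]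
  intro ε hε x
  refine ⟨{y | ω x y < ε / 3}, (hω x).eventually (gt_mem_nhds (by positivity)), ?_⟩
  filter_upwards [(h x).eventually (Metric.ball_mem_nhds _ (show 0 < ε / 3 by positivity))]
    with n hn y (hy : ω x y < ε / 3)
  rw [Real.dist_eq] at hn ⊢
  have h1 := abs_lt.1 hn
  have h2 := abs_le.1 ((hF n x y).trans hy.le)
  have h3 := abs_le.1 ((hf x y).trans hy.le)
  have h4 := (hF n x y).trans_lt hy
  have h5 := abs_lt.1 h4
  rw [abs_lt]
  constructor <;> linarith

lemma tendsto_sum_dist {m : ℕ} (y : Fin m → I) :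
    Tendsto (fun y' : Fin m → I => ∑ i, dist (y i) (y' i)) (𝓝 y) (𝓝 0) := by
  have : Continuous fun y' : Fin m → I => ∑ i, dist (y i) (y' i) := by fun_prop
  exact this.tendsto' _ _ (by simp)

namespace Copula

variable {d m : ℕ}

lemma measureReal_eval_mem (C : Copula d) (i : Fin d) {S : Set I} (hS : MeasurableSet S) :
    C.measure.real {u | u i ∈ S} = volume.real S := by
  rw [← C.map_eval i, map_measureReal_apply (by fun_prop) hS]
  rfl

lemma volumeReal_uIoc (x y : I) : (volume : Measure I).real (Set.uIoc x y) = dist x y := by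
  rw [measureReal_def, unitInterval.volume_uIoc, edist_dist, ENNReal.toReal_ofReal dist_nonneg,
    dist_comm]

lemma abs_cdf_sub_le (C : Copula d) (x y : Fin d → I) :
    |C.cdf x - C.cdf y| ≤ ∑ i, dist (x i) (y i) := by
  refine (abs_measureReal_Iic_sub_le C.measure x y).trans (Finset.sum_le_sum fun i _ => ?_)
  rw [C.measureReal_eval_mem i measurableSet_uIoc, volumeReal_uIoc]

lemma cdf_nonneg (C : Copula d) (x : Fin d → I) : 0 ≤ C.cdf x := measureReal_nonneg

lemma cdf_le_apply (C : Copula d) (x : Fin d → I) (i : Fin d) : C.cdf x ≤ x i := by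
  have h1 := C.measureReal_eval_mem i (measurableSet_Iic (a := x i))
  rw [measureReal_def volume, unitInterval.volume_Iic, ENNReal.toReal_ofReal (x i).2.1] at h1
  rw [← h1]
  exact measureReal_mono fun u hu => hu i

lemma tendsto_cdf {Cs : ℕ → Copula d} {C : Copula d} {x : Fin d → I}
    (h : Tendsto (fun n => (Cs n).cdf x) atTop (𝓝 (C.cdf x))) {xs : ℕ → Fin d → I}
    (hx : Tendsto xs atTop (𝓝 x)) : Tendsto (fun n => (Cs n).cdf (xs n)) atTop (𝓝 (C.cdf x)) := by
  have h1 : Tendsto (fun n => (Cs n).cdf (xs n) - (Cs n).cdf x) atTop (𝓝 0) := by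
    refine squeeze_zero_norm (fun n => ?_) ((tendsto_sum_dist x).comp hx)
    rw [Real.norm_eq_abs, abs_sub_comm]
    exact (Cs n).abs_cdf_sub_le _ _
  simpa using h1.add h

lemma tendstoUniformly_cdf {Cs : ℕ → Copula d} {C : Copula d}
    (h : ∀ x, Tendsto (fun n => (Cs n).cdf x) atTop (𝓝 (C.cdf x))) :
    TendstoUniformly (fun n => (Cs n).cdf) C.cdf atTop :=
  tendstoUniformly_of_modulus tendsto_sum_dist (fun n => (Cs n).abs_cdf_sub_le) C.abs_cdf_sub_le h

/-! ### Markov kernels of copulas -/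

lemma fst_splitMeasure (C : Copula (m + 1)) : C.splitMeasure.fst = volume := by
  rw [Measure.fst, splitMeasure, Measure.map_map measurable_fst (by fun_prop), ← C.map_eval 0]
  rfl

lemma volume_compProd_kernel (C : Copula (m + 1)) : volume ⊗ₘ C.kernel = C.splitMeasure := by
  rw [← C.fst_splitMeasure]
  exact C.splitMeasure.disintegrate C.splitMeasure.condKernel

lemma setLIntegral_kernel (C : Copula (m + 1)) {A : Set I} (hA : MeasurableSet A)
    {B : Set (Fin m → I)} (hB : MeasurableSet B) :
    ∫⁻ x in A, C.kernel x B = C.splitMeasure (A ×ˢ B) := by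
  rw [← C.volume_compProd_kernel, Measure.compProd_apply_prod hA hB]

lemma splitMeasure_prod (C : Copula (m + 1)) {A : Set I} (hA : MeasurableSet A)
    {B : Set (Fin m → I)} (hB : MeasurableSet B) :
    C.splitMeasure (A ×ˢ B) = C.measure {u | u 0 ∈ A ∧ (fun i : Fin m => u i.succ) ∈ B} := by
  rw [splitMeasure, Measure.map_apply (by fun_prop) (hA.prod hB)]
  rfl

lemma splitMeasure_Iic (C : Copula (m + 1)) (x : I) (y : Fin m → I) :
    C.splitMeasure (Set.Iic x ×ˢ Set.Iic y) = ENNReal.ofReal (C.cdf (Fin.cons x y)) := by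
  rw [C.splitMeasure_prod measurableSet_Iic (measurableSet_Iic_pi y), cdf, ofReal_measureReal]
  congr 1
  ext u
  simp [Pi.le_def, Fin.forall_fin_succ]

lemma lintegral_kernel_eval_mem (C : Copula (m + 1)) (i : Fin m) {S : Set I}
    (hS : MeasurableSet S) : ∫⁻ x, C.kernel x {u | u i ∈ S} = volume S := by
  have hB : MeasurableSet {u : Fin m → I | u i ∈ S} := measurable_pi_apply i hS
  rw [← setLIntegral_univ, C.setLIntegral_kernel .univ hB, C.splitMeasure_prod .univ hB,
    ← C.map_eval i.succ, Measure.map_apply (by fun_prop) hS]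
  congr 1
  ext u
  simp

lemma measurable_kernelCdf (C : Copula (m + 1)) :
    Measurable fun z : I × (Fin m → I) => C.kernelCdf z.1 z.2 := by
  have hset : MeasurableSet {q : (I × (Fin m → I)) × (Fin m → I) | q.2 ≤ q.1.2} :=
    (isClosed_le continuous_snd (continuous_snd.comp continuous_fst)).measurableSet
  have := Kernel.measurable_kernel_prodMk_left
    (κ := C.kernel.comap (Prod.fst : I × (Fin m → I) → I) measurable_fst) hset
  exact this.ennreal_toReal

lemma kernelCdf_nonneg (C : Copula (m + 1)) (x : I) (y : Fin m → I) : 0 ≤ C.kernelCdf x y :=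
  measureReal_nonneg

lemma kernelCdf_le_one (C : Copula (m + 1)) (x : I) (y : Fin m → I) : C.kernelCdf x y ≤ 1 :=
  measureReal_le_one

lemma measurable_kernelCdf_left (C : Copula (m + 1)) (y : Fin m → I) :
    Measurable fun x => C.kernelCdf x y :=
  C.measurable_kernelCdf.comp (measurable_id.prodMk measurable_const)

lemma abs_kernelCdf_sub_le_one (A B : Copula (m + 1)) (x : I) (y : Fin m → I) :
    |A.kernelCdf x y - B.kernelCdf x y| ≤ 1 := by
  rw [abs_le]
  have := A.kernelCdf_nonneg x y
  have := B.kernelCdf_nonneg x y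
  have := A.kernelCdf_le_one x y
  have := B.kernelCdf_le_one x y
  constructor <;> linarith

lemma integrable_of_abs_le_one {α : Type*} [MeasurableSpace α] {μ : Measure α} [IsFiniteMeasure μ]
    {f : α → ℝ} (hf : Measurable f) (h : ∀ x, |f x| ≤ 1) : Integrable f μ :=
  Integrable.of_bound hf.aestronglyMeasurable 1 (Eventually.of_forall h)

lemma integrable_kernelCdf_left (C : Copula (m + 1)) (y : Fin m → I) :
    Integrable fun x => C.kernelCdf x y :=
  integrable_of_abs_le_one (C.measurable_kernelCdf_left y) fun x => by
    rw [abs_of_nonneg (C.kernelCdf_nonneg x y)]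
    exact C.kernelCdf_le_one x y

lemma setIntegral_kernelCdf (C : Copula (m + 1)) (x : I) (y : Fin m → I) :
    ∫ t in Set.Iic x, C.kernelCdf t y = C.cdf (Fin.cons x y) := by
  rw [integral_eq_lintegral_of_nonneg_ae (Eventually.of_forall fun t => C.kernelCdf_nonneg t y)
    (C.measurable_kernelCdf_left y).aestronglyMeasurable]
  have e : ∀ t, ENNReal.ofReal (C.kernelCdf t y) = C.kernel t (Set.Iic y) := fun t =>
    ofReal_measureReal
  simp_rw [e]
  rw [C.setLIntegral_kernel measurableSet_Iic (measurableSet_Iic_pi y), C.splitMeasure_Iic,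
    ENNReal.toReal_ofReal (C.cdf_nonneg _)]

/-! ### Comparison of the metrics -/

/-- The `L¹`-distance of two kernels evaluated at the lower orthant of `y`. -/
noncomputable def kernelDist (A B : Copula (m + 1)) (y : Fin m → I) : ℝ :=
  ∫ x : I, |A.kernelCdf x y - B.kernelCdf x y|

lemma measurable_abs_kernelCdf_sub (A B : Copula (m + 1)) :
    Measurable fun z : I × (Fin m → I) => |A.kernelCdf z.1 z.2 - B.kernelCdf z.1 z.2| :=
  (A.measurable_kernelCdf.sub B.measurable_kernelCdf).norm

lemma integrable_abs_kernelCdf_sub (A B : Copula (m + 1)) (y : Fin m → I) :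
    Integrable fun x => |A.kernelCdf x y - B.kernelCdf x y| :=
  ((A.integrable_kernelCdf_left y).sub (B.integrable_kernelCdf_left y)).abs

lemma integrable_prod_abs_kernelCdf_sub (A B : Copula (m + 1)) :
    Integrable fun z : I × (Fin m → I) => |A.kernelCdf z.1 z.2 - B.kernelCdf z.1 z.2| :=
  integrable_of_abs_le_one (measurable_abs_kernelCdf_sub A B) fun z => by
    rw [abs_abs]
    exact abs_kernelCdf_sub_le_one A B z.1 z.2

lemma kernelDist_nonneg (A B : Copula (m + 1)) (y : Fin m → I) : 0 ≤ kernelDist A B y :=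
  integral_nonneg fun _ => abs_nonneg _

lemma kernelDist_le_one (A B : Copula (m + 1)) (y : Fin m → I) : kernelDist A B y ≤ 1 := by
  have := integral_mono (integrable_abs_kernelCdf_sub A B y) (integrable_const (μ := volume) (1:ℝ))
    (fun x => abs_kernelCdf_sub_le_one A B x y)
  simpa [kernelDist] using this

lemma D1_eq_integral_kernelDist (A B : Copula (m + 1)) : D1 A B = ∫ y, kernelDist A B y :=
  integral_prod_symm _ (integrable_prod_abs_kernelCdf_sub A B)

lemma integrable_kernelDist (A B : Copula (m + 1)) : Integrable (kernelDist A B) :=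
  (integrable_prod_abs_kernelCdf_sub A B).integral_prod_right

/-- For a fixed `x` the kernel may be discontinuous in `y`. Averaging over `x` turns the slab masses
into those of the uniform marginals, so the average is Lipschitz. -/
lemma integral_abs_kernelCdf_sub_le (C : Copula (m + 1)) (y y' : Fin m → I) :
    ∫ x, |C.kernelCdf x y - C.kernelCdf x y'| ≤ ∑ i, dist (y i) (y' i) := by
  have hS : ∀ i : Fin m, MeasurableSet {u : Fin m → I | u i ∈ Set.uIoc (y i) (y' i)} := fun i =>
    measurable_pi_apply i measurableSet_uIoc
  have hm : ∀ i : Fin m, Measurable fun x => (C.kernel x).real {u | u i ∈ Set.uIoc (y i) (y' i)} :=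
    fun i => (C.kernel.measurable_coe (hS i)).ennreal_toReal
  have hint : ∀ i : Fin m, Integrable fun x => (C.kernel x).real {u | u i ∈ Set.uIoc (y i) (y' i)} :=
    fun i => integrable_of_abs_le_one (hm i) fun x => by
      rw [abs_of_nonneg measureReal_nonneg]
      exact measureReal_le_one
  calc ∫ x, |C.kernelCdf x y - C.kernelCdf x y'|
      ≤ ∫ x, ∑ i, (C.kernel x).real {u | u i ∈ Set.uIoc (y i) (y' i)} :=
        integral_mono ((C.integrable_kernelCdf_left y).sub (C.integrable_kernelCdf_left y')).abs
          (integrable_finsetSum _ fun i _ => hint i)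
          fun x => abs_measureReal_Iic_sub_le (C.kernel x) y y'
    _ = ∑ i, ∫ x, (C.kernel x).real {u | u i ∈ Set.uIoc (y i) (y' i)} :=
        integral_finsetSum _ fun i _ => hint i
    _ = ∑ i, dist (y i) (y' i) := by
        refine Finset.sum_congr rfl fun i _ => ?_
        rw [integral_eq_lintegral_of_nonneg_ae (Eventually.of_forall fun x => measureReal_nonneg)
          (hm i).aestronglyMeasurable]
        have e : ∀ x, ENNReal.ofReal ((C.kernel x).real {u | u i ∈ Set.uIoc (y i) (y' i)}) =
          C.kernel x {u | u i ∈ Set.uIoc (y i) (y' i)} := fun x => ofReal_measureReal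
        simp_rw [e]
        rw [C.lintegral_kernel_eval_mem i measurableSet_uIoc, ← volumeReal_uIoc, measureReal_def]

lemma abs_kernelDist_sub_le (A B : Copula (m + 1)) (y y' : Fin m → I) :
    |kernelDist A B y - kernelDist A B y'| ≤ 2 * ∑ i, dist (y i) (y' i) := by
  have hA : Integrable fun x => |A.kernelCdf x y - A.kernelCdf x y'| :=
    ((A.integrable_kernelCdf_left y).sub (A.integrable_kernelCdf_left y')).abs
  have hB : Integrable fun x => |B.kernelCdf x y - B.kernelCdf x y'| :=
    ((B.integrable_kernelCdf_left y).sub (B.integrable_kernelCdf_left y')).abs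
  have h0 := integrable_abs_kernelCdf_sub A B y
  have h1 := integrable_abs_kernelCdf_sub A B y'
  calc |kernelDist A B y - kernelDist A B y'|
      = |∫ x, (|A.kernelCdf x y - B.kernelCdf x y| - |A.kernelCdf x y' - B.kernelCdf x y'|)| := by
        rw [integral_sub h0 h1]; rfl
    _ ≤ ∫ x, |(|A.kernelCdf x y - B.kernelCdf x y|) - (|A.kernelCdf x y' - B.kernelCdf x y'|)| :=
        abs_integral_le_integral_abs
    _ ≤ ∫ x, (|A.kernelCdf x y - A.kernelCdf x y'| + |B.kernelCdf x y - B.kernelCdf x y'|) := by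
        refine integral_mono (h0.sub h1).abs (hA.add hB) fun x => ?_
        refine (abs_abs_sub_abs_le_abs_sub _ _).trans ?_
        rw [show A.kernelCdf x y - B.kernelCdf x y - (A.kernelCdf x y' - B.kernelCdf x y')
          = (A.kernelCdf x y - A.kernelCdf x y') - (B.kernelCdf x y - B.kernelCdf x y') by ring]
        exact abs_sub _ _
    _ ≤ 2 * ∑ i, dist (y i) (y' i) := by
        rw [integral_add hA hB, two_mul]
        exact add_le_add (A.integral_abs_kernelCdf_sub_le y y') (B.integral_abs_kernelCdf_sub_le y y')

lemma kernelDist_le_DInf (A B : Copula (m + 1)) (y : Fin m → I) : kernelDist A B y ≤ DInf A B :=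
  le_ciSup (f := kernelDist A B) ⟨1, by rintro _ ⟨y, rfl⟩; exact kernelDist_le_one A B y⟩ y

lemma DInf_nonneg (A B : Copula (m + 1)) : 0 ≤ DInf A B :=
  (kernelDist_nonneg A B 0).trans (kernelDist_le_DInf A B 0)

lemma D1_nonneg (A B : Copula (m + 1)) : 0 ≤ D1 A B := integral_nonneg fun _ => abs_nonneg _

lemma D1_le_DInf (A B : Copula (m + 1)) : D1 A B ≤ DInf A B := by
  rw [D1_eq_integral_kernelDist]
  have := integral_mono (integrable_kernelDist A B) (integrable_const (μ := volume) (DInf A B))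
    (fun y => kernelDist_le_DInf A B y)
  simpa using this

lemma D2_le_sqrt_D1 (A B : Copula (m + 1)) : D2 A B ≤ Real.sqrt (D1 A B) := by
  refine Real.sqrt_le_sqrt (integral_mono_of_nonneg (Eventually.of_forall fun z => sq_nonneg _)
    (integrable_prod_abs_kernelCdf_sub A B) (Eventually.of_forall fun z => ?_))
  have h := abs_kernelCdf_sub_le_one A B z.1 z.2
  simp only
  rw [← sq_abs]
  nlinarith [abs_nonneg (A.kernelCdf z.1 z.2 - B.kernelCdf z.1 z.2)]

/-- Jensen's inequality for the square on a probability space. -/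
lemma D1_le_D2 (A B : Copula (m + 1)) : D1 A B ≤ D2 A B := by
  refine Real.le_sqrt_of_sq_le ?_
  have h1 := integrable_prod_abs_kernelCdf_sub A B
  have h2 : Integrable fun z : I × (Fin m → I) => |A.kernelCdf z.1 z.2 - B.kernelCdf z.1 z.2| ^ 2 :=
    integrable_of_abs_le_one ((measurable_abs_kernelCdf_sub A B).pow_const 2) fun z => by
      rw [abs_pow, abs_abs]
      exact pow_le_one₀ (abs_nonneg _) (abs_kernelCdf_sub_le_one A B z.1 z.2)
  have := ConvexOn.map_integral_le (s := Set.univ) (g := fun t : ℝ => t ^ 2) (even_two.convexOn_pow)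
    (by fun_prop) isClosed_univ (Eventually.of_forall fun _ => Set.mem_univ _) h1 h2
  simpa only [sq_abs, D1] using this

lemma tendsto_DInf {Cs : ℕ → Copula (m + 1)} {C : Copula (m + 1)}
    (h : ∀ y, Tendsto (fun n => kernelDist (Cs n) C y) atTop (𝓝 0)) :
    Tendsto (fun n => DInf (Cs n) C) atTop (𝓝 0) := by
  have hu : TendstoUniformly (fun n => kernelDist (Cs n) C) (fun _ => 0) atTop := by
    refine tendstoUniformly_of_modulus (ω := fun y y' => 2 * ∑ i, dist (y i) (y' i))
      (fun y => by simpa using (tendsto_sum_dist y).const_mul 2)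
      (fun n => abs_kernelDist_sub_le _ _) (fun y y' => ?_) h
    simp only [sub_self, abs_zero]
    positivity
  rw [Metric.tendsto_atTop]
  intro ε hε
  obtain ⟨N, hN⟩ := eventually_atTop.1 (Metric.tendstoUniformly_iff.1 hu (ε / 2) (half_pos hε))
  refine ⟨N, fun n hn => ?_⟩
  rw [Real.dist_eq, sub_zero, abs_of_nonneg (DInf_nonneg _ _)]
  refine lt_of_le_of_lt (ciSup_le fun y => ?_) (half_lt_self hε)
  have := hN n hn y
  rw [dist_zero_left, Real.norm_eq_abs] at this
  exact (le_abs_self _).trans this.le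

/-- If `kernelDist` is at least `ε` at `y`, the Lipschitz bound keeps it at least `ε / 2` on a fixed
neighbourhood of positive volume, so `D₁` cannot be small. -/
lemma tendsto_kernelDist_of_D1 {Cs : ℕ → Copula (m + 1)} {C : Copula (m + 1)}
    (h : Tendsto (fun n => D1 (Cs n) C) atTop (𝓝 0)) (y : Fin m → I) :
    Tendsto (fun n => kernelDist (Cs n) C y) atTop (𝓝 0) := by
  rw [Metric.tendsto_atTop]
  intro ε hε
  let U : Set (Fin m → I) := {y' | 2 * ∑ i, dist (y i) (y' i) < ε / 2}
  have hU : IsOpen U := isOpen_lt (by fun_prop) continuous_const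
  have hpos : 0 < volume.real U := by
    rw [measureReal_def]
    refine ENNReal.toReal_pos (hU.measure_pos volume ⟨y, ?_⟩).ne' (measure_ne_top _ _)
    simpa [U] using hε
  obtain ⟨N, hN⟩ := eventually_atTop.1
    (h.eventually (gt_mem_nhds (show 0 < ε / 2 * volume.real U by positivity)))
  refine ⟨N, fun n hn => ?_⟩
  rw [Real.dist_eq, sub_zero, abs_of_nonneg (kernelDist_nonneg _ _ _)]
  by_contra! hge
  refine (hN n hn).not_ge ?_
  rw [D1_eq_integral_kernelDist]
  calc ε / 2 * volume.real U = ∫ y' in U, ε / 2 := by simp [mul_comm]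
    _ ≤ ∫ y' in U, kernelDist (Cs n) C y' := by
        refine setIntegral_mono_on (integrable_const _) (integrable_kernelDist _ _).integrableOn
          hU.measurableSet fun y' hy' => ?_
        have := (abs_le.1 (abs_kernelDist_sub_le (Cs n) C y y')).2
        have h2 : 2 * ∑ i, dist (y i) (y' i) < ε / 2 := hy'
        linarith
    _ ≤ ∫ y', kernelDist (Cs n) C y' :=
        setIntegral_le_integral (integrable_kernelDist _ _)
          (Eventually.of_forall fun y' => kernelDist_nonneg _ _ y')

lemma abs_cdf_sub_le_kernelDist (A B : Copula (m + 1)) (x : Fin (m + 1) → I) :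
    |A.cdf x - B.cdf x| ≤ kernelDist A B (fun i => x i.succ) := by
  have e : ∀ C : Copula (m + 1), C.cdf x
      = ∫ t in Set.Iic (x 0), C.kernelCdf t (fun i => x i.succ) := fun C => by
    rw [C.setIntegral_kernelCdf]
    congr 1
    exact (Fin.cons_self_tail x).symm
  rw [e A, e B, ← integral_sub (A.integrable_kernelCdf_left _).integrableOn
    (B.integrable_kernelCdf_left _).integrableOn]
  refine abs_integral_le_integral_abs.trans ?_
  exact setIntegral_le_integral (integrable_abs_kernelCdf_sub A B _)
    (Eventually.of_forall fun _ => abs_nonneg _)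

lemma tendstoUniformly_cdf_of_kernelDist {Cs : ℕ → Copula (m + 1)} {C : Copula (m + 1)}
    (h : ∀ y, Tendsto (fun n => kernelDist (Cs n) C y) atTop (𝓝 0)) :
    TendstoUniformly (fun n => (Cs n).cdf) C.cdf atTop := by
  refine tendstoUniformly_cdf fun x => ?_
  rw [tendsto_iff_norm_sub_tendsto_zero]
  exact squeeze_zero (fun _ => norm_nonneg _) (fun n => abs_cdf_sub_le_kernelDist (Cs n) C x) (h _)

/-- The frontier lies in the hyperplanes `u i = y i`, whose kernel masses integrate to the uniform
measure of a point. This is the null-frontier condition of the portmanteau theorem. -/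
lemma ae_kernel_frontier_Iic (C : Copula (m + 1)) (y : Fin m → I) :
    ∀ᵐ x : I, C.kernel x (frontier (Set.Iic y)) = 0 := by
  have h1 : ∀ i : Fin m, ∀ᵐ x : I, C.kernel x {u | u i ∈ ({y i} : Set I)} = 0 := fun i => by
    have hS : MeasurableSet {u : Fin m → I | u i ∈ ({y i} : Set I)} :=
      measurable_pi_apply i (measurableSet_singleton _)
    have := C.lintegral_kernel_eval_mem i (measurableSet_singleton (y i))
    rw [measure_singleton, lintegral_eq_zero_iff (C.kernel.measurable_coe hS)] at this
    exact this
  filter_upwards [ae_all_iff.2 h1] with x hx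
  refine measure_mono_null (t := ⋃ i, {u | u i ∈ ({y i} : Set I)}) ?_ (measure_iUnion_null hx)
  have ho : IsOpen {u : Fin m → I | ∀ i, u i < y i} := by
    simp only [Set.ofPred_forall]
    exact isOpen_iInter_of_finite fun i => isOpen_lt (continuous_apply i) continuous_const
  intro u hu
  rw [isClosed_Iic.frontier_eq] at hu
  by_contra hne
  simp only [Set.mem_iUnion, Set.mem_ofPred_eq, Set.mem_singleton_iff, not_exists] at hne
  exact hu.2 (mem_interior.2 ⟨_, fun v hv i => (hv i).le, ho,
    fun i => lt_of_le_of_ne (hu.1 i) (hne i)⟩)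

lemma tendsto_kernelDist_of_weaklyConditional {Cs : ℕ → Copula (m + 1)} {C : Copula (m + 1)}
    (h : TendstoWeaklyConditional Cs C) (y : Fin m → I) :
    Tendsto (fun n => kernelDist (Cs n) C y) atTop (𝓝 0) := by
  obtain ⟨Λ, hΛ, hΛ1, hlim⟩ := h
  rw [C.map_eval 0] at hΛ1
  have hae : ∀ᵐ x : I, x ∈ Λ := (prob_compl_eq_zero_iff hΛ).2 hΛ1
  have := tendsto_integral_of_dominated_convergence (μ := (volume : Measure I))
    (F := fun n x => |(Cs n).kernelCdf x y - C.kernelCdf x y|) (f := fun _ => 0) (fun _ => 1)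
    (fun n => (integrable_abs_kernelCdf_sub (Cs n) C y).aestronglyMeasurable) (integrable_const _)
    (fun n => Eventually.of_forall fun x => by
      rw [Real.norm_eq_abs, abs_abs]
      exact abs_kernelCdf_sub_le_one _ _ x y) ?_
  · simpa [kernelDist] using this
  · filter_upwards [hae, C.ae_kernel_frontier_Iic y] with x hx hfr
    have h1 := ProbabilityMeasure.tendsto_measure_of_null_frontier_of_tendsto' (hlim x hx) hfr
    have h2 := (ENNReal.tendsto_toReal (measure_ne_top _ _)).comp h1
    have h3 : Tendsto (fun n => (Cs n).kernelCdf x y) atTop (𝓝 (C.kernelCdf x y)) := h2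
    simpa using (h3.sub_const (C.kernelCdf x y)).abs

end Copula

/-! ### Distribution functions determine measures and weak limits -/

lemma isPiSystem_Iic_of_mem {m : ℕ} (D : Set I) :
    IsPiSystem {A : Set (Fin m → I) | ∃ y, (∀ i, y i ∈ D) ∧ A = Set.Iic y} := by
  rintro _ ⟨y, hy, rfl⟩ _ ⟨z, hz, rfl⟩ -
  refine ⟨y ⊓ z, fun i => ?_, Set.Iic_inter_Iic⟩
  rcases min_choice (y i) (z i) with h | h
  · exact (show (y ⊓ z) i = y i from h) ▸ hy i
  · exact (show (y ⊓ z) i = z i from h) ▸ hz i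

lemma exists_mem_Iic_mem_nhds {D : Set I} (hD : Dense D) (h1 : 1 ∈ D) (t : I) {ε : ℝ} (hε : 0 < ε) :
    ∃ b ∈ D, Set.Iic b ∈ 𝓝 t ∧ (b : ℝ) < t + ε := by
  rcases eq_or_ne t 1 with rfl | ht
  · refine ⟨1, h1, ?_, by simpa using hε⟩
    rw [show Set.Iic (1 : I) = Set.univ from Set.eq_univ_of_forall fun x => unitInterval.le_one x]
    exact univ_mem
  · have ht1 : (t:ℝ) < 1 := lt_of_le_of_ne t.2.2 fun h => ht (Subtype.ext h)
    let s : I := ⟨min 1 (t + ε), le_min zero_le_one (by linarith [t.2.1]), min_le_left _ _⟩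
    have hts : t < s := Subtype.coe_lt_coe.1 (lt_min ht1 (by linarith))
    obtain ⟨b, hb, htb, hbs⟩ := hD.exists_between hts
    refine ⟨b, hb, Iic_mem_nhds htb, ?_⟩
    exact lt_of_lt_of_le (Subtype.coe_lt_coe.2 hbs) (min_le_right _ _)

lemma exists_mem_lt {D : Set I} (hD : Dense D) {t : I} (ht : 0 < t) {ε : ℝ} (hε : 0 < ε) :
    ∃ a ∈ D, a < t ∧ (t : ℝ) - ε < a := by
  have ht0 : (0:ℝ) < t := ht
  let s : I := ⟨max 0 (t - ε), le_max_left _ _, max_le zero_le_one (by linarith [t.2.2])⟩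
  have hts : s < t := Subtype.coe_lt_coe.1 (max_lt ht0 (by linarith))
  obtain ⟨a, ha, hsa, hat⟩ := hD.exists_between hts
  exact ⟨a, ha, hat, lt_of_le_of_lt (le_max_right _ _) (Subtype.coe_lt_coe.2 hsa)⟩

/-- The sets `Iic y` minus finitely many orthants form a π-system containing arbitrarily small
neighbourhoods of each point, and inclusion–exclusion carries convergence from orthants to them.
That corners in a dense `D` suffice allows `D` to be countable in the application. The point `1` of
`D` serves as upper bound near `1` and as the unconstrained coordinate. -/
lemma tendsto_probabilityMeasure_of_tendsto_Iic {m : ℕ} {D : Set I} (hD : Dense D) (h1 : 1 ∈ D)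
    {μs : ℕ → ProbabilityMeasure (Fin m → I)} {μ : ProbabilityMeasure (Fin m → I)}
    (h : ∀ y : Fin m → I, (∀ i, y i ∈ D) →
      Tendsto (fun n => (μs n : Measure (Fin m → I)).real (Set.Iic y)) atTop
        (𝓝 ((μ : Measure (Fin m → I)).real (Set.Iic y)))) :
    Tendsto μs atTop (𝓝 μ) := by
  classical
  have hinf : ∀ {y z : Fin m → I}, (∀ i, y i ∈ D) → (∀ i, z i ∈ D) → ∀ i, (y ⊓ z) i ∈ D := by
    intro y z hy hz i
    rcases min_choice (y i) (z i) with h | h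
    · exact (show (y ⊓ z) i = y i from h) ▸ hy i
    · exact (show (y ⊓ z) i = z i from h) ▸ hz i
  have hmU : ∀ F : Finset (Fin m → I), MeasurableSet (⋃ z ∈ F, Set.Iic z) := fun F =>
    F.measurableSet_biUnion fun z _ => measurableSet_Iic_pi z
  let S : Set (Set (Fin m → I)) := {A | ∃ y, (∀ i, y i ∈ D) ∧ ∃ F : Finset (Fin m → I),
    (∀ z ∈ F, ∀ i, z i ∈ D) ∧ A = Set.Iic y \ ⋃ z ∈ F, Set.Iic z}
  have hS : IsPiSystem S := by
    rintro _ ⟨y, hy, F, hF, rfl⟩ _ ⟨y', hy', F', hF', rfl⟩ -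
    refine ⟨y ⊓ y', hinf hy hy', F ∪ F', fun z hz => ?_, ?_⟩
    · rcases Finset.mem_union.1 hz with hz | hz
      exacts [hF z hz, hF' z hz]
    · rw [Finset.set_biUnion_union, ← Set.Iic_inter_Iic]
      ext u
      simp only [Set.mem_inter_iff, Set.mem_sdiff, Set.mem_union]
      tauto
  refine hS.tendsto_probabilityMeasure_of_tendsto_of_mem ?_ ?_ ?_
  · rintro _ ⟨y, hy, F, hF, rfl⟩
    exact (measurableSet_Iic_pi y).diff (hmU F)
  · intro G hG u hu
    obtain ⟨ε, hε, hball⟩ := Metric.isOpen_iff.1 hG u hu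
    choose b hbD hbn hbε using fun i => exists_mem_Iic_mem_nhds hD h1 (u i) hε
    have ha : ∀ i, ∃ a ∈ D, 0 < u i → a < u i ∧ (u i : ℝ) - ε < a := fun i => by
      by_cases h0 : 0 < u i
      · obtain ⟨a, haD, ha⟩ := exists_mem_lt hD h0 hε
        exact ⟨a, haD, fun _ => ha⟩
      -- An arbitrary member of `D`: where `u i = 0` no lower bound is imposed.
      · exact ⟨1, h1, fun h => absurd h h0⟩
    choose a haD ha using ha
    -- Removing the orthant with `i`-th corner `a i` and all other corners `1` imposes exactly `a i
    -- < v i`.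
    let F : Finset (Fin m → I) := (Finset.univ.filter fun i => 0 < u i).image
      fun i => Function.update (fun _ => 1) i (a i)
    have hF : ∀ v : Fin m → I, v ∉ ⋃ z ∈ F, Set.Iic z ↔ ∀ i, 0 < u i → a i < v i := by
      intro v
      simp only [F, Finset.mem_image, Finset.mem_filter, Finset.mem_univ, true_and, Set.mem_iUnion,
        Set.mem_Iic, exists_prop, not_exists, not_and]
      constructor
      · intro hv i hi
        by_contra! hle
        refine hv _ ⟨i, hi, rfl⟩ fun j => ?_
        by_cases hj : j = i
        · subst hj; simpa using hle
        · rw [Function.update_of_ne hj]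
          exact (v j).2.2
      · rintro hv _ ⟨i, hi, rfl⟩ hle
        have := hle i
        rw [Function.update_self] at this
        exact (hv i hi).not_ge this
    refine ⟨Set.Iic b \ ⋃ z ∈ F, Set.Iic z, ⟨b, hbD, F, ?_, rfl⟩, ?_, ?_⟩
    · intro z hz j
      obtain ⟨i, -, rfl⟩ := Finset.mem_image.1 hz
      by_cases hj : j = i
      · subst hj; simpa using haD j
      · simpa [hj] using h1
    · have e1 : ∀ᶠ v in 𝓝 u, ∀ i, v i ≤ b i := eventually_all.2 fun i =>
        (continuous_apply i).continuousAt.eventually (hbn i)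
      have e2 : ∀ᶠ v in 𝓝 u, ∀ i, 0 < u i → a i < v i := eventually_all.2 fun i => by
        by_cases h0 : 0 < u i
        · filter_upwards [(continuous_apply i).continuousAt.eventually (lt_mem_nhds (ha i h0).1)]
            with v hv _ using hv
        · exact Eventually.of_forall fun v h => absurd h h0
      filter_upwards [e1, e2] with v hv1 hv2
      exact ⟨hv1, (hF v).2 hv2⟩
    · rintro v ⟨hv1, hv2⟩
      rw [hF] at hv2
      refine hball ((dist_pi_lt_iff hε).2 fun i => ?_)
      rw [Subtype.dist_eq, Real.dist_eq, abs_lt]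
      have h3 : (v i : ℝ) ≤ b i := hv1 i
      have h4 := hbε i
      refine ⟨?_, by linarith⟩
      by_cases h0 : 0 < u i
      · have h5 : (a i : ℝ) < v i := hv2 i h0
        linarith [(ha i h0).2]
      · have : (u i : ℝ) = 0 := le_antisymm (not_lt.1 h0) (u i).2.1
        linarith [(v i).2.1]
  · rintro _ ⟨y, hy, F, hF, rfl⟩
    have e : ∀ ν : ProbabilityMeasure (Fin m → I),
        (ν : Measure (Fin m → I)).real (Set.Iic y \ ⋃ z ∈ F, Set.Iic z) =
          (ν : Measure (Fin m → I)).real (Set.Iic y) -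
          (ν : Measure (Fin m → I)).real (⋃ s ∈ F.image (fun z => Set.Iic (y ⊓ z)), s) := by
      intro ν
      have hsub : (⋃ s ∈ F.image (fun z => Set.Iic (y ⊓ z)), s) = Set.Iic y ∩ ⋃ z ∈ F, Set.Iic z := by
        simp only [Finset.set_biUnion_finset_image, ← Set.Iic_inter_Iic, Set.inter_iUnion]
      rw [hsub, ← Set.sdiff_inter_self_eq_sdiff, Set.inter_comm,
        measureReal_sdiff Set.inter_subset_left ((measurableSet_Iic_pi y).inter (hmU F))]
    have h2 := (isPiSystem_Iic_of_mem (m := m) D).tendsto_measureReal_biUnion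
      (μ := fun n => (μs n : Measure (Fin m → I))) (ν := (μ : Measure (Fin m → I)))
      (t := F.image (fun z => Set.Iic (y ⊓ z))) (l := atTop)
      (fun s hs => by
        obtain ⟨z, hz, rfl⟩ := Finset.mem_image.1 hs
        exact ⟨y ⊓ z, hinf hy (hF z hz), rfl⟩)
      (by rintro _ ⟨z, -, rfl⟩; exact measurableSet_Iic_pi z)
      (by rintro _ ⟨z, hz, rfl⟩; exact h z hz)
    have h3 := (h y hy).sub h2
    simp_rw [← e] at h3
    rw [← NNReal.tendsto_coe]
    exact h3

/-- Corners with a zero coordinate are limits from above of positive ones. Restricting to positive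
corners matters because `genInv` is meaningful only on `(0,1]`. -/
lemma Measure.ext_of_Iic_pos {m : ℕ} {μ ν : Measure (Fin m → I)} [IsFiniteMeasure μ]
    [IsFiniteMeasure ν] (h : ∀ x : Fin m → I, (∀ i, 0 < x i) → μ (Set.Iic x) = ν (Set.Iic x)) :
    μ = ν := by
  have hall : ∀ x : Fin m → I, μ (Set.Iic x) = ν (Set.Iic x) := by
    intro x
    let w : ℕ → I := fun k => ⟨1 / ((k:ℝ) + 1), by positivity, by
      rw [div_le_one (by positivity)]; linarith [(Nat.cast_nonneg k : (0:ℝ) ≤ k)]⟩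
    have hw0 : ∀ k, 0 < w k := fun k => by
      rw [← Subtype.coe_lt_coe]
      simp only [w]
      positivity
    have hwlim : Tendsto w atTop (𝓝 0) :=
      tendsto_subtype_rng.2 (tendsto_one_div_add_atTop_nhds_zero_nat (𝕜 := ℝ))
    have hwanti : Antitone w := fun k l hkl => by
      rw [← Subtype.coe_le_coe]
      simp only [w]
      gcongr
    let X : ℕ → Fin m → I := fun k i => max (x i) (w k)
    have hX : Antitone fun k => Set.Iic (X k) := fun k l hkl =>
      Set.Iic_subset_Iic.2 fun i => max_le_max le_rfl (hwanti hkl)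
    have hInter : ⋂ k, Set.Iic (X k) = Set.Iic x := by
      ext u
      simp only [Set.mem_iInter, Set.mem_Iic]
      refine ⟨fun hu i => ?_, fun hu k i => (hu i).trans (le_max_left _ _)⟩
      have : Tendsto (fun k => max (x i) (w k)) atTop (𝓝 (max (x i) 0)) :=
        tendsto_const_nhds.max hwlim
      rw [max_eq_left (show (0 : I) ≤ x i from (x i).2.1)] at this
      exact ge_of_tendsto this (Eventually.of_forall fun k => hu k i)
    have lim : ∀ ρ : Measure (Fin m → I), IsFiniteMeasure ρ →
        Tendsto (fun k => ρ (Set.Iic (X k))) atTop (𝓝 (ρ (Set.Iic x))) := fun ρ _ => by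
      rw [← hInter]
      exact tendsto_measure_iInter_atTop (fun k => (measurableSet_Iic_pi _).nullMeasurableSet) hX
        ⟨0, measure_ne_top _ _⟩
    refine tendsto_nhds_unique (lim μ inferInstance) ((lim ν inferInstance).congr fun k => ?_)
    exact (h (X k) fun i => (hw0 k).trans_le (le_max_right _ _)).symm
  have huniv : (Set.Iic fun _ => 1 : Set (Fin m → I)) = Set.univ :=
    Set.eq_univ_of_forall fun u i => unitInterval.le_one _
  refine ext_of_generate_finite (Set.pi Set.univ '' Set.pi Set.univ fun _ => Set.range Set.Iic)
    (generateFrom_eq_pi (fun _ => ?_) (fun _ => ?_)).symm ?_ ?_ (by rw [← huniv, hall])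
  · rw [← borel_eq_generateFrom_Iic, BorelSpace.measurable_eq (α := I)]
  · exact ⟨fun _ => Set.Iic 1, fun _ => ⟨1, rfl⟩, Set.eq_univ_of_forall fun x =>
      Set.mem_iUnion.2 ⟨0, unitInterval.le_one x⟩⟩
  · refine IsPiSystem.pi fun _ => ?_
    rintro _ ⟨x, rfl⟩ _ ⟨y, rfl⟩ -
    exact ⟨x ⊓ y, Set.Iic_inter_Iic.symm⟩
  · rintro _ ⟨s, hs, rfl⟩
    choose x hx using fun i => hs i (Set.mem_univ i)
    have : Set.pi Set.univ s = Set.Iic x := by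
      rw [← Set.pi_univ_Iic]
      exact congrArg _ (funext fun i => (hx i).symm)
    rw [this, hall]

lemma Measure.ext_of_Iic_pos_unitInterval {μ ν : Measure I} [IsFiniteMeasure μ] [IsFiniteMeasure ν]
    (h : ∀ x : I, 0 < x → μ (Set.Iic x) = ν (Set.Iic x)) : μ = ν := by
  have hm : Measurable fun x : I => fun _ : Fin 1 => x := by fun_prop
  have h1 : μ.map (fun x => fun _ : Fin 1 => x) = ν.map (fun x => fun _ : Fin 1 => x) := by
    refine Measure.ext_of_Iic_pos fun x hx => ?_
    rw [Measure.map_apply hm (measurableSet_Iic_pi _), Measure.map_apply hm (measurableSet_Iic_pi _)]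
    have : (fun x => fun _ : Fin 1 => x) ⁻¹' Set.Iic x = Set.Iic (x 0) := by
      ext t
      simp [Pi.le_def]
    rw [this, h _ (hx 0)]
  have h2 := congrArg (Measure.map fun u : Fin 1 → I => u 0) h1
  rw [Measure.map_map (by fun_prop) hm, Measure.map_map (by fun_prop) hm] at h2
  simpa [Function.comp_def] using h2

namespace Copula.IsArchimedeanWith

variable {d p : ℕ} {ψ : ℝ → ℝ}

/-! ### The generator of an Archimedean copula is multiply monotone -/

lemma cdf_eq_of_pos {C : Copula d} (hC : C.IsArchimedeanWith ψ) {x : Fin d → I}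
    (hx : ∀ i, 0 < x i) : C.cdf x = ψ (∑ i, genInv ψ (x i)) := by
  have h := hC.isGenerator
  rw [hC.cdf_eq, ← genExt_ofReal ψ (Finset.sum_nonneg fun i _ => genInv_nonneg ψ (x i)),
    ENNReal.ofReal_sum_of_nonneg fun i _ => genInv_nonneg ψ (x i)]
  congr 1
  exact Finset.sum_congr rfl fun i _ => (h.ofReal_genInv (hx i)).symm

/-- If some `ψ (z i)` is zero, then `φ(ψ(z i))` may be smaller than `z i`, but both sides vanish. -/
lemma cdf_genUnit {C : Copula d} (hC : C.IsArchimedeanWith ψ) {z : Fin d → ℝ} (hz : ∀ i, 0 ≤ z i) :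
    C.cdf (fun i => genUnit ψ (z i)) = ψ (∑ i, z i) := by
  have h := hC.isGenerator
  by_cases hpos : ∀ i, 0 < ψ (z i)
  · rw [hC.cdf_eq_of_pos fun i => by
      rw [← Subtype.coe_lt_coe, h.coe_genUnit (hz i)]; exact hpos i]
    congr 1
    exact Finset.sum_congr rfl fun i _ => h.genInv_genUnit (hz i) (hpos i)
  · obtain ⟨i, hi⟩ := not_forall.1 hpos
    have hi0 : ψ (z i) = 0 := le_antisymm (not_lt.1 hi) (h.apply_nonneg (hz i))
    have hs : z i ≤ ∑ i, z i := Finset.single_le_sum (fun i _ => hz i) (Finset.mem_univ i)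
    have h1 := C.cdf_le_apply (fun i => genUnit ψ (z i)) i
    rw [h.coe_genUnit (hz i), hi0] at h1
    have h2 := h.antitoneOn (hz i) ((hz i).trans hs) hs
    rw [hi0] at h2
    rw [le_antisymm h1 (C.cdf_nonneg _), le_antisymm h2 (h.apply_nonneg ((hz i).trans hs))]

lemma genUnit_anti (h : IsArchimedeanGenerator ψ) {z w : ℝ} (hz : 0 ≤ z) (hzw : z ≤ w) :
    genUnit ψ w ≤ genUnit ψ z := by
  rw [← Subtype.coe_le_coe, h.coe_genUnit hz, h.coe_genUnit (hz.trans hzw)]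
  exact h.antitoneOn hz (hz.trans hzw) hzw

/-- In the coordinates `ψ(z i)`, imposing a lower bound on coordinate `k` removes the same box with
`z k` shifted by `h k`. Since the distribution function depends on `∑ z i` only, each removal is one
backward difference. -/
lemma measureReal_eq_iterDiff {C : Copula d} (hC : C.IsArchimedeanWith ψ) {h : ℕ → ℝ}
    (hh : ∀ i, 0 < h i) {k : ℕ} (hk : k ≤ d) {z : Fin d → ℝ} (hz : ∀ i, 0 ≤ z i) :
    C.measure.real {u | (∀ i : Fin d, i.1 < k → genUnit ψ (z i + h i) < u i) ∧
      ∀ i, u i ≤ genUnit ψ (z i)} = iterDiff h k ψ (∑ i, z i) := by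
  have hmeas : ∀ (k : ℕ) (z : Fin d → ℝ), MeasurableSet {u : Fin d → I |
      (∀ i : Fin d, i.1 < k → genUnit ψ (z i + h i) < u i) ∧ ∀ i, u i ≤ genUnit ψ (z i)} := by
    intro k z
    suffices h1 : MeasurableSet {u : Fin d → I |
        ∀ i : Fin d, i.1 < k → genUnit ψ (z i + h i) < u i} from
      h1.inter (measurableSet_Iic_pi fun i => genUnit ψ (z i))
    rw [Set.ofPred_forall]
    refine MeasurableSet.iInter fun i => ?_
    by_cases hi : i.1 < k
    · simp only [hi, true_imp_iff]
      exact measurableSet_lt measurable_const (measurable_pi_apply i)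
    · simp [hi]
  induction k generalizing z with
  | zero =>
    rw [iterDiff, ← hC.cdf_genUnit hz, Copula.cdf]
    congr 1
    ext u
    simp [Pi.le_def]
  | succ k ih =>
    let j : Fin d := ⟨k, hk⟩
    let z' := Function.update z j (z j + h k)
    have hz' : ∀ i, 0 ≤ z' i := fun i => by
      by_cases hi : i = j
      · subst hi
        simpa [z'] using add_nonneg (hz j) (hh k).le
      · simpa [z', hi] using hz i
    have hsum : ∑ i, z' i = ∑ i, z i + h k := by
      have e : z' = z + Pi.single j (h k) := by
        funext i
        by_cases hi : i = j
        · subst hi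
          simp [z']
        · simp [z', hi]
      simp only [e, Pi.add_apply, Finset.sum_add_distrib, Finset.sum_pi_single', Finset.mem_univ,
        if_true]
    have hj : j.1 = k := rfl
    have hset : {u : Fin d → I | (∀ i : Fin d, i.1 < k + 1 → genUnit ψ (z i + h i) < u i) ∧
        ∀ i, u i ≤ genUnit ψ (z i)} =
        {u | (∀ i : Fin d, i.1 < k → genUnit ψ (z i + h i) < u i) ∧ ∀ i, u i ≤ genUnit ψ (z i)} \
        {u | (∀ i : Fin d, i.1 < k → genUnit ψ (z' i + h i) < u i) ∧
          ∀ i, u i ≤ genUnit ψ (z' i)} := by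
      ext u
      simp only [Set.mem_sdiff, Set.mem_ofPred_eq]
      constructor
      · rintro ⟨h1, h2⟩
        refine ⟨⟨fun i hi => h1 i (by omega), h2⟩, fun h3 => ?_⟩
        have h4 := h3.2 j
        have h5 := h1 j (by simp [hj])
        rw [show z' j = z j + h k from Function.update_self ..] at h4
        exact h4.not_gt h5
      · rintro ⟨⟨h1, h2⟩, h3⟩
        refine ⟨fun i hi => ?_, h2⟩
        rcases (Nat.lt_succ_iff.1 hi).lt_or_eq with hi' | hi'
        · exact h1 i hi'
        · have hij : i = j := Fin.ext hi'
          subst hij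
          by_contra! hle
          refine h3 ⟨fun l hl => ?_, fun l => ?_⟩
          · have : l ≠ j := fun e => by rw [e] at hl; exact lt_irrefl _ hl
            rw [show z' l = z l from Function.update_of_ne this ..]
            exact h1 l hl
          · by_cases hl : l = j
            · subst hl
              rw [show z' j = z j + h k from Function.update_self ..]
              exact hle
            · rw [show z' l = z l from Function.update_of_ne hl ..]
              exact h2 l
    have hsub : {u : Fin d → I | (∀ i : Fin d, i.1 < k → genUnit ψ (z' i + h i) < u i) ∧
          ∀ i, u i ≤ genUnit ψ (z' i)} ⊆
        {u | (∀ i : Fin d, i.1 < k → genUnit ψ (z i + h i) < u i) ∧ ∀ i, u i ≤ genUnit ψ (z i)} := by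
      rintro u ⟨h1, h2⟩
      have hne : ∀ {l : Fin d}, l ≠ j → z' l = z l := fun hl => Function.update_of_ne hl ..
      refine ⟨fun i hi => ?_, fun i => ?_⟩
      · have : i ≠ j := fun e => by rw [e] at hi; exact lt_irrefl _ hi
        rw [← hne this]
        exact h1 i hi
      · by_cases hi : i = j
        · subst hi
          refine (h2 j).trans (genUnit_anti hC.isGenerator (hz j) ?_)
          rw [show z' j = z j + h k from Function.update_self ..]
          linarith [hh k]
        · rw [← hne hi]
          exact h2 i
    rw [hset, measureReal_sdiff hsub (hmeas k z'), ih (by omega) hz, ih (by omega) hz', hsum]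
    rfl

lemma multiplyMonotone {C : Copula (p + 2)} (hC : C.IsArchimedeanWith ψ) :
    MultiplyMonotone p ψ where
  continuousOn := hC.isGenerator.continuousOn.mono Set.Ioi_subset_Ici_self
  tendsto := hC.isGenerator.tendsto_atTop
  diffNonneg h hh z hz := by
    -- Only the sum of the corner coordinates counts, so all of `z` may sit in one coordinate.
    have := hC.measureReal_eq_iterDiff hh le_rfl (z := Pi.single 0 z) (fun i => by
      by_cases hi : i = 0
      · subst hi; simpa using hz.le
      · simp [hi])
    rw [Finset.sum_pi_single' 0 z Finset.univ, if_pos (Finset.mem_univ _)] at this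
    rw [← this]
    exact measureReal_nonneg

lemma convexDecay {C : Copula (p + 2)} (hC : C.IsArchimedeanWith ψ) : ConvexDecay ψ :=
  hC.multiplyMonotone.convexDecay

/-! ### Marginals of Archimedean copulas -/

lemma pairMarginal_genUnit {C : Copula d} (hC : C.IsArchimedeanWith ψ) {i j : Fin d} (hij : i ≠ j)
    {a b : ℝ} (ha : 0 ≤ a) (hb : 0 ≤ b) :
    C.pairMarginal i j (genUnit ψ a, genUnit ψ b) = ψ (a + b) := by
  have h1 : genUnit ψ 0 = 1 := by
    ext
    rw [hC.isGenerator.coe_genUnit le_rfl, hC.isGenerator.map_zero]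
    rfl
  have := hC.cdf_genUnit (z := Pi.single i a + Pi.single j b) (fun l => by
    have : ∀ (k : Fin d) (c : ℝ), 0 ≤ c → 0 ≤ (Pi.single k c : Fin d → ℝ) l := fun k c hc => by
      by_cases hl : l = k
      · subst hl; simpa using hc
      · simp [hl]
    exact add_nonneg (this i a ha) (this j b hb))
  simp only [Pi.add_apply, Finset.sum_add_distrib, Finset.sum_pi_single', Finset.mem_univ,
    if_true] at this
  rw [← this, pairMarginal]
  congr 1
  funext l
  by_cases hl : l = j
  · subst hl
    simp [hij.symm]
  · by_cases hl' : l = i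
    · subst hl'
      simp [hl]
    · simp [hl, hl', h1]

lemma firstMarginal_Iic {C : Copula d} (hC : C.IsArchimedeanWith ψ) {m : ℕ} (hm : m ≤ d)
    {x : Fin m → I} (hx : ∀ i, 0 < x i) :
    C.firstMarginal m hm (Set.Iic x) = ENNReal.ofReal (ψ (∑ i, genInv ψ (x i))) := by
  let y : Fin d → I := fun j => if hj : j.1 < m then x ⟨j.1, hj⟩ else 1
  have hy : ∀ j, 0 < y j := fun j => by
    by_cases hj : j.1 < m
    · simpa [y, hj] using hx _
    · simp [y, hj]
  have hsum : ∑ i, genInv ψ (x i) = ∑ j, genInv ψ (y j) := by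
    refine Fintype.sum_of_injective (Fin.castLE hm) (Fin.castLE_injective hm) _ _ (fun j hj => ?_)
      (fun i => ?_)
    · have : ¬ j.1 < m := fun hlt => hj ⟨⟨j.1, hlt⟩, rfl⟩
      simp only [y, this, dite_false]
      exact hC.isGenerator.genInv_one
    · simp [y]
  rw [hsum, ← hC.cdf_eq_of_pos hy, Copula.cdf, ofReal_measureReal, firstMarginal,
    Measure.map_apply (by fun_prop) (measurableSet_Iic_pi x)]
  congr 1
  ext u
  simp only [Set.mem_preimage, Set.mem_Iic, Pi.le_def]
  constructor
  · intro hu j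
    by_cases hj : j.1 < m
    · simpa [y, hj] using hu ⟨j.1, hj⟩
    · simp only [y, hj, dite_false]
      exact (u j).2.2
  · intro hu i
    simpa [y] using hu (Fin.castLE hm i)

lemma splitMeasure_Iic_of_pos {m : ℕ} {C : Copula (m + 1)} (hC : C.IsArchimedeanWith ψ) {x : I}
    (hx : 0 < x) {y : Fin m → I} (hy : ∀ i, 0 < y i) :
    C.splitMeasure (Set.Iic x ×ˢ Set.Iic y) =
      ENNReal.ofReal (ψ (genInv ψ x + ∑ i, genInv ψ (y i))) := by
  rw [C.splitMeasure_Iic, hC.cdf_eq_of_pos (Fin.cases (by simpa using hx) (by simpa using hy)),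
    Fin.sum_univ_succ]
  simp

end Copula.IsArchimedeanWith

namespace IsArchimedeanGenerator

variable {ψ : ℝ → ℝ}

/-! ### Substitution along a generator -/

lemma negLeftDeriv_pos (h : IsArchimedeanGenerator ψ) (hψ : ConvexDecay ψ) {z : ℝ} (hz : 0 < z)
    (hpos : 0 < ψ z) : 0 < negLeftDeriv ψ z := by
  refine lt_of_lt_of_le ?_ (hψ.slope_le_negLeftDeriv hz (lt_add_one z))
  have := h.apply_lt_apply hz.le (lt_add_one z) hpos
  exact div_pos (by linarith) (by linarith)

/-- The only possible exception is the first positive zero. There the left derivative may be nonzero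
although `ψ` vanishes, so it has to be discarded. -/
lemma ae_exists_lt_of_apply_eq_zero (ψ : ℝ → ℝ) :
    ∀ᵐ z : ℝ, 0 < z → ψ z = 0 → ∃ w, 0 < w ∧ w < z ∧ ψ w = 0 := by
  have : {z : ℝ | ¬(0 < z → ψ z = 0 → ∃ w, 0 < w ∧ w < z ∧ ψ w = 0)}.Subsingleton := by
    intro z hz w hw
    simp only [Set.mem_ofPred_eq, not_forall, not_exists, not_and, exists_prop] at hz hw
    by_contra hne
    rcases lt_or_gt_of_ne hne with h | h
    · exact hw.2.2 z hz.1 h hz.2.1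
    · exact hz.2.2 w hw.1 h hw.2.1
  exact this.measure_zero _

lemma lintegral_genUnit_preimage_Iic (h : IsArchimedeanGenerator ψ) {x : I} (hx : 0 < x)
    {g : ℝ → ℝ≥0∞} (hg : ∀ z, z ≤ 0 → g z = 0) :
    ∫⁻ z in genUnit ψ ⁻¹' Set.Iic x, g z = ∫⁻ z in Set.Ioi (genInv ψ x), g z := by
  rw [← lintegral_indicator (h.continuous_genUnit.measurable measurableSet_Iic),
    ← lintegral_indicator measurableSet_Ioi]
  refine lintegral_congr_ae ?_
  filter_upwards [Measure.ae_ne volume (genInv ψ x)] with z hz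
  rcases le_or_gt z 0 with h0 | h0
  · simp [Set.indicator_apply, hg z h0]
  · have : z ∈ genUnit ψ ⁻¹' Set.Iic x ↔ z ∈ Set.Ioi (genInv ψ x) := by
      rw [Set.mem_preimage, Set.mem_Iic, h.genUnit_le_iff hx h0.le]
      exact ⟨fun hle => lt_of_le_of_ne hle (Ne.symm hz), fun hlt => le_of_lt hlt⟩
    by_cases hm : z ∈ Set.Ioi (genInv ψ x)
    · rw [Set.indicator_of_mem hm, Set.indicator_of_mem (this.2 hm)]
    · rw [Set.indicator_of_notMem hm, Set.indicator_of_notMem fun h' => hm (this.1 h')]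

lemma continuousWithinAt_Ioi (h : IsArchimedeanGenerator ψ) {s : ℝ} (hs : 0 ≤ s) :
    ContinuousWithinAt ψ (Set.Ioi s) s :=
  (h.continuousOn s hs).mono fun _ hz => hs.trans (le_of_lt hz)

/-- The law on `(0,∞)` with density `-D⁻ψ` has tail function `ψ`, and a continuous tail function
transforms its own law into the uniform one. -/
lemma map_genUnit_withDensity (h : IsArchimedeanGenerator ψ) (hψ : ConvexDecay ψ) :
    (volume.withDensity fun z => ENNReal.ofReal (negLeftDeriv ψ z)).map (genUnit ψ) = volume := by
  have hT : ∀ z, z ≤ 0 → ENNReal.ofReal (negLeftDeriv ψ z) = 0 := fun z hz => by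
    simp [negLeftDeriv, hz.not_gt]
  have hIic : ∀ x : I, 0 < x → (volume.withDensity fun z => ENNReal.ofReal (negLeftDeriv ψ z)).map
      (genUnit ψ) (Set.Iic x) = volume (Set.Iic x) := fun x hx => by
    rw [Measure.map_apply h.continuous_genUnit.measurable measurableSet_Iic,
      withDensity_apply _ (h.continuous_genUnit.measurable measurableSet_Iic),
      h.lintegral_genUnit_preimage_Iic hx hT,
      hψ.setLIntegral_Ioi_negLeftDeriv (genInv_nonneg _ _)
        (h.continuousWithinAt_Ioi (genInv_nonneg _ _)), h.apply_genInv hx, unitInterval.volume_Iic]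
  have huniv : (Set.univ : Set I) = Set.Iic 1 := (Set.eq_univ_of_forall fun x => x.2.2).symm
  have : IsFiniteMeasure ((volume.withDensity fun z => ENNReal.ofReal (negLeftDeriv ψ z)).map
      (genUnit ψ)) := ⟨by rw [huniv, hIic 1 zero_lt_one]; exact measure_lt_top _ _⟩
  exact Measure.ext_of_Iic_pos_unitInterval hIic

/-- The change of variables `t = ψ(z)`, `dt = -D⁻ψ(z) dz`. Beyond a zero of `ψ` the weight vanishes
and cannot be cancelled, so `H` has to vanish there as well. -/
lemma setLIntegral_comp_genInv (h : IsArchimedeanGenerator ψ) (hψ : ConvexDecay ψ) {x : I}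
    (hx : 0 < x) {H : ℝ → ℝ≥0∞} (hH : Measurable H)
    (hvan : ∀ w z, 0 < w → w < z → ψ w = 0 → H z = 0) :
    ∫⁻ t in Set.Iic x, H (genInv ψ t) * (ENNReal.ofReal (negLeftDeriv ψ (genInv ψ t)))⁻¹ =
      ∫⁻ z in Set.Ioi (genInv ψ x), H z := by
  have hm : Measurable fun t => H (genInv ψ t) * (ENNReal.ofReal (negLeftDeriv ψ (genInv ψ t)))⁻¹ :=
    (hH.comp (measurable_genInv ψ)).mul
      (hψ.measurable_negLeftDeriv.comp (measurable_genInv ψ)).ennreal_ofReal.inv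
  rw [← h.map_genUnit_withDensity hψ]
  rw [setLIntegral_map measurableSet_Iic hm h.continuous_genUnit.measurable]
  refine (setLIntegral_withDensity_eq_setLIntegral_mul _
    hψ.measurable_negLeftDeriv.ennreal_ofReal (hm.comp h.continuous_genUnit.measurable)
    (h.continuous_genUnit.measurable measurableSet_Iic)).trans ?_
  rw [h.lintegral_genUnit_preimage_Iic hx fun z hz => by simp [negLeftDeriv, hz.not_gt]]
  refine setLIntegral_congr_fun_ae measurableSet_Ioi ?_
  filter_upwards [ae_exists_lt_of_apply_eq_zero ψ] with z hz hzx
  have hz0 : 0 < z := (genInv_nonneg ψ x).trans_lt hzx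
  rcases (h.apply_nonneg hz0.le).eq_or_lt with h0 | h0
  · obtain ⟨w, hw0, hwz, hw⟩ := hz hz0 h0.symm
    have hT : negLeftDeriv ψ z = 0 := by
      refine le_antisymm ((hψ.negLeftDeriv_le_slope hw0 hwz).trans ?_) (hψ.negLeftDeriv_nonneg z)
      rw [hw, ← h0]; simp
    simp [hT, hvan w z hw0 hwz hw]
  · have hT := h.negLeftDeriv_pos hψ hz0 h0
    simp only [Pi.mul_apply, Function.comp_apply, h.genInv_genUnit hz0.le h0]
    rw [mul_comm, mul_assoc, ENNReal.inv_mul_cancel (by simpa using hT) ENNReal.ofReal_ne_top,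
      mul_one]

end IsArchimedeanGenerator

lemma ConvexDecay.setLIntegral_Ioi_negLeftDeriv_add {f : ℝ → ℝ} (hf : ConvexDecay f) {a s : ℝ}
    (has : 0 ≤ s + a) (hc : ContinuousWithinAt f (Set.Ioi (s + a)) (s + a)) :
    ∫⁻ z in Set.Ioi a, ENNReal.ofReal (negLeftDeriv f (s + z)) = ENNReal.ofReal (f (s + a)) := by
  rw [← hf.setLIntegral_Ioi_negLeftDeriv has hc]
  have := (measurePreserving_add_left (volume : Measure ℝ) s).setLIntegral_comp_preimage
    (measurableSet_Ioi (a := s + a)) hf.measurable_negLeftDeriv.ennreal_ofReal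
  rw [← this]
  congr 2
  ext z
  simp

/-! ### Explicit formulas for densities and Markov kernels -/

lemma setLIntegral_Iic_succ {m : ℕ} {F : (Fin (m + 1) → I) → ℝ≥0∞} (hF : Measurable F)
    (y : Fin (m + 1) → I) :
    ∫⁻ u in Set.Iic y, F u =
      ∫⁻ t in Set.Iic (y 0), ∫⁻ v in Set.Iic (fun i => y i.succ), F (Fin.cons t v) := by
  have hcons : Measurable fun q : I × (Fin m → I) => (Fin.cons q.1 q.2 : Fin (m + 1) → I) := by
    refine measurable_pi_iff.2 (Fin.cases ?_ fun i => ?_)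
    · simpa using measurable_fst
    · simpa [Function.comp_def] using (measurable_pi_apply i).comp measurable_snd
  have hmp : MeasurePreserving (fun q : I × (Fin m → I) => (Fin.cons q.1 q.2 : Fin (m + 1) → I)) := by
    have := (volume_preserving_piFinSuccAbove (fun _ : Fin (m + 1) => I) 0).symm
    convert this using 1
    funext q
    simp [MeasurableEquiv.piFinSuccAbove, Fin.insertNthEquiv, Fin.insertNth_zero']
  have hpre : (fun q : I × (Fin m → I) => (Fin.cons q.1 q.2 : Fin (m + 1) → I)) ⁻¹' Set.Iic y =
      Set.Iic (y 0) ×ˢ Set.Iic (fun i => y i.succ) := by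
    ext q
    simp only [Set.mem_preimage, Set.mem_Iic, Set.mem_prod, Pi.le_def, Fin.forall_fin_succ,
      Fin.cons_zero, Fin.cons_succ]
  rw [← hmp.setLIntegral_comp_preimage (measurableSet_Iic_pi y) hF, hpre]
  rw [Measure.volume_eq_prod, ← Measure.prod_restrict]
  exact lintegral_prod _ (hF.comp hcons).aemeasurable

/-- The Lebesgue density of the distribution of the first `m` coordinates of an Archimedean copula,
with a shift `s` in the argument and a general function `f` in place of the generator. -/
noncomputable def archDensity (ψ f : ℝ → ℝ) (s : ℝ) (m : ℕ) (u : Fin m → I) : ℝ≥0∞ :=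
  ENNReal.ofReal (negLeftDeriv^[m] f (s + ∑ i, genInv ψ (u i))) *
    ∏ i, (ENNReal.ofReal (negLeftDeriv ψ (genInv ψ (u i))))⁻¹

lemma measurable_archDensity {ψ f : ℝ → ℝ} (hψ : ConvexDecay ψ) {m : ℕ}
    (hf : ConvexDecay (negLeftDeriv^[m] f)) (s : ℝ) : Measurable (archDensity ψ f s (m + 1)) := by
  have hm : Measurable (negLeftDeriv^[m + 1] f) := by
    rw [Function.iterate_succ_apply']
    exact hf.measurable_negLeftDeriv
  have hg := measurable_genInv ψ
  have h1 := hψ.measurable_negLeftDeriv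
  unfold archDensity
  fun_prop

namespace IsArchimedeanGenerator

variable {ψ : ℝ → ℝ}

/-- Each coordinate integral undoes one derivative through `setLIntegral_comp_genInv`. The general
`f` and `s` drive the induction: with the first coordinate fixed at `t`, the remaining ones see
`negLeftDeriv f` and the shift `s + genInv ψ t`. -/
lemma setLIntegral_archDensity (h : IsArchimedeanGenerator ψ) (hψ : ConvexDecay ψ) {m : ℕ}
    {f : ℝ → ℝ} (hf : ∀ k < m, ConvexDecay (negLeftDeriv^[k] f))
    (hvan : ∀ w z, 0 < w → w < z → ψ w = 0 → f z = 0) {s : ℝ} (hs : 0 ≤ s)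
    (hc : ∀ w, s ≤ w → ContinuousWithinAt f (Set.Ioi w) w) {y : Fin m → I} (hy : ∀ i, 0 < y i) :
    ∫⁻ u in Set.Iic y, archDensity ψ f s m u =
      ENNReal.ofReal (f (s + ∑ i, genInv ψ (y i))) := by
  induction m generalizing f s with
  | zero =>
    have : (Set.Iic y) = Set.univ := Set.eq_univ_of_forall fun u i => i.elim0
    rw [this]
    simp [archDensity, lintegral_unique]
  | succ m ih =>
    have hf0 : ConvexDecay f := hf 0 (Nat.succ_pos m)
    have hvan' : ∀ w z, 0 < w → w < z → ψ w = 0 → negLeftDeriv f z = 0 := by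
      intro w z hw hwz hw0
      obtain ⟨v, hwv, hvz⟩ := exists_between hwz
      refine le_antisymm ((hf0.negLeftDeriv_le_slope (hw.trans hwv) hvz).trans ?_)
        (hf0.negLeftDeriv_nonneg z)
      rw [hvan w v hw hwv hw0, hvan w z hw hwz hw0]
      simp
    have hf' : ∀ k < m, ConvexDecay (negLeftDeriv^[k] (negLeftDeriv f)) := fun k hk => by
      rw [← Function.iterate_succ_apply]
      exact hf (k + 1) (by omega)
    set r := ∑ i : Fin m, genInv ψ (y i.succ) with hr
    have hr0 : 0 ≤ r := Finset.sum_nonneg fun i _ => genInv_nonneg _ _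
    have hinner : ∀ t : I, 0 < t → t ≠ 1 →
        ∫⁻ v in Set.Iic (fun i => y i.succ), archDensity ψ f s (m + 1) (Fin.cons t v) =
          ENNReal.ofReal (negLeftDeriv f ((s + r) + genInv ψ t)) *
            (ENNReal.ofReal (negLeftDeriv ψ (genInv ψ t)))⁻¹ := by
      -- At `t = 1` one has `genInv ψ t = 0`, where left derivatives carry the default value `0`;
      -- this null set is skipped.
      intro t ht ht1
      have ht0 : 0 < genInv ψ t := h.genInv_pos ht (lt_of_le_of_ne t.2.2 ht1)
      have e : ∀ v : Fin m → I, archDensity ψ f s (m + 1) (Fin.cons t v) =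
          archDensity ψ (negLeftDeriv f) (s + genInv ψ t) m v *
            (ENNReal.ofReal (negLeftDeriv ψ (genInv ψ t)))⁻¹ := by
        intro v
        simp only [archDensity, Function.iterate_succ_apply, Fin.sum_univ_succ, Fin.prod_univ_succ,
          Fin.cons_zero, Fin.cons_succ, ← add_assoc]
        ring
      simp_rw [e]
      have hb : (ENNReal.ofReal (negLeftDeriv ψ (genInv ψ t)))⁻¹ ≠ ∞ := by
        have := h.negLeftDeriv_pos hψ ht0 (by rw [h.apply_genInv ht]; exact ht)
        simpa using this
      rw [lintegral_mul_const' _ _ hb]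
      congr 1
      -- With no coordinate left, `negLeftDeriv f` need not be continuous, so the induction
      -- hypothesis does not apply and the integral is evaluated directly.
      cases m with
      | zero =>
        have : (Set.Iic fun i : Fin 0 => y i.succ) = Set.univ :=
          Set.eq_univ_of_forall fun u i => i.elim0
        rw [this]
        simp [archDensity, lintegral_unique, hr]
      | succ m =>
        have hcd' : ConvexDecay (negLeftDeriv f) := hf' 0 (Nat.succ_pos m)
        have := ih hf' hvan' (s := s + genInv ψ t) (by linarith)
          (fun w hw => hcd'.continuousWithinAt_of_pos (by linarith)) (fun i => hy i.succ)
        rw [this]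
        congr 2
        ring
    have hm : Measurable (archDensity ψ f s (m + 1)) :=
      measurable_archDensity hψ (hf m (Nat.lt_succ_self m)) s
    rw [setLIntegral_Iic_succ hm y]
    have hae : ∀ᵐ t : I, t ∈ Set.Iic (y 0) →
        ∫⁻ v in Set.Iic (fun i => y i.succ), archDensity ψ f s (m + 1) (Fin.cons t v) =
          ENNReal.ofReal (negLeftDeriv f ((s + r) + genInv ψ t)) *
            (ENNReal.ofReal (negLeftDeriv ψ (genInv ψ t)))⁻¹ := by
      filter_upwards [Measure.ae_ne volume (0 : I), Measure.ae_ne volume (1 : I)] with t h0 h1 _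
      exact hinner t (lt_of_le_of_ne t.2.1 (Ne.symm h0)) h1
    rw [setLIntegral_congr_fun_ae measurableSet_Iic hae]
    rw [h.setLIntegral_comp_genInv hψ (hy 0)
      (H := fun z => ENNReal.ofReal (negLeftDeriv f ((s + r) + z)))
      ((hf0.measurable_negLeftDeriv.comp (by fun_prop)).ennreal_ofReal)
      (fun w z hw hwz hw0 => by
        rw [hvan' w _ hw (by linarith) hw0, ENNReal.ofReal_zero])]
    have hg := genInv_nonneg ψ (y 0)
    rw [hf0.setLIntegral_Ioi_negLeftDeriv_add (by linarith) (hc _ (by linarith)),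
      Fin.sum_univ_succ]
    congr 2
    ring

end IsArchimedeanGenerator

namespace Copula.IsArchimedeanWith

variable {p : ℕ} {ψ : ℝ → ℝ} {C : Copula (p + 2)}

lemma convexDecay_iterate (hC : C.IsArchimedeanWith ψ) {k : ℕ} (hk : k ≤ p) :
    ConvexDecay (negLeftDeriv^[k] ψ) :=
  (hC.multiplyMonotone.iterate_negLeftDeriv hk).convexDecay

lemma apply_eq_zero_of_lt (hC : C.IsArchimedeanWith ψ) {w z : ℝ} (hw : 0 < w) (hwz : w < z)
    (h0 : ψ w = 0) : ψ z = 0 := by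
  have h := hC.isGenerator
  refine le_antisymm ?_ (h.apply_nonneg (hw.trans hwz).le)
  rw [← h0]
  exact h.antitoneOn hw.le (hw.trans hwz).le hwz.le

lemma firstMarginal_eq_withDensity (hC : C.IsArchimedeanWith ψ) {m : ℕ} (hm : m ≤ p + 1)
    (hmd : m ≤ p + 2) :
    C.firstMarginal m hmd = volume.withDensity (archDensity ψ ψ 0 m) := by
  have h := hC.isGenerator
  have key : ∀ x : Fin m → I, (∀ i, 0 < x i) →
      C.firstMarginal m hmd (Set.Iic x) = volume.withDensity (archDensity ψ ψ 0 m) (Set.Iic x) := by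
    intro x hx
    rw [hC.firstMarginal_Iic hmd hx, withDensity_apply _ (measurableSet_Iic_pi x),
      h.setLIntegral_archDensity hC.convexDecay (fun k hk => hC.convexDecay_iterate (by omega))
        (fun w z hw hwz h0 => hC.apply_eq_zero_of_lt hw hwz h0) le_rfl
        (fun w hw => h.continuousWithinAt_Ioi hw) hx, zero_add]
  have huniv : (Set.univ : Set (Fin m → I)) = Set.Iic fun _ => 1 :=
    (Set.eq_univ_of_forall fun u i => (u i).2.2).symm
  have h1 : IsFiniteMeasure (C.firstMarginal m hmd) := by
    unfold firstMarginal; infer_instance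
  have h2 : IsFiniteMeasure (volume.withDensity (archDensity ψ ψ 0 m)) :=
    ⟨by rw [huniv, ← key _ fun _ => zero_lt_one]; exact measure_lt_top _ _⟩
  exact Measure.ext_of_Iic_pos key

lemma firstMarginalDensity_ae_eq (hC : C.IsArchimedeanWith ψ) {m : ℕ} (hm : m + 1 ≤ p + 1)
    (hmd : m + 1 ≤ p + 2) :
    C.firstMarginalDensity (m + 1) hmd =ᵐ[volume] archDensity ψ ψ 0 (m + 1) := by
  rw [firstMarginalDensity, hC.firstMarginal_eq_withDensity hm hmd]
  exact Measure.rnDeriv_withDensity _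
    (measurable_archDensity hC.convexDecay (hC.convexDecay_iterate (by omega)) 0)

/-- Both sides, integrated over `[0,x]`, give the value of the copula at `(x, y)` for every `x > 0`.
The null set depends on `y`. -/
lemma kernel_Iic_ae_eq {y : Fin (p + 1) → I} (hC : C.IsArchimedeanWith ψ) (hy : ∀ i, 0 < y i) :
    ∀ᵐ x : I, C.kernel x (Set.Iic y) =
      ENNReal.ofReal (negLeftDeriv ψ ((∑ i, genInv ψ (y i)) + genInv ψ x)) *
        (ENNReal.ofReal (negLeftDeriv ψ (genInv ψ x)))⁻¹ := by
  have h := hC.isGenerator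
  have hψ := hC.convexDecay
  set s := ∑ i, genInv ψ (y i) with hs
  have hs0 : 0 ≤ s := Finset.sum_nonneg fun i _ => genInv_nonneg _ _
  have hm : Measurable fun x : I => ENNReal.ofReal (negLeftDeriv ψ (s + genInv ψ x)) *
      (ENNReal.ofReal (negLeftDeriv ψ (genInv ψ x)))⁻¹ := by
    have hg := measurable_genInv ψ
    have h1 := hψ.measurable_negLeftDeriv
    fun_prop
  have hmK : Measurable fun x : I => C.kernel x (Set.Iic y) :=
    C.kernel.measurable_coe (measurableSet_Iic_pi y)
  have hfin : ∫⁻ x, C.kernel x (Set.Iic y) ≠ ∞ := by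
    rw [← setLIntegral_univ, C.setLIntegral_kernel .univ (measurableSet_Iic_pi y)]
    exact measure_ne_top _ _
  have key : ∀ x : I, 0 < x → volume.withDensity (fun x => C.kernel x (Set.Iic y)) (Set.Iic x) =
      volume.withDensity (fun x => ENNReal.ofReal (negLeftDeriv ψ (s + genInv ψ x)) *
        (ENNReal.ofReal (negLeftDeriv ψ (genInv ψ x)))⁻¹) (Set.Iic x) := by
    intro x hx
    have hg := genInv_nonneg ψ x
    rw [withDensity_apply _ measurableSet_Iic, withDensity_apply _ measurableSet_Iic,
      C.setLIntegral_kernel measurableSet_Iic (measurableSet_Iic_pi y),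
      hC.splitMeasure_Iic_of_pos hx hy,
      h.setLIntegral_comp_genInv hψ hx (H := fun z => ENNReal.ofReal (negLeftDeriv ψ (s + z)))
        (hψ.measurable_negLeftDeriv.comp (by fun_prop)).ennreal_ofReal ?_,
      hψ.setLIntegral_Ioi_negLeftDeriv_add (by linarith) (h.continuousWithinAt_Ioi (by linarith)),
      add_comm]
    intro w z hw hwz hw0
    obtain ⟨v, hwv, hvz⟩ := exists_between hwz
    have : negLeftDeriv ψ (s + z) = 0 := by
      refine le_antisymm ((hψ.negLeftDeriv_le_slope (x := v) (hw.trans hwv) (by linarith)).trans ?_)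
        (hψ.negLeftDeriv_nonneg _)
      rw [hC.apply_eq_zero_of_lt hw hwv hw0, hC.apply_eq_zero_of_lt hw (by linarith) hw0]
      simp
    rw [this, ENNReal.ofReal_zero]
  have huniv : (Set.univ : Set I) = Set.Iic 1 := (Set.eq_univ_of_forall fun x => x.2.2).symm
  have h1 : IsFiniteMeasure (volume.withDensity (fun x => C.kernel x (Set.Iic y))) :=
    isFiniteMeasure_withDensity hfin
  have h2 : IsFiniteMeasure (volume.withDensity (fun x : I =>
      ENNReal.ofReal (negLeftDeriv ψ (s + genInv ψ x)) *
        (ENNReal.ofReal (negLeftDeriv ψ (genInv ψ x)))⁻¹)) :=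
    ⟨by rw [huniv, ← key 1 zero_lt_one]; exact measure_lt_top _ _⟩
  exact (withDensity_eq_iff hmK.aemeasurable hm.aemeasurable hfin).1
    (Measure.ext_of_Iic_pos_unitInterval key)

end Copula.IsArchimedeanWith

/-! ### Convergence of generators and of the associated objects -/

namespace Copula

variable {d p : ℕ}

lemma cdf_mono (C : Copula d) : Monotone C.cdf := fun _ _ hxy =>
  measureReal_mono (Set.Iic_subset_Iic.2 hxy)

lemma pairMarginal_mono (C : Copula d) (i j : Fin d) {s s' t t' : I} (hs : s ≤ s') (ht : t ≤ t') :
    C.pairMarginal i j (s, t) ≤ C.pairMarginal i j (s', t') :=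
  C.cdf_mono (update_le_update_iff.2 ⟨ht, fun k _ =>
    (update_le_update_iff.2 ⟨hs, fun _ _ => le_rfl⟩ :
      Function.update (fun _ : Fin d => (1 : I)) i s ≤ Function.update (fun _ => 1) i s') k⟩)

lemma tendsto_pairMarginal {Cs : ℕ → Copula d} {C : Copula d} {i j : Fin d} {s t : I}
    (h : Tendsto (fun n => (Cs n).pairMarginal i j (s, t)) atTop (𝓝 (C.pairMarginal i j (s, t))))
    {ss ts : ℕ → I} (hs : Tendsto ss atTop (𝓝 s)) (ht : Tendsto ts atTop (𝓝 t)) :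
    Tendsto (fun n => (Cs n).pairMarginal i j (ss n, ts n)) atTop
      (𝓝 (C.pairMarginal i j (s, t))) :=
  tendsto_cdf h ((tendsto_const_nhds.update i hs).update j ht)

namespace IsArchimedeanWith

variable {ψ : ℝ → ℝ} {ψs : ℕ → ℝ → ℝ}

lemma tendsto_genUnit (h : IsArchimedeanGenerator ψ) (hs : ∀ n, IsArchimedeanGenerator (ψs n))
    {a : ℝ} (ha : 0 ≤ a) (hlim : Tendsto (fun n => ψs n a) atTop (𝓝 (ψ a))) :
    Tendsto (fun n => genUnit (ψs n) a) atTop (𝓝 (genUnit ψ a)) := by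
  rw [tendsto_subtype_rng, h.coe_genUnit ha]
  simpa only [(hs _).coe_genUnit ha] using hlim

variable {C : Copula d} {Cs : ℕ → Copula d} {i j : Fin d}

lemma tendsto_generator_add (hC : C.IsArchimedeanWith ψ) (hCs : ∀ n, (Cs n).IsArchimedeanWith (ψs n))
    (hij : i ≠ j) (h : ∀ q, Tendsto (fun n => (Cs n).pairMarginal i j q) atTop
      (𝓝 (C.pairMarginal i j q))) {a b : ℝ} (ha : 0 ≤ a) (hb : 0 ≤ b)
    (hla : Tendsto (fun n => ψs n a) atTop (𝓝 (ψ a)))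
    (hlb : Tendsto (fun n => ψs n b) atTop (𝓝 (ψ b))) :
    Tendsto (fun n => ψs n (a + b)) atTop (𝓝 (ψ (a + b))) := by
  have hG := hC.isGenerator
  have hGs := fun n => (hCs n).isGenerator
  have := tendsto_pairMarginal (h (genUnit ψ a, genUnit ψ b)) (tendsto_genUnit hG hGs ha hla)
    (tendsto_genUnit hG hGs hb hlb)
  rw [hC.pairMarginal_genUnit hij ha hb] at this
  exact this.congr fun n => (hCs n).pairMarginal_genUnit hij ha hb

/-- If `ψ_n(a)` stayed below `ψ(b)` for some `b > a`, monotonicity of the diagonal would keep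
`ψ_n(2a)` below a quantity tending to `ψ(2b)`, which is less than `ψ(2a)` as `ψ(2a) > 0`. The other
side is symmetric. -/
lemma tendsto_generator_half (hC : C.IsArchimedeanWith ψ)
    (hCs : ∀ n, (Cs n).IsArchimedeanWith (ψs n))
    (hij : i ≠ j) (h : ∀ q, Tendsto (fun n => (Cs n).pairMarginal i j q) atTop
      (𝓝 (C.pairMarginal i j q))) {a : ℝ} (ha : 0 < a) (hpos : 0 < ψ (a + a))
    (hla : Tendsto (fun n => ψs n (a + a)) atTop (𝓝 (ψ (a + a)))) :
    Tendsto (fun n => ψs n a) atTop (𝓝 (ψ a)) := by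
  have hG := hC.isGenerator
  have hGs := fun n => (hCs n).isGenerator
  have hcont : ContinuousAt ψ a := hG.continuousOn.continuousAt (Ici_mem_nhds ha)
  have hlim : ∀ b, 0 ≤ b → Tendsto
      (fun n => (Cs n).pairMarginal i j (genUnit ψ b, genUnit ψ b)) atTop (𝓝 (ψ (b + b))) :=
    fun b hb => by
      rw [← hC.pairMarginal_genUnit hij hb hb]
      exact h _
  refine tendsto_order.2 ⟨fun c hc => ?_, fun c hc => ?_⟩
  · have h1 : ∀ᶠ b in 𝓝[>] a, c < ψ b :=
      (hcont.eventually (lt_mem_nhds hc)).filter_mono nhdsWithin_le_nhds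
    obtain ⟨b, hcb, hab : a < b⟩ := (h1.and self_mem_nhdsWithin).exists
    have hb : 0 ≤ b := (ha.trans hab).le
    have hlt : ψ (b + b) < ψ (a + a) := hG.apply_lt_apply (by linarith) (by linarith) hpos
    obtain ⟨r, hr1, hr2⟩ := exists_between hlt
    filter_upwards [(hlim b hb).eventually (gt_mem_nhds hr1), hla.eventually (lt_mem_nhds hr2)]
      with n hn1 hn2
    by_contra! hle
    have hle' : genUnit (ψs n) a ≤ genUnit ψ b := by
      rw [← Subtype.coe_le_coe, (hGs n).coe_genUnit ha.le, hG.coe_genUnit hb]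
      exact hle.trans hcb.le
    have := (Cs n).pairMarginal_mono i j hle' hle'
    rw [(hCs n).pairMarginal_genUnit hij ha.le ha.le] at this
    linarith
  · have h1 : ∀ᶠ b in 𝓝[<] a, ψ b < c :=
      (hcont.eventually (gt_mem_nhds hc)).filter_mono nhdsWithin_le_nhds
    obtain ⟨b, hcb, hb0 : 0 < b, hab : b < a⟩ := (h1.and (Ioo_mem_nhdsLT ha)).exists
    have hlt : ψ (a + a) < ψ (b + b) := hG.apply_lt_apply (by linarith) (by linarith)
      (hpos.trans_le (hG.antitoneOn (by simp only [Set.mem_Ici]; linarith)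
        (by simp only [Set.mem_Ici]; linarith) (by linarith)))
    obtain ⟨r, hr1, hr2⟩ := exists_between hlt
    filter_upwards [(hlim b hb0.le).eventually (lt_mem_nhds hr2), hla.eventually (gt_mem_nhds hr1)]
      with n hn1 hn2
    by_contra! hle
    have hle' : genUnit ψ b ≤ genUnit (ψs n) a := by
      rw [← Subtype.coe_le_coe, (hGs n).coe_genUnit ha.le, hG.coe_genUnit hb0.le]
      exact hcb.le.trans hle
    have := (Cs n).pairMarginal_mono i j hle' hle'
    rw [(hCs n).pairMarginal_genUnit hij ha.le ha.le] at this
    linarith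

/-- The common value `1/2` at `1` anchors the argument: halving reaches `2⁻ᵏ`, where `ψ ≥ 1/2` keeps
the positivity hypothesis alive, adding reaches all nonnegative dyadics, and monotonicity with
continuity of `ψ` does the rest. -/
lemma tendsto_generator_of_pairMarginal (hC : C.IsArchimedeanWith ψ)
    (hCs : ∀ n, (Cs n).IsArchimedeanWith (ψs n))
    (hij : i ≠ j) (h : ∀ q, Tendsto (fun n => (Cs n).pairMarginal i j q) atTop
      (𝓝 (C.pairMarginal i j q))) {z : ℝ} (hz : 0 ≤ z) :
    Tendsto (fun n => ψs n z) atTop (𝓝 (ψ z)) := by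
  have hG := hC.isGenerator
  have hGs := fun n => (hCs n).isGenerator
  have hpow : ∀ k : ℕ, Tendsto (fun n => ψs n ((1 / 2) ^ k)) atTop (𝓝 (ψ ((1 / 2) ^ k))) := by
    intro k
    induction k with
    | zero =>
      simp only [pow_zero, hC.normalized, (hCs _).normalized]
      exact tendsto_const_nhds
    | succ k ih =>
      have e : ((1:ℝ) / 2) ^ (k + 1) + (1 / 2) ^ (k + 1) = (1 / 2) ^ k := by ring
      refine tendsto_generator_half hC hCs hij h (by positivity) ?_ (by rwa [e])
      rw [e]
      have h1 : ψ 1 ≤ ψ ((1 / 2) ^ k) := hG.antitoneOn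
        (by simp only [Set.mem_Ici]; positivity) (by simp)
        (pow_le_one₀ (by norm_num) (by norm_num))
      rw [hC.normalized] at h1
      linarith
  have hdy : ∀ k l : ℕ, Tendsto (fun n => ψs n (l * (1 / 2) ^ k)) atTop
      (𝓝 (ψ (l * (1 / 2) ^ k))) := by
    intro k l
    induction l with
    | zero =>
      simp only [Nat.cast_zero, zero_mul, hG.map_zero, (hGs _).map_zero]
      exact tendsto_const_nhds
    | succ l ih =>
      have := tendsto_generator_add hC hCs hij h (by positivity) (by positivity) ih (hpow k)
      simpa only [Nat.cast_succ, add_mul, one_mul] using this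
  have hp : Tendsto (fun k : ℕ => ((1:ℝ) / 2) ^ k) atTop (𝓝 0) :=
    tendsto_pow_atTop_nhds_zero_of_lt_one (by norm_num) (by norm_num)
  have hfl : ∀ k : ℕ, (⌊z / (1 / 2) ^ k⌋₊ : ℝ) * (1 / 2) ^ k ≤ z ∧
      z ≤ (⌊z / (1 / 2) ^ k⌋₊ : ℝ) * (1 / 2) ^ k + (1 / 2) ^ k := by
    intro k
    have hk : (0:ℝ) < (1 / 2) ^ k := by positivity
    constructor
    · rw [← le_div_iff₀ hk]
      exact Nat.floor_le (by positivity)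
    · have := (Nat.lt_floor_add_one (z / (1 / 2) ^ k)).le
      rw [div_le_iff₀ hk] at this
      linarith
  have hlow : Tendsto (fun k : ℕ => (⌊z / (1 / 2) ^ k⌋₊ : ℝ) * (1 / 2) ^ k) atTop (𝓝 z) := by
    have h1 : Tendsto (fun k : ℕ => z - (1 / 2) ^ k) atTop (𝓝 z) := by
      have := hp.const_sub z
      rwa [sub_zero] at this
    refine tendsto_of_tendsto_of_tendsto_of_le_of_le h1
      tendsto_const_nhds (fun k => ?_) (fun k => (hfl k).1)
    have := (hfl k).2
    simp only
    linarith
  have hup : Tendsto (fun k : ℕ => ((⌊z / (1 / 2) ^ k⌋₊ + 1 : ℕ) : ℝ) * (1 / 2) ^ k) atTop (𝓝 z) := by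
    have := hlow.add hp
    rw [add_zero] at this
    refine this.congr fun k => ?_
    push_cast
    ring
  have hcomp : ∀ {u : ℕ → ℝ}, (∀ k, 0 ≤ u k) → Tendsto u atTop (𝓝 z) →
      Tendsto (fun k => ψ (u k)) atTop (𝓝 (ψ z)) := fun hu hlim =>
    (hG.continuousOn z hz).tendsto.comp (tendsto_nhdsWithin_iff.2 ⟨hlim, Eventually.of_forall hu⟩)
  refine tendsto_order.2 ⟨fun c hc => ?_, fun c hc => ?_⟩
  · obtain ⟨k, hk⟩ := ((hcomp (fun k => by positivity) hup).eventually (lt_mem_nhds hc)).exists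
    filter_upwards [(hdy k _).eventually (lt_mem_nhds hk)] with n hn
    refine hn.trans_le ((hGs n).antitoneOn hz (by simp only [Set.mem_Ici]; positivity) ?_)
    push_cast
    linarith [(hfl k).2]
  · obtain ⟨k, hk⟩ := ((hcomp (fun k => by positivity) hlow).eventually (gt_mem_nhds hc)).exists
    filter_upwards [(hdy k _).eventually (gt_mem_nhds hk)] with n hn
    exact ((hGs n).antitoneOn (by simp only [Set.mem_Ici]; positivity) hz (hfl k).1).trans_lt hn

/-- The arguments `∑ φ_n(x i)` move with `n`, hence the use of uniform convergence. If a coordinate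
is `0`, every copula vanishes. -/
lemma tendsto_cdf_of_generator (hC : C.IsArchimedeanWith ψ)
    (hCs : ∀ n, (Cs n).IsArchimedeanWith (ψs n))
    (h : ∀ z, 0 ≤ z → Tendsto (fun n => ψs n z) atTop (𝓝 (ψ z))) (x : Fin d → I) :
    Tendsto (fun n => (Cs n).cdf x) atTop (𝓝 (C.cdf x)) := by
  have hG := hC.isGenerator
  have hGs := fun n => (hCs n).isGenerator
  by_cases hx : ∀ i, 0 < x i
  · rw [hC.cdf_eq_of_pos hx]
    simp_rw [fun n => (hCs n).cdf_eq_of_pos hx]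
    have h1 : Tendsto (fun n => ∑ i, genInv (ψs n) (x i)) atTop (𝓝 (∑ i, genInv ψ (x i))) :=
      tendsto_finsetSum _ fun i _ => tendsto_genInv hG (hx i)
        (tendsto_pseudoInv_of_tendsto hG hGs h (hx i))
    have h0 : ∀ (φ : ℝ → ℝ), 0 ≤ ∑ i, genInv φ (x i) := fun φ =>
      Finset.sum_nonneg fun i _ => genInv_nonneg _ _
    refine (tendstoUniformlyOn_of_tendsto hG hGs h).tendstoLocallyUniformlyOn.tendsto_comp
      (hG.continuousOn _ (h0 ψ)) (h0 ψ) ?_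
    exact tendsto_nhdsWithin_iff.2 ⟨h1, Eventually.of_forall fun n => h0 _⟩
  · obtain ⟨i, hi⟩ := not_forall.1 hx
    have hxi : (x i : ℝ) = 0 := le_antisymm (not_lt.1 hi) (x i).2.1
    have e : ∀ A : Copula d, A.cdf x = 0 := fun A =>
      le_antisymm ((A.cdf_le_apply x i).trans_eq hxi) (A.cdf_nonneg x)
    simp only [e]
    exact tendsto_const_nhds

end IsArchimedeanWith

end Copula

namespace Copula.IsArchimedeanWith

variable {p : ℕ} {ψ : ℝ → ℝ} {ψs : ℕ → ℝ → ℝ} {C : Copula (p + 2)} {Cs : ℕ → Copula (p + 2)}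

/-! ### Derivatives of generators -/

lemma continuousAt_iterate (hC : C.IsArchimedeanWith ψ) {k : ℕ} (hk : k ≤ p) {z : ℝ} (hz : 0 < z) :
    ContinuousAt (negLeftDeriv^[k] ψ) z :=
  (hC.convexDecay_iterate hk).continuousOn.continuousAt (Ioi_mem_nhds hz)

lemma tendsto_iterate_negLeftDeriv (hC : C.IsArchimedeanWith ψ)
    (hCs : ∀ n, (Cs n).IsArchimedeanWith (ψs n))
    (h : ∀ z, 0 ≤ z → Tendsto (fun n => ψs n z) atTop (𝓝 (ψ z))) {k : ℕ} (hk : k ≤ p) {z : ℝ}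
    (hz : 0 < z) :
    Tendsto (fun n => negLeftDeriv^[k] (ψs n) z) atTop (𝓝 (negLeftDeriv^[k] ψ z)) := by
  induction k generalizing z with
  | zero => exact h z hz.le
  | succ k ih =>
    have hc := hC.continuousAt_iterate hk hz
    simp only [Function.iterate_succ_apply'] at hc ⊢
    exact tendsto_negLeftDeriv_of_tendsto (fun n => (hCs n).convexDecay_iterate (by omega))
      (hC.convexDecay_iterate (by omega)) (fun w hw => ih (by omega) hw) hz tendsto_const_nhds
      (by simpa only [Function.iterate_succ_apply'] using hc)

lemma tendsto_iterate_succ_negLeftDeriv (hC : C.IsArchimedeanWith ψ)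
    (hCs : ∀ n, (Cs n).IsArchimedeanWith (ψs n))
    (h : ∀ z, 0 ≤ z → Tendsto (fun n => ψs n z) atTop (𝓝 (ψ z))) {k : ℕ} (hk : k ≤ p) {z : ℝ}
    (hz : 0 < z) {w : ℕ → ℝ} (hw : Tendsto w atTop (𝓝 z))
    (hc : ContinuousAt (negLeftDeriv^[k + 1] ψ) z) :
    Tendsto (fun n => negLeftDeriv^[k + 1] (ψs n) (w n)) atTop
      (𝓝 (negLeftDeriv^[k + 1] ψ z)) := by
  rw [Function.iterate_succ'] at hc
  simp only [Function.iterate_succ_apply']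
  exact tendsto_negLeftDeriv_of_tendsto (fun n => (hCs n).convexDecay_iterate hk)
    (hC.convexDecay_iterate hk)
    (fun v hv => hC.tendsto_iterate_negLeftDeriv hCs h hk hv) hz hw hc

lemma continuousAt_leftDeriv_iteratedDeriv_iff (hC : C.IsArchimedeanWith ψ) {k : ℕ} (hk : k ≤ p)
    {z : ℝ} (hz : 0 < z) :
    ContinuousAt (leftDeriv (iteratedDeriv k ψ)) z ↔
      ContinuousAt (negLeftDeriv^[k + 1] ψ) z := by
  have e : leftDeriv (iteratedDeriv k ψ) =ᶠ[𝓝 z]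
      fun w => (-1) ^ (k + 1) * negLeftDeriv^[k + 1] ψ w := by
    filter_upwards [Ioi_mem_nhds hz] with w hw
    exact hC.multiplyMonotone.leftDeriv_iteratedDeriv hk hw
  rw [continuousAt_congr e]
  refine ⟨fun h => ?_, fun h => h.const_mul _⟩
  have := h.const_mul ((-1 : ℝ) ^ (k + 1))
  refine this.congr (Eventually.of_forall fun w => ?_)
  simp [← mul_assoc, ← mul_pow]

lemma tendsto_derivatives (hC : C.IsArchimedeanWith ψ) (hCs : ∀ n, (Cs n).IsArchimedeanWith (ψs n))
    (h : ∀ z, 0 ≤ z → Tendsto (fun n => ψs n z) atTop (𝓝 (ψ z))) :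
    (∀ m : ℕ, 1 ≤ m → m ≤ p → ∀ z : ℝ, 0 < z →
        Tendsto (fun n => iteratedDeriv m (ψs n) z) atTop (𝓝 (iteratedDeriv m ψ z))) ∧
      (∀ z : ℝ, 0 < z → ContinuousAt (leftDeriv (iteratedDeriv p ψ)) z →
        Tendsto (fun n => leftDeriv (iteratedDeriv p (ψs n)) z) atTop
          (𝓝 (leftDeriv (iteratedDeriv p ψ) z))) := by
  refine ⟨fun m _ hm z hz => ?_, fun z hz hc => ?_⟩
  · rw [hC.multiplyMonotone.iteratedDeriv_eq hm hz]
    simp_rw [fun n => (hCs n).multiplyMonotone.iteratedDeriv_eq hm hz]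
    exact (hC.tendsto_iterate_negLeftDeriv hCs h hm hz).const_mul _
  · rw [hC.continuousAt_leftDeriv_iteratedDeriv_iff le_rfl hz] at hc
    rw [hC.multiplyMonotone.leftDeriv_iteratedDeriv le_rfl hz]
    simp_rw [fun n => (hCs n).multiplyMonotone.leftDeriv_iteratedDeriv le_rfl hz]
    exact (hC.tendsto_iterate_succ_negLeftDeriv hCs h le_rfl hz tendsto_const_nhds hc).const_mul _

lemma tendsto_generator_of_negLeftDeriv (hC : C.IsArchimedeanWith ψ)
    (hCs : ∀ n, (Cs n).IsArchimedeanWith (ψs n))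
    (h : ∀ z, 0 < z → ContinuousAt (negLeftDeriv ψ) z →
      Tendsto (fun n => negLeftDeriv (ψs n) z) atTop (𝓝 (negLeftDeriv ψ z))) {z : ℝ} (hz : 0 ≤ z) :
    Tendsto (fun n => ψs n z) atTop (𝓝 (ψ z)) := by
  have hG := hC.isGenerator
  have hGs := fun n => (hCs n).isGenerator
  have hint : ∀ a b : ℝ, 0 < a → a ≤ b →
      Tendsto (fun n => ψs n a - ψs n b) atTop (𝓝 (ψ a - ψ b)) := by
    intro a b ha hab
    rw [← hC.convexDecay.integral_negLeftDeriv ha hab]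
    simp_rw [← fun n => (hCs n).convexDecay.integral_negLeftDeriv ha hab]
    -- For `w > a` the left derivative is bounded by the slope over `[a / 2, w]`, an interval longer
    -- than `a / 2` on which the generator drops by at most `1`.
    refine intervalIntegral.tendsto_integral_filter_of_dominated_convergence (fun _ => 2 / a)
      (Eventually.of_forall fun n =>
        (hCs n).convexDecay.measurable_negLeftDeriv.aestronglyMeasurable)
      (Eventually.of_forall fun n => Eventually.of_forall fun w hw => ?_)
      intervalIntegrable_const ?_
    · rw [Set.uIoc_of_le hab] at hw
      have hcd := (hCs n).convexDecay
      rw [Real.norm_eq_abs, abs_of_nonneg (hcd.negLeftDeriv_nonneg w)]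
      refine (hcd.negLeftDeriv_le_slope (x := a / 2) (by linarith) (by linarith [hw.1])).trans ?_
      have h1 := (hGs n).apply_le_one (z := a / 2) (by linarith)
      have h2 := (hGs n).apply_nonneg (z := w) (by linarith [hw.1])
      rw [div_le_div_iff₀ (by linarith [hw.1]) ha]
      nlinarith [hw.1]
    · filter_upwards [hC.convexDecay.countable_not_continuousAt.ae_notMem volume] with w hw hwab
      rw [Set.uIoc_of_le hab] at hwab
      have hw0 : 0 < w := ha.trans hwab.1
      refine h w hw0 ?_
      by_contra hc
      exact hw ⟨hw0, hc⟩
  rcases hz.eq_or_lt with rfl | hz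
  · simp only [hG.map_zero, (hGs _).map_zero]
    exact tendsto_const_nhds
  · rcases le_total z 1 with h1 | h1
    · have := (hint z 1 hz h1).add_const (1 / 2)
      simpa only [hC.normalized, (hCs _).normalized, sub_add_cancel] using this
    · have := (hint 1 z one_pos h1).const_sub (1 / 2)
      simpa only [hC.normalized, (hCs _).normalized, sub_sub_cancel] using this

/-- The first derivative suffices: it is the case `m = 1` if `p ≥ 1`, and the left-derivative
condition if `p = 0`. -/
lemma tendsto_generator_of_derivatives (hC : C.IsArchimedeanWith ψ)
    (hCs : ∀ n, (Cs n).IsArchimedeanWith (ψs n))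
    (h1 : ∀ m : ℕ, 1 ≤ m → m ≤ p → ∀ z : ℝ, 0 < z →
        Tendsto (fun n => iteratedDeriv m (ψs n) z) atTop (𝓝 (iteratedDeriv m ψ z)))
    (h2 : ∀ z : ℝ, 0 < z → ContinuousAt (leftDeriv (iteratedDeriv p ψ)) z →
        Tendsto (fun n => leftDeriv (iteratedDeriv p (ψs n)) z) atTop
          (𝓝 (leftDeriv (iteratedDeriv p ψ) z))) {z : ℝ} (hz : 0 ≤ z) :
    Tendsto (fun n => ψs n z) atTop (𝓝 (ψ z)) := by
  refine hC.tendsto_generator_of_negLeftDeriv hCs (fun w hw hc => ?_) hz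
  rcases Nat.eq_zero_or_pos p with hp | hp
  · subst hp
    have := h2 w hw ((hC.continuousAt_leftDeriv_iteratedDeriv_iff le_rfl hw).2 hc)
    rw [hC.multiplyMonotone.leftDeriv_iteratedDeriv le_rfl hw] at this
    simp_rw [fun n => (hCs n).multiplyMonotone.leftDeriv_iteratedDeriv le_rfl hw] at this
    simpa using this.neg
  · have := h1 1 le_rfl hp w hw
    rw [hC.multiplyMonotone.iteratedDeriv_eq hp hw] at this
    simp_rw [fun n => (hCs n).multiplyMonotone.iteratedDeriv_eq hp hw] at this
    simpa using this.neg

/-! ### Weak convergence of the Markov kernels -/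

/-- The discontinuities are countable and `φ` is injective on `(0,1]`, so only countably many `x` in
`(0,1)` hit them. -/
lemma ae_continuousAt_negLeftDeriv (hC : C.IsArchimedeanWith ψ) {s : ℝ} (hs : 0 ≤ s) :
    ∀ᵐ x : I, ContinuousAt (negLeftDeriv ψ) (s + genInv ψ x) := by
  have hcount : {x : I | (0 < x ∧ x < 1) ∧
      ¬ContinuousAt (negLeftDeriv ψ) (s + genInv ψ x)}.Countable := by
    refine Set.MapsTo.countable_of_injOn (f := fun x => s + genInv ψ x) (fun x hx => ?_) ?_
      hC.convexDecay.countable_not_continuousAt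
    · exact ⟨by linarith [hC.isGenerator.genInv_pos hx.1.1 hx.1.2], hx.2⟩
    · intro x hx y hy hxy
      exact hC.isGenerator.genInv_injOn hx.1.1 hy.1.1 (add_left_cancel hxy)
  filter_upwards [hcount.ae_notMem volume, Measure.ae_ne volume (0 : I),
    Measure.ae_ne volume (1 : I)] with x hx h0 h1
  by_contra hc
  exact hx ⟨⟨lt_of_le_of_ne x.2.1 (Ne.symm h0), lt_of_le_of_ne x.2.2 h1⟩, hc⟩

lemma tendsto_inv_negLeftDeriv_genInv (hC : C.IsArchimedeanWith ψ)
    (hCs : ∀ n, (Cs n).IsArchimedeanWith (ψs n))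
    (h : ∀ z, 0 ≤ z → Tendsto (fun n => ψs n z) atTop (𝓝 (ψ z))) {x : I} (hx : 0 < x) (hx1 : x < 1)
    (hc : ContinuousAt (negLeftDeriv ψ) (genInv ψ x)) :
    Tendsto (fun n => (ENNReal.ofReal (negLeftDeriv (ψs n) (genInv (ψs n) x)))⁻¹) atTop
      (𝓝 (ENNReal.ofReal (negLeftDeriv ψ (genInv ψ x)))⁻¹) :=
  (ENNReal.tendsto_ofReal (hC.tendsto_iterate_succ_negLeftDeriv hCs h (Nat.zero_le p)
    (hC.isGenerator.genInv_pos hx hx1) (tendsto_genInv hC.isGenerator hx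
      (tendsto_pseudoInv_of_tendsto hC.isGenerator (fun n => (hCs n).isGenerator) h hx)) hc)).inv

lemma inv_negLeftDeriv_genInv_ne_top (hC : C.IsArchimedeanWith ψ) {x : I} (hx : 0 < x)
    (hx1 : x < 1) : (ENNReal.ofReal (negLeftDeriv ψ (genInv ψ x)))⁻¹ ≠ ∞ := by
  have h := hC.isGenerator
  have := h.negLeftDeriv_pos hC.convexDecay (h.genInv_pos hx hx1)
    (by rw [h.apply_genInv hx]; exact hx)
  simpa using this

lemma tendstoWeaklyConditional (hC : C.IsArchimedeanWith ψ)
    (hCs : ∀ n, (Cs n).IsArchimedeanWith (ψs n))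
    (h : ∀ z, 0 ≤ z → Tendsto (fun n => ψs n z) atTop (𝓝 (ψ z))) :
    TendstoWeaklyConditional Cs C := by
  have hG := hC.isGenerator
  have hinv : ∀ {x : I}, 0 < x → Tendsto (fun n => genInv (ψs n) x) atTop (𝓝 (genInv ψ x)) :=
    fun hx => tendsto_genInv hG hx
      (tendsto_pseudoInv_of_tendsto hG (fun n => (hCs n).isGenerator) h hx)
  -- The kernel formula fails on a null set depending on `y`; a countable dense set of corners
  -- leaves one null set. Avoiding `0` keeps `φ` finite at the corners.
  obtain ⟨D₀, hD₀c, hD₀, hbot, -⟩ := exists_countable_dense_no_bot_top I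
  let D : Set I := insert 1 D₀
  have hDpos : ∀ x ∈ D, 0 < x := by
    rintro x (rfl | hx)
    · exact zero_lt_one
    · refine lt_of_le_of_ne x.2.1 fun h0 => hbot x ?_ hx
      rw [← h0]
      exact fun y => y.2.1
  have hYc : (Set.univ.pi fun _ : Fin (p + 1) => D).Countable :=
    Set.countable_univ_pi fun _ => hD₀c.insert 1
  let P : I → Prop := fun x => ∀ y ∈ Set.univ.pi fun _ : Fin (p + 1) => D,
    Tendsto (fun n => (Cs n).kernelCdf x y) atTop (𝓝 (C.kernelCdf x y))
  have hP : ∀ᵐ x : I, P x := by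
    refine (ae_ball_iff hYc).2 fun y hy => ?_
    have hy0 : ∀ i, 0 < y i := fun i => hDpos _ (hy i (Set.mem_univ i))
    have hs0 : 0 ≤ ∑ i, genInv ψ (y i) := Finset.sum_nonneg fun i _ => genInv_nonneg _ _
    filter_upwards [hC.kernel_Iic_ae_eq hy0, ae_all_iff.2 fun n => (hCs n).kernel_Iic_ae_eq hy0,
      hC.ae_continuousAt_negLeftDeriv le_rfl, hC.ae_continuousAt_negLeftDeriv hs0,
      Measure.ae_ne volume (0 : I), Measure.ae_ne volume (1 : I)] with x hK hKs hc1 hc2 hx0 hx1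
    rw [zero_add] at hc1
    have hx0' : 0 < x := lt_of_le_of_ne x.2.1 (Ne.symm hx0)
    have hx1' : x < 1 := lt_of_le_of_ne x.2.2 hx1
    have hpos := hG.genInv_pos hx0' hx1'
    have hnum := ENNReal.tendsto_ofReal (hC.tendsto_iterate_succ_negLeftDeriv hCs h
      (Nat.zero_le p) (z := (∑ i, genInv ψ (y i)) + genInv ψ x) (by linarith)
      ((tendsto_finsetSum _ fun i _ => hinv (hy0 i)).add (hinv hx0')) hc2)
    have hmul := ENNReal.Tendsto.mul hnum
      (Or.inr (hC.inv_negLeftDeriv_genInv_ne_top hx0' hx1'))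
      (hC.tendsto_inv_negLeftDeriv_genInv hCs h hx0' hx1' hc1) (Or.inr ENNReal.ofReal_ne_top)
    have hK' : Tendsto (fun n => (Cs n).kernel x (Set.Iic y)) atTop (𝓝 (C.kernel x (Set.Iic y))) := by
      rw [hK]
      simp_rw [hKs]
      exact hmul
    exact (ENNReal.tendsto_toReal (measure_ne_top _ _)).comp hK'
  -- A measurable hull of the exceptional set avoids proving that `P` is measurable.
  refine ⟨(toMeasurable volume {x | ¬P x})ᶜ, (measurableSet_toMeasurable _ _).compl, ?_,
    fun x hx => ?_⟩
  · rw [C.map_eval 0, prob_compl_eq_one_iff (measurableSet_toMeasurable _ _), measure_toMeasurable]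
    exact hP
  · have hPx : P x := by
      by_contra hn
      exact hx (subset_toMeasurable _ _ hn)
    exact tendsto_probabilityMeasure_of_tendsto_Iic (D := D) (hD₀.mono (Set.subset_insert _ _))
      (Set.mem_insert _ _) fun y hy => hPx y fun i _ => hy i

/-! ### Convergence of the densities -/

/-- By Fubini: with the other coordinates fixed, the sum is injective in `u 0 > 0`, so it meets `N`
for countably many values only. -/
lemma ae_sum_genInv_notMem (h : IsArchimedeanGenerator ψ) {m : ℕ} {N : Set ℝ} (hN : N.Countable) :
    ∀ᵐ u : Fin (m + 1) → I, 0 < u 0 → ∑ i, genInv ψ (u i) ∉ N := by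
  have hmp : MeasurePreserving (fun q : (Fin m → I) × I => (Fin.cons q.2 q.1 : Fin (m + 1) → I))
      (volume.prod volume) volume := by
    have := (volume_preserving_piFinSuccAbove (fun _ : Fin (m + 1) => I) 0).symm.comp
      (Measure.measurePreserving_swap (μ := (volume : Measure (Fin m → I)))
        (ν := (volume : Measure I)))
    have e : (fun q : (Fin m → I) × I => (Fin.cons q.2 q.1 : Fin (m + 1) → I)) =
        ⇑(MeasurableEquiv.piFinSuccAbove (fun _ : Fin (m + 1) => I) 0).symm ∘ Prod.swap := by
      funext q
      simp [MeasurableEquiv.piFinSuccAbove, Fin.insertNthEquiv, Fin.insertNth_zero']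
    rw [e]
    exact this
  have hg := measurable_genInv ψ
  have hB : MeasurableSet {u : Fin (m + 1) → I | 0 < u 0 ∧ ∑ i, genInv ψ (u i) ∈ N} := by
    refine (measurableSet_lt measurable_const (measurable_pi_apply 0)).inter ?_
    have hsum : Measurable fun u : Fin (m + 1) → I => ∑ i, genInv ψ (u i) := by fun_prop
    exact hsum hN.measurableSet
  have hnull : volume {u : Fin (m + 1) → I | 0 < u 0 ∧ ∑ i, genInv ψ (u i) ∈ N} = 0 := by
    rw [← hmp.measure_preimage hB.nullMeasurableSet,
      Measure.measure_prod_null (hmp.measurable hB)]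
    refine Eventually.of_forall fun v => Set.Countable.measure_zero ?_ _
    refine Set.MapsTo.countable_of_injOn (t := N)
      (f := fun t => genInv ψ t + ∑ i, genInv ψ (v i)) (fun t ht => ?_) ?_ hN
    · simpa [Fin.sum_univ_succ] using ht.2
    · intro t ht t' ht' htt
      have h1 : 0 < t := by simpa using ht.1
      have h2 : 0 < t' := by simpa using ht'.1
      exact h.genInv_injOn h1 h2 (add_right_cancel htt)
  filter_upwards [measure_eq_zero_iff_ae_notMem.1 hnull] with u hu h0 hmem using hu ⟨h0, hmem⟩

lemma tendsto_firstMarginalDensity (hC : C.IsArchimedeanWith ψ)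
    (hCs : ∀ n, (Cs n).IsArchimedeanWith (ψs n))
    (h : ∀ z, 0 ≤ z → Tendsto (fun n => ψs n z) atTop (𝓝 (ψ z))) (hp : 1 ≤ p) {k : ℕ}
    (hk : k + 1 ≤ p + 1) (hkd : k + 1 ≤ p + 2) :
    ∀ᵐ x : Fin (k + 1) → I, Tendsto (fun n => (Cs n).firstMarginalDensity (k + 1) hkd x) atTop
      (𝓝 (C.firstMarginalDensity (k + 1) hkd x)) := by
  have hG := hC.isGenerator
  have hinv : ∀ {x : I}, 0 < x → Tendsto (fun n => genInv (ψs n) x) atTop (𝓝 (genInv ψ x)) :=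
    fun hx => tendsto_genInv hG hx
      (tendsto_pseudoInv_of_tendsto hG (fun n => (hCs n).isGenerator) h hx)
  have hne : ∀ c : I, ∀ᵐ x : Fin (k + 1) → I, ∀ i, x i ≠ c := fun c =>
    ae_all_iff.2 fun i => (measurePreserving_eval (fun _ : Fin (k + 1) => (volume : Measure I))
      i).quasiMeasurePreserving.ae (Measure.ae_ne volume c)
  have hcount := (hC.convexDecay_iterate (k := k) (by omega)).countable_not_continuousAt
  filter_upwards [hC.firstMarginalDensity_ae_eq hk hkd,
    ae_all_iff.2 fun n => (hCs n).firstMarginalDensity_ae_eq hk hkd, hne 0, hne 1,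
    ae_sum_genInv_notMem hG hcount] with x hx hxs h0 h1 hsum
  have hx0 : ∀ i, 0 < x i := fun i => lt_of_le_of_ne (x i).2.1 (Ne.symm (h0 i))
  have hx1 : ∀ i, x i < 1 := fun i => lt_of_le_of_ne (x i).2.2 (h1 i)
  have hpos : ∀ i, 0 < genInv ψ (x i) := fun i => hG.genInv_pos (hx0 i) (hx1 i)
  have hS : 0 < ∑ i, genInv ψ (x i) := Finset.sum_pos (fun i _ => hpos i) Finset.univ_nonempty
  have hc : ContinuousAt (negLeftDeriv^[k + 1] ψ) (∑ i, genInv ψ (x i)) := by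
    rw [Function.iterate_succ']
    by_contra hn
    exact hsum (hx0 0) ⟨hS, hn⟩
  rw [hx]
  simp_rw [hxs, archDensity, zero_add]
  have hnum := ENNReal.tendsto_ofReal (hC.tendsto_iterate_succ_negLeftDeriv hCs h
    (show k ≤ p by omega) hS (tendsto_finsetSum _ fun i _ => hinv (hx0 i)) hc)
  -- Here `p ≥ 1` enters: the first derivative is continuous on `(0,∞)`, so the denominators need no
  -- further exceptional set.
  have hprod := ENNReal.tendsto_finsetProd_of_ne_top Finset.univ
    (fun i _ => hC.tendsto_inv_negLeftDeriv_genInv hCs h (hx0 i) (hx1 i)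
      (hC.continuousAt_iterate hp (hpos i)))
    (fun i _ => hC.inv_negLeftDeriv_genInv_ne_top (hx0 i) (hx1 i))
  exact ENNReal.Tendsto.mul hnum
    (Or.inr (ENNReal.prod_ne_top fun i _ => hC.inv_negLeftDeriv_genInv_ne_top (hx0 i) (hx1 i)))
    hprod (Or.inr ENNReal.ofReal_ne_top)

lemma setLIntegral_firstMarginalDensity (hC : C.IsArchimedeanWith ψ) {k : ℕ}
    (hk : k + 1 ≤ p + 1) (hkd : k + 1 ≤ p + 2) {A : Set (Fin (k + 1) → I)} (hA : MeasurableSet A) :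
    ∫⁻ x in A, C.firstMarginalDensity (k + 1) hkd x = C.firstMarginal (k + 1) hkd A := by
  rw [setLIntegral_congr_fun_ae hA ((hC.firstMarginalDensity_ae_eq hk hkd).mono fun x hx _ => hx),
    hC.firstMarginal_eq_withDensity hk hkd, withDensity_apply _ hA]

/-- Scheffé's argument: Fatou gives the lower bound on `A` and on `Aᶜ`, and equal total masses turn
the latter into the upper bound on `A`. Absolute continuity is needed for the limit only. -/
lemma tendsto_firstMarginal_of_density (hC : C.IsArchimedeanWith ψ) {k : ℕ}
    (hk : k + 1 ≤ p + 1) (hkd : k + 1 ≤ p + 2)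
    (h : ∀ᵐ x : Fin (k + 1) → I, Tendsto (fun n => (Cs n).firstMarginalDensity (k + 1) hkd x) atTop
      (𝓝 (C.firstMarginalDensity (k + 1) hkd x))) {A : Set (Fin (k + 1) → I)}
    (hA : MeasurableSet A) :
    Tendsto (fun n => (Cs n).firstMarginal (k + 1) hkd A) atTop
      (𝓝 (C.firstMarginal (k + 1) hkd A)) := by
  have hprob : ∀ B : Copula (p + 2), IsProbabilityMeasure (B.firstMarginal (k + 1) hkd) := fun B =>
    Measure.isProbabilityMeasure_map
      (measurable_pi_lambda _ fun i => measurable_pi_apply _).aemeasurable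
  have hle : ∀ A : Set (Fin (k + 1) → I), MeasurableSet A →
      C.firstMarginal (k + 1) hkd A ≤ liminf (fun n => (Cs n).firstMarginal (k + 1) hkd A) atTop := by
    intro A hA
    calc C.firstMarginal (k + 1) hkd A
        = ∫⁻ x in A, C.firstMarginalDensity (k + 1) hkd x :=
          (hC.setLIntegral_firstMarginalDensity hk hkd hA).symm
      _ = ∫⁻ x in A, liminf (fun n => (Cs n).firstMarginalDensity (k + 1) hkd x) atTop :=
          setLIntegral_congr_fun_ae hA (h.mono fun x hx _ => hx.liminf_eq.symm)
      _ ≤ liminf (fun n => ∫⁻ x in A, (Cs n).firstMarginalDensity (k + 1) hkd x) atTop :=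
          lintegral_liminf_le fun n => Measure.measurable_rnDeriv _ _
      _ ≤ liminf (fun n => (Cs n).firstMarginal (k + 1) hkd A) atTop :=
          liminf_le_liminf (Eventually.of_forall fun n => Measure.setLIntegral_rnDeriv_le A)
  exact tendsto_of_le_liminf_of_limsup_le (hle A hA)
    (limsup_measure_le_of_le_liminf_measure_compl hA (hle Aᶜ hA.compl))

end Copula.IsArchimedeanWith

lemma Copula.pairMarginal_eq_firstMarginal {p : ℕ} (C : Copula (p + 2)) (hd : 2 ≤ p + 2)
    (q : I × I) :
    C.pairMarginal 0 1 q = (C.firstMarginal 2 hd).real (Set.Iic ![q.1, q.2]) := by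
  rw [pairMarginal, Copula.cdf, firstMarginal,
    map_measureReal_apply (by fun_prop) (measurableSet_Iic_pi _)]
  congr 1
  ext u
  have e : Fin.castLE hd 1 = 1 := rfl
  simp only [Set.mem_Iic, Set.mem_preimage, Pi.le_def, Fin.forall_fin_two, e]
  constructor
  · intro h
    exact ⟨by simpa using h 0, by simpa using h 1⟩
  · rintro ⟨h0, h1⟩ i
    by_cases hi : i = 1
    · subst hi
      simpa using h1
    · by_cases hi' : i = 0
      · subst hi'
        simpa using h0
      · rw [Function.update_of_ne hi, Function.update_of_ne hi']
        exact (u i).2.2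

/-! ### The equivalences -/

theorem theorem4p3 (p : ℕ) (C : Copula (p + 2)) (Cs : ℕ → Copula (p + 2))
    (ψ : ℝ → ℝ) (ψs : ℕ → ℝ → ℝ)
    (hC : C.IsArchimedeanWith ψ) (hCs : ∀ n, (Cs n).IsArchimedeanWith (ψs n)) :
    -- the dimension is `d = p + 2 ≥ 2`
    List.TFAE [
      -- uniform convergence
      TendstoUniformly (fun n => (Cs n).cdf) C.cdf atTop,
      -- uniform convergence of all bivariate marginals
      ∀ i j : Fin (p + 2), i < j →
        TendstoUniformly (fun n => (Cs n).pairMarginal i j) (C.pairMarginal i j) atTop,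
      -- pointwise convergence of the inverse generators on `(0,1]`
      ∀ x : I, 0 < x →
        Tendsto (fun n => pseudoInv (ψs n) x) atTop (𝓝 (pseudoInv ψ x)),
      -- uniform convergence of the generators on `[0,∞)`
      TendstoUniformlyOn ψs ψ atTop (Set.Ici 0),
      -- pointwise convergence of the derivatives of the generators
      (∀ m : ℕ, 1 ≤ m → m ≤ p → ∀ z : ℝ, 0 < z →
          Tendsto (fun n => iteratedDeriv m (ψs n) z) atTop (𝓝 (iteratedDeriv m ψ z))) ∧
        (∀ z : ℝ, 0 < z → ContinuousAt (leftDeriv (iteratedDeriv p ψ)) z →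
          Tendsto (fun n => leftDeriv (iteratedDeriv p (ψs n)) z) atTop
            (𝓝 (leftDeriv (iteratedDeriv p ψ) z))),
      -- convergence with respect to `D₁`
      Tendsto (fun n => Copula.D1 (Cs n) C) atTop (𝓝 0),
      -- convergence with respect to `D₂`
      Tendsto (fun n => Copula.D2 (Cs n) C) atTop (𝓝 0),
      -- convergence with respect to `D_∞`
      Tendsto (fun n => Copula.DInf (Cs n) C) atTop (𝓝 0),
      -- 1-weak conditional convergence
      Copula.TendstoWeaklyConditional Cs C] ∧
    -- for `d ≥ 3` also almost everywhere convergence of the densities of the marginals `C^{1:m}`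
    (1 ≤ p →
      (TendstoUniformly (fun n => (Cs n).cdf) C.cdf atTop ↔
        ∀ (m : ℕ) (_ : 2 ≤ m) (hm : m ≤ p + 1), ∀ᵐ x : Fin m → I,
          Tendsto (fun n => (Cs n).firstMarginalDensity m (hm.trans (Nat.le_succ _)) x) atTop
            (𝓝 (C.firstMarginalDensity m (hm.trans (Nat.le_succ _)) x)))) := by
  have hG := hC.isGenerator
  have hGs := fun n => (hCs n).isGenerator
  have h01 : (0 : Fin (p + 2)) < 1 := by simp
  have hpair : (∀ q, Tendsto (fun n => (Cs n).pairMarginal 0 1 q) atTop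
      (𝓝 (C.pairMarginal 0 1 q))) → ∀ z, 0 ≤ z → Tendsto (fun n => ψs n z) atTop (𝓝 (ψ z)) :=
    fun h z hz => hC.tendsto_generator_of_pairMarginal hCs h01.ne h hz
  have hcdf : (∀ z, 0 ≤ z → Tendsto (fun n => ψs n z) atTop (𝓝 (ψ z))) →
      TendstoUniformly (fun n => (Cs n).cdf) C.cdf atTop := fun h =>
    Copula.tendstoUniformly_cdf fun x => hC.tendsto_cdf_of_generator hCs h x
  have hgen : TendstoUniformlyOn ψs ψ atTop (Set.Ici 0) →
      ∀ z, 0 ≤ z → Tendsto (fun n => ψs n z) atTop (𝓝 (ψ z)) := fun h z hz => h.tendsto_at hz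
  have hgenU : (∀ z, 0 ≤ z → Tendsto (fun n => ψs n z) atTop (𝓝 (ψ z))) →
      TendstoUniformlyOn ψs ψ atTop (Set.Ici 0) := tendstoUniformlyOn_of_tendsto hG hGs
  have hcdfgen : TendstoUniformly (fun n => (Cs n).cdf) C.cdf atTop →
      ∀ z, 0 ≤ z → Tendsto (fun n => ψs n z) atTop (𝓝 (ψ z)) := fun h =>
    hpair fun q => h.tendsto_at _
  constructor
  · tfae_have 1 → 2 := fun h i j _ => h.comp _
    -- One pair of coordinates is enough, since all bivariate marginals of an Archimedean copula
    -- share the generator.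
    tfae_have 2 → 4 := fun h => hgenU (hpair fun q => (h 0 1 h01).tendsto_at q)
    tfae_have 4 → 1 := fun h => hcdf (hgen h)
    tfae_have 4 → 3 := fun h x hx => tendsto_pseudoInv_of_tendsto hG hGs (hgen h) hx
    tfae_have 3 → 4 := fun h => hgenU fun z hz =>
      tendsto_of_tendsto_genInv hG hGs (fun x hx => tendsto_genInv hG hx (h x hx)) hz
    tfae_have 4 → 5 := fun h => hC.tendsto_derivatives hCs (hgen h)
    tfae_have 5 → 4 := fun h => hgenU fun z hz =>
      hC.tendsto_generator_of_derivatives hCs h.1 h.2 hz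
    tfae_have 4 → 9 := fun h => hC.tendstoWeaklyConditional hCs (hgen h)
    tfae_have 9 → 8 := fun h =>
      Copula.tendsto_DInf (Copula.tendsto_kernelDist_of_weaklyConditional h)
    tfae_have 8 → 6 := fun h =>
      squeeze_zero (fun _ => Copula.D1_nonneg _ _) (fun _ => Copula.D1_le_DInf _ _) h
    tfae_have 6 → 7 := fun h => squeeze_zero (fun _ => Real.sqrt_nonneg _)
      (fun _ => Copula.D2_le_sqrt_D1 _ _) (by simpa using h.sqrt)
    tfae_have 7 → 6 := fun h =>
      squeeze_zero (fun _ => Copula.D1_nonneg _ _) (fun _ => Copula.D1_le_D2 _ _) h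
    tfae_have 6 → 1 := fun h =>
      Copula.tendstoUniformly_cdf_of_kernelDist (Copula.tendsto_kernelDist_of_D1 h)
    tfae_finish
  · intro hp
    refine ⟨fun h m hm2 hm => ?_, fun h => hcdf (hpair fun q => ?_)⟩
    · obtain ⟨k, rfl⟩ : ∃ k, m = k + 1 := ⟨m - 1, by omega⟩
      exact hC.tendsto_firstMarginalDensity hCs (hcdfgen h) hp hm _
    -- The case `m = 2` suffices: its density determines the marginal of the coordinates `0` and
    -- `1`. It is available because `2 ≤ p + 1`.
    · have hd : 2 ≤ p + 2 := by omega
      have := hC.tendsto_firstMarginal_of_density (show 1 + 1 ≤ p + 1 by omega) hd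
        (h 2 le_rfl (by omega)) (measurableSet_Iic_pi ![q.1, q.2])
      simp_rw [Copula.pairMarginal_eq_firstMarginal _ hd, measureReal_def]
      have hfin : IsFiniteMeasure (C.firstMarginal 2 hd) := by
        unfold Copula.firstMarginal; infer_instance
      exact (ENNReal.tendsto_toReal (measure_ne_top _ _)).comp this
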